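/- Conventions. A permutation $\sigma\in S_n$ is a shuffle if, for some $k$, $\sigma(1)<\dots<\sigma(k)$ and $\sigma(k+1)<\dots<\sigma(n)$; if $\sigma$ has no fixed points and $n\ge 1$, its Lorenz vector is $\langle\sigma(1)-1,\dots,\sigma(k)-k\rangle$. The diagonal link $\mathrm{diag}(\sigma)$, also denoted $\mathrm{diag}(v)$ where $v$ is the Lorenz vector of $\sigma$, is the oriented link in $\mathbb{R}^3$ whose grid diagram (vertical edges pass over horizontal ones) has the vertices $(i,i)$ and $(i,\sigma(i))$, $1\le i\le n$; the vertical edge with $x$-coordinate $i$ is oriented from $(i,i)$ to $(i,\sigma(i))$ and the horizontal edge with $y$-coordinate $\sigma(i)$ from $(i,\sigma(i))$ to $(\sigma(i),\sigma(i))$. For integers $s\ge 1$, $1\le p_1<\dots<p_s$ and $q_1,\dots,q_s\ge 1$, let $\langle p_1^{q_1},\dots,p_s^{q_s}\rangle$ be the vector in which $p_1$ is repeated $q_1$ times, then $p_2$ is repeated $q_2$ times, and so on, and let the twisted link (T-link) $T((p_1,q_1),\dots,(p_s,q_s))$ be the closure, with the orientation of the braid, of the braid on $p_s$ strings $$(\sigma_1\sigma_2\cdots\sigma_{p_1-1})^{q_1}(\sigma_1\sigma_2\cdots\sigma_{p_2-1})^{q_2}\cdots(\sigma_1\sigma_2\cdots\sigma_{p_s-1})^{q_s}.$$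 Here braids run from left to right, their strings are numbered from bottom to top, and in $\sigma_i$ the string going from position $i$ to position $i+1$ passes over the string going from $i+1$ to $i$. Theorem 2. Up to isotopy of oriented links in $\mathbb{R}^3$, the class of diagonal links (of shuffles without fixed points) coincides with the class of twisted links. Precisely, for all integers $s\ge 1$, $1\le p_1<\dots<p_s$ and $q_1,\dots,q_s\ge 1$, the vector $\langle p_1^{q_1},\dots,p_s^{q_s}\rangle$ is the Lorenz vector of a shuffle without fixed points, and for each such shuffle the diagonal link $\mathrm{diag}(\langle p_1^{q_1},\dots,p_s^{q_s}\rangle)$ is isotopic to the T-link $T((p_1,q_1),\dots,(p_s,q_s))$. -/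

import Mathlib

/-! ### Oriented polygonal links in three-space and isotopy -/

/-- Three-space with coordinates `(x, y, z)`; only its topology and affine structure are used.
Pictures are drawn in the `xy`-plane and are viewed from `z = +∞`, so that at a crossing the strand
with the larger `z` is the over-strand. -/
abbrev Space : Type := ℝ × ℝ × ℝ

/-- A finite family of oriented closed polygons: finitely many vertices, each with a position, and
a permutation giving the next vertex. There is one closed polygon for each cycle of `next`. -/
structure PolygonalCurve where
  /-- the set of vertices -/
  Vertex : Type
  /-- there are finitely many vertices -/
  finite : Finite Vertex
  /-- the oriented edge at `v` runs from `v` to `next v` -/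
  next : Equiv.Perm Vertex
  /-- the position of a vertex -/
  pos : Vertex → Space

namespace PolygonalCurve

/-- The oriented edge at the vertex `v`, parametrized affinely by `t ∈ [0, 1]`. -/
noncomputable def edge (K : PolygonalCurve) (v : K.Vertex) (t : ℝ) : Space :=
  AffineMap.lineMap (K.pos v) (K.pos (K.next v)) t

/-- The set of points of the curve. -/
def carrier (K : PolygonalCurve) : Set Space :=
  {x | ∃ v : K.Vertex, ∃ t ∈ Set.Icc (0 : ℝ) 1, x = K.edge v t}

/-- The periodic parametrization, in the direction of the orientation and with one unit of time for
each edge, of the closed polygon through `v`. -/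
noncomputable def param (K : PolygonalCurve) (v : K.Vertex) (t : ℝ) : Space :=
  K.edge ((K.next ^ ⌊t⌋) v) (Int.fract t)

/-- An oriented (polygonal) link: the closed polygons are simple and pairwise disjoint. -/
def IsLink (K : PolygonalCurve) : Prop :=
  ∀ u v : K.Vertex, ∀ s ∈ Set.Ico (0 : ℝ) 1, ∀ t ∈ Set.Ico (0 : ℝ) 1,
    K.edge u s = K.edge v t → u = v ∧ s = t

/-- The homeomorphism `h` takes `K` onto `K'`, and each closed polygon of `K` onto one of `K'` in
an orientation-preserving way. -/
def Carries (h : Space ≃ₜ Space) (K K' : PolygonalCurve) : Prop :=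
  h '' K.carrier = K'.carrier ∧
    ∀ v : K.Vertex, ∃ v' : K'.Vertex, ∃ φ : ℝ ≃o ℝ, ∀ t : ℝ, h (K.param v t) = K'.param v' (φ t)

/-- Two oriented links are isotopic: an ambient isotopy of three-space takes the first
to the second, with orientations. -/
def Isotopic (K K' : PolygonalCurve) : Prop :=
  K.IsLink ∧ K'.IsLink ∧
    ∃ H : unitInterval → (Space ≃ₜ Space),
      Continuous (fun a : unitInterval × Space => H a.1 a.2) ∧
      H 0 = Homeomorph.refl Space ∧ Carries (H 1) K K'

end PolygonalCurve

/-! ### Shuffles, Lorenz vectors and diagonal links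

The set `{1, …, n}` is `Fin n`, with `i : Fin n` standing for the number `i + 1`. -/

/-- `σ` is a shuffle with parameter `k`: `σ(1) < ⋯ < σ(k)` and `σ(k+1) < ⋯ < σ(n)`. -/
def IsShuffle {n : ℕ} (σ : Equiv.Perm (Fin n)) (k : ℕ) : Prop :=
  k ≤ n ∧ StrictMonoOn σ {i : Fin n | (i : ℕ) < k} ∧ StrictMonoOn σ {i : Fin n | k ≤ (i : ℕ)}

/-- The vector `⟨σ(1) - 1, …, σ(k) - k⟩`. For a shuffle with parameter `k` one has `i ≤ σ(i)` for
`i ≤ k`, so that no subtraction is truncated. -/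
def lorenzVector {n : ℕ} (σ : Equiv.Perm (Fin n)) (k : ℕ) : List ℕ :=
  ((List.finRange n).take k).map fun i => (σ i : ℕ) - (i : ℕ)

/-- The link with grid diagram `(1,1), …, (n,n), (1,σ(1)), …, (n,σ(n))`. As in every grid diagram
the vertical edges pass over the horizontal ones: vertical edges are placed at `z = 1`, horizontal
ones at `z = 0`, and they are joined by segments parallel to the `z`-axis. The polygon runs
`(i,i,0) → (i,i,1) → (i,σ(i),1) → (i,σ(i),0) → (σ(i),σ(i),0)`, so that the vertical edge at `x = i`
is oriented upwards if `σ(i) > i` and downwards otherwise. -/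
def diagLink {n : ℕ} (σ : Equiv.Perm (Fin n)) : PolygonalCurve where
  Vertex := Fin 4 × Fin n
  finite := inferInstance
  next := Equiv.prodShear (finRotate 4) fun c => if c = 3 then σ else 1
  pos := fun v =>
    let i : ℝ := ((v.2 : ℕ) : ℝ) + 1
    let j : ℝ := ((σ v.2 : ℕ) : ℝ) + 1
    (![(i, i, 0), (i, i, 1), (i, j, 1), (i, j, 0)] : Fin 4 → Space) v.1

/-! ### Closed braids and T-links

A positive braid word is a list of natural numbers, with `i` standing for the Artin generator `σ_i`.
The strings run to the right and their positions `1, …, n` are numbered from bottom to top. -/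

/-- The transposition of the positions `i` and `i + 1` among `1, …, n` induced by `σ_i`. -/
def artinPerm (n i : ℕ) : Equiv.Perm (Fin n) :=
  if h : 1 ≤ i ∧ i < n then Equiv.swap ⟨i - 1, by omega⟩ ⟨i, h.2⟩ else 1

/-- In the closed braid below, string positions change on the way out of column `2 m + 1`, by the
transposition of the `m`-th letter (counted from `0`), and stay the same in all other columns. -/
def columnPerm (n : ℕ) (w : List ℕ) (c : ℕ) : Equiv.Perm (Fin n) :=
  if h : c % 2 = 1 ∧ c / 2 < w.length then artinPerm n w[c / 2] else 1

/-- The closure of the braid on `n` strings given by the positive word `w`, of length `N`.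

The `m`-th letter (counted from `0`) occupies `m ≤ x ≤ m + 1`. The string that starts there in
position `j` and ends in position `j'` is the broken line
`(m, j, 0) → (m + 1/2, (j + j')/2, z) → (m + 1, j', 0)`, with `z = 1` if it moves up (`j < j'`) and
`z = 0` otherwise. Thus in `σ_i` the string that moves from position `i` to position `i + 1` passes
over the one that moves from `i + 1` to `i`.

The closing strings `(N, j, 0) → (N + 1, j, -1) → (-1, j, -1) → (0, j, 0)` lie in the parallel planes
`y = j`, behind the braid, so that the closed braid winds around an axis parallel to the `y`-axis.

Column `c ≤ 2 N` of vertices is at `x = c / 2`; columns `2 N + 1` and `2 N + 2` are those of the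
closing strings. -/
noncomputable def closedBraid (n : ℕ) (w : List ℕ) : PolygonalCurve where
  Vertex := Fin (2 * w.length + 3) × Fin n
  finite := inferInstance
  next := Equiv.prodShear (finRotate (2 * w.length + 3)) fun c => columnPerm n w c
  pos := fun v =>
    let c : ℕ := v.1
    let j : ℝ := ((v.2 : ℕ) : ℝ) + 1
    let j' : ℝ := ((columnPerm n w c v.2 : ℕ) : ℝ) + 1
    if c = 2 * w.length + 2 then (-1, j, -1)
    else if c = 2 * w.length + 1 then ((w.length : ℝ) + 1, j, -1)
    else ((c : ℝ) / 2, (j + j') / 2, if j < j' then 1 else 0)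

/-- The lists `(p₁, q₁), …, (p_s, q_s)` with `s ≥ 1`, `1 ≤ p₁ < ⋯ < p_s` and all `q_i ≥ 1`. -/
def IsTwistData (L : List (ℕ × ℕ)) : Prop :=
  L ≠ [] ∧ (L.map Prod.fst).Pairwise (· < ·) ∧ ∀ a ∈ L, 1 ≤ a.1 ∧ 1 ≤ a.2

/-- The vector `⟨p₁^{q₁}, …, p_s^{q_s}⟩`, in which `p_i` is repeated `q_i` times. -/
def expandVector (L : List (ℕ × ℕ)) : List ℕ :=
  L.flatMap fun a => List.replicate a.2 a.1

/-- The braid word `(σ₁ ⋯ σ_{p₁-1})^{q₁} ⋯ (σ₁ ⋯ σ_{p_s-1})^{q_s}`. -/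
def twistWord (L : List (ℕ × ℕ)) : List ℕ :=
  L.flatMap fun a => (List.replicate a.2 (List.range' 1 (a.1 - 1))).flatten

/-- The T-link `T((p₁, q₁), …, (p_s, q_s))`, the closure of a braid on `p_s` strings. -/
noncomputable def tLink (L : List (ℕ × ℕ)) : PolygonalCurve :=
  closedBraid ((L.map Prod.fst).getLastD 0) (twistWord L)

/-- `K` belongs to the class of diagonal links: it is isotopic to the link `diag(σ)` of a
shuffle `σ ∈ S_n`, `n ≥ 1`, without fixed points. -/
def IsDiagonalLink (K : PolygonalCurve) : Prop :=
  ∃ n : ℕ, 0 < n ∧ ∃ (σ : Equiv.Perm (Fin n)) (k : ℕ),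
    IsShuffle σ k ∧ (∀ i, σ i ≠ i) ∧ PolygonalCurve.Isotopic K (diagLink σ)

/-- `K` belongs to the class of twisted links. -/
def IsTwistedLink (K : PolygonalCurve) : Prop :=
  ∃ L : List (ℕ × ℕ), IsTwistData L ∧ PolygonalCurve.Isotopic K (tLink L)

/-!
A diagonal link becomes a closed braid when its arcs below the diagonal are swung around behind the
arcs above the diagonal. All isotopies are obtained from two principles for polygonal curves.

* If the vertices of a curve move in straight lines and the curve is a link at all times, then the
  initial and the final link are isotopic (`PolygonalCurve.isotopic_of_forall_isLink`). For a short
  time the displacement is Lipschitz on the link, with a small constant. It extends to a contraction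
  of three-space, since Lipschitz functions with values in a maximum norm extend, and the identity
  plus a contraction is a homeomorphism. Long times are reached by connectedness of the interval.
* A curve is isotopic to each of its subdivisions (`PolygonalCurve.Subdivides.isotopic`), because
  the two have the same oriented closed polygons.

Let `σ` be a shuffle with Lorenz vector `⟨d 1, …, d k⟩`. The diagram of `diagLink σ` consists of one
arc for each `i`, from the diagonal point `i` to the diagonal point `σ i`. The arcs above the
diagonal are those with `i ≤ k`. Three straight-line motions take the link to a closed form: the
arcs below the diagonal are stretched behind the diagram as far as the plane `x = 0`, their vertical
edges are lowered behind the others, and finally they are made into parallel closing strings while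
the arcs above the diagonal are tilted so that they run to the right
(`ArcCurve.isotopic_diagLink_closed`).

In the closed form all edges in front run to the right. Cut by the planes in which `x` is constant
it is a closed braid on `n - k = d k` strings: the lowest string turns up at the abscissa of arc `i`
and crosses over the next `d i - 1` strings, that is, it contributes the factor `σ₁ ⋯ σ_{d i - 1}`.
For the proof, a subdivision of the closed form (`LorenzData.subdivides_braidPos`) is compared with
the standard closed braid of the same word, in which trivial letters have been inserted to make room
for the turning points (`ColumnPos.isotopic_filter_zero`). The two are related by a
straight-line motion through links: for any two strings and between any two neighbouring columns
there is one linear form in `y` and `z` that separates the strings in both closed braids, and hence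
at all times in between (`ColumnPos.isotopic_of_sepAt`, `LorenzData.isotopic_ofWord_braidPos`).

It remains to see that the vectors that occur on both sides are the same. A shuffle without fixed
points moves `1, …, k` up and the other points down, is determined by its Lorenz vector, and every
nonempty nondecreasing vector of positive integers occurs (`exists_lorenzData`,
`IsShuffle.exists_lorenzData`). Grouping equal entries turns such vectors into the exponents of
T-links (`exists_expandVector_eq`, `twistWord_eq`).
-/

/-! ### Isotopy of oriented polygonal links -/

namespace PolygonalCurve

variable {K K' K'' : PolygonalCurve}

lemma edge_zero (K : PolygonalCurve) (v : K.Vertex) : K.edge v 0 = K.pos v := by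
  simp [edge]

lemma edge_one (K : PolygonalCurve) (v : K.Vertex) : K.edge v 1 = K.pos (K.next v) := by
  simp [edge]

lemma edge_eq (K : PolygonalCurve) (v : K.Vertex) (t : ℝ) :
    K.edge v t = (1 - t) • K.pos v + t • K.pos (K.next v) := by
  rw [edge, AffineMap.lineMap_apply_module]

lemma param_add_int (K : PolygonalCurve) (v : K.Vertex) (t : ℝ) (m : ℤ) :
    K.param v (t + m) = K.param ((K.next ^ m) v) t := by
  simp only [param, Int.floor_add_intCast, Int.fract_add_intCast, zpow_add, Equiv.Perm.mul_apply]

lemma param_of_mem_Ico (K : PolygonalCurve) (v : K.Vertex) {t : ℝ} (ht : t ∈ Set.Ico (0 : ℝ) 1) :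
    K.param v t = K.edge v t := by
  have h0 : ⌊t⌋ = 0 := Int.floor_eq_zero_iff.2 ht
  simp [param, h0, Int.fract]

lemma param_zero (K : PolygonalCurve) (v : K.Vertex) : K.param v 0 = K.pos v := by
  rw [param_of_mem_Ico _ _ (by simp), edge_zero]

lemma param_mem_carrier (K : PolygonalCurve) (v : K.Vertex) (t : ℝ) : K.param v t ∈ K.carrier :=
  ⟨_, _, ⟨Int.fract_nonneg t, (Int.fract_lt_one t).le⟩, rfl⟩

/-- Every point of the curve lies on a half-open edge. -/
lemma exists_edge_of_mem_carrier {x : Space} (hx : x ∈ K.carrier) :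
    ∃ v : K.Vertex, ∃ t ∈ Set.Ico (0 : ℝ) 1, x = K.edge v t := by
  obtain ⟨v, t, ht, rfl⟩ := hx
  rcases ht.2.lt_or_eq with h | rfl
  · exact ⟨v, t, ⟨ht.1, h⟩, rfl⟩
  · exact ⟨K.next v, 0, by simp, by rw [edge_one, edge_zero]⟩

lemma Carries.trans {g h : Space ≃ₜ Space} (hg : Carries g K K') (hh : Carries h K' K'') :
    Carries (g.trans h) K K'' := by
  refine ⟨?_, fun v => ?_⟩
  · rw [← hh.1, ← hg.1, Set.image_image]; rfl
  · obtain ⟨v', φ, hφ⟩ := hg.2 v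
    obtain ⟨v'', ψ, hψ⟩ := hh.2 v'
    exact ⟨v'', φ.trans ψ, fun t => by simp [hφ, hψ]⟩

/-- Every vertex `v'` of `K'` is the image of a point of `K`, and as `K'` is a link, the polygon of
`K'` that this point runs along is that of `v'`, up to a shift of the parameter by an integer. -/
lemma Carries.symm {h : Space ≃ₜ Space} (hh : Carries h K K') (hK' : K'.IsLink) :
    Carries h.symm K' K := by
  refine ⟨?_, fun v' => ?_⟩
  · rw [← hh.1, Set.image_image]; simp
  · have hmem : K'.pos v' ∈ K'.carrier := by
      rw [← param_zero]; exact param_mem_carrier _ _ _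
    rw [← hh.1] at hmem
    obtain ⟨x, hx, hxv⟩ := hmem
    obtain ⟨v, s, hs, rfl⟩ := exists_edge_of_mem_carrier hx
    obtain ⟨w, φ, hφ⟩ := hh.2 v
    have h1 := hφ s
    rw [param_of_mem_Ico _ _ hs, hxv, ← edge_zero, param] at h1
    obtain ⟨h2, h3⟩ := hK' _ _ 0 (by simp) _ ⟨Int.fract_nonneg _, Int.fract_lt_one _⟩ h1
    refine ⟨v, (OrderIso.addRight ((⌊φ s⌋ : ℤ) : ℝ)).trans φ.symm, fun t => ?_⟩
    rw [Homeomorph.symm_apply_eq, hφ]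
    simp [param_add_int, ← h2]

lemma Isotopic.refl (hK : K.IsLink) : Isotopic K K :=
  ⟨hK, hK, fun _ => Homeomorph.refl _, continuous_snd, rfl, by simp,
    fun v => ⟨v, OrderIso.refl ℝ, fun _ => rfl⟩⟩

lemma Isotopic.trans (h : Isotopic K K') (h' : Isotopic K' K'') : Isotopic K K'' := by
  obtain ⟨hK, _, H, hc, h0, h1⟩ := h
  obtain ⟨_, hK'', H', hc', h0', h1'⟩ := h'
  refine ⟨hK, hK'', fun a => (H a).trans (H' a), ?_, ?_, h1.trans h1'⟩
  · exact hc'.comp (continuous_fst.prodMk hc)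
  · simp only [h0, h0']; rfl

/-- The inverse isotopy is `a ↦ H (1 - a) ∘ (H 1)⁻¹`, whose joint continuity needs no continuity of
`a ↦ (H a)⁻¹`. -/
lemma Isotopic.symm (h : Isotopic K K') : Isotopic K' K := by
  obtain ⟨hK, hK', H, hc, h0, h1⟩ := h
  refine ⟨hK', hK, fun a => (H 1).symm.trans (H (unitInterval.symm a)), ?_, ?_, ?_⟩
  · exact hc.comp ((unitInterval.continuous_symm.comp continuous_fst).prodMk
      ((H 1).symm.continuous.comp continuous_snd))
  · simp
  · simp only [unitInterval.symm_one, h0]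
    exact h1.symm hK'

lemma Isotopic.of_carries_refl (hK : K.IsLink) (hK' : K'.IsLink)
    (h : Carries (Homeomorph.refl Space) K K') : Isotopic K K' :=
  ⟨hK, hK', fun _ => Homeomorph.refl _, continuous_snd, rfl, h⟩

/-! ### Isotopy extension for a small displacement of the vertices -/

/-- The curve with the vertices of `K` at new positions. -/
def withPos (K : PolygonalCurve) (q : K.Vertex → Space) : PolygonalCurve where
  Vertex := K.Vertex
  finite := K.finite
  next := K.next
  pos := q

lemma withPos_edge (K : PolygonalCurve) (q : K.Vertex → Space) (v : K.Vertex) (t : ℝ) :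
    (K.withPos q).edge v t = (1 - t) • q v + t • q (K.next v) :=
  edge_eq _ _ _

lemma IsLink.next_ne (hK : K.IsLink) (v : K.Vertex) : K.pos (K.next v) ≠ K.pos v := by
  intro h
  have := (hK v v 0 (by simp) (1 / 2) (by norm_num) (by
    rw [edge_eq, edge_eq, h]; module)).2
  norm_num at this

/-- The vectors `α a + β b` with `α, β ≥ 0` are bounded below in terms of `α + β`, if none of them
vanishes but the trivial one. -/
lemma exists_pos_mul_le_norm_add {a b : Space}
    (h : ∀ α β : ℝ, 0 ≤ α → 0 ≤ β → α • a + β • b = 0 → α + β = 0) :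
    ∃ c > 0, ∀ α β : ℝ, 0 ≤ α → 0 ≤ β → c * (α + β) ≤ ‖α • a + β • b‖ := by
  have hcont : ContinuousOn (fun α : ℝ => ‖α • a + (1 - α) • b‖) (Set.Icc 0 1) := by fun_prop
  obtain ⟨α₀, hα₀, hmin⟩ := isCompact_Icc.exists_isMinOn (by simp : (Set.Icc (0 : ℝ) 1).Nonempty)
    hcont
  refine ⟨‖α₀ • a + (1 - α₀) • b‖, ?_, fun α β hα hβ => ?_⟩
  · rw [gt_iff_lt, norm_pos_iff]
    intro h0
    have := h _ _ hα₀.1 (by linarith [hα₀.2]) h0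
    linarith
  · rcases (add_nonneg hα hβ).eq_or_lt with h0 | h0
    · rw [← h0]; simp
    · have hm := hmin (a := α / (α + β)) ⟨by positivity, by rw [div_le_one h0]; linarith⟩
      have e : α • a + β • b = (α + β) • ((α / (α + β)) • a + (1 - α / (α + β)) • b) := by
        have h1 : (α + β) * (α / (α + β)) = α := by field_simp
        have h2 : (α + β) * (1 - α / (α + β)) = β := by field_simp; ring
        rw [smul_add, smul_smul, smul_smul, h1, h2]
      rw [e, norm_smul, Real.norm_of_nonneg h0.le, mul_comm]
      exact mul_le_mul_of_nonneg_left hm h0.le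

lemma IsLink.edge_ne_edge_of_ne (hK : K.IsLink) {u w : K.Vertex} (h : u ≠ w) (h1 : K.next u ≠ w)
    (h2 : K.next w ≠ u) {s t : ℝ} (hs : s ∈ Set.Icc (0 : ℝ) 1) (ht : t ∈ Set.Icc (0 : ℝ) 1) :
    K.edge u s ≠ K.edge w t := by
  intro e
  rcases hs.2.lt_or_eq with hs1 | rfl <;> rcases ht.2.lt_or_eq with ht1 | rfl
  · exact h (hK _ _ _ ⟨hs.1, hs1⟩ _ ⟨ht.1, ht1⟩ e).1
  · rw [edge_one, ← edge_zero] at e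
    exact h2 (hK _ _ _ ⟨hs.1, hs1⟩ _ (by simp) e).1.symm
  · rw [edge_one, ← edge_zero] at e
    exact h1 (hK _ _ _ (by simp) _ ⟨ht.1, ht1⟩ e).1
  · rw [edge_one, edge_one, ← edge_zero, ← edge_zero] at e
    exact h (K.next.injective (hK _ _ _ (by simp) _ (by simp) e).1)

lemma IsLink.add_eq_zero_of_next (hK : K.IsLink) {u : K.Vertex} {α β : ℝ} (hα : 0 ≤ α)
    (hβ : 0 ≤ β) (h : α • (K.pos (K.next u) - K.pos u) +
      β • (K.pos (K.next (K.next u)) - K.pos (K.next u)) = 0) : α + β = 0 := by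
  by_contra hne
  have hpos : 0 < α + β := lt_of_le_of_ne (add_nonneg hα hβ) (Ne.symm hne)
  have hα' : 0 ≤ α / (2 * (α + β)) := by positivity
  have hβ' : 0 ≤ β / (2 * (α + β)) := by positivity
  have hsum : α / (2 * (α + β)) + β / (2 * (α + β)) = 1 / 2 := by field_simp
  set α' := α / (2 * (α + β))
  set β' := β / (2 * (α + β))
  have h' : α' • (K.pos (K.next u) - K.pos u) +
      β' • (K.pos (K.next (K.next u)) - K.pos (K.next u)) = 0 := by
    have := congrArg (fun x => (2 * (α + β))⁻¹ • x) h
    simp only [smul_add, smul_smul, smul_zero] at this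
    rwa [inv_mul_eq_div, inv_mul_eq_div] at this
  rcases hα'.eq_or_lt with h0 | h0
  · rw [← h0, zero_smul, zero_add, smul_eq_zero] at h'
    rcases h' with h' | h'
    · linarith
    · exact hK.next_ne (K.next u) (sub_eq_zero.1 h')
  · have e : K.edge u (1 - α') = K.edge (K.next u) β' := by
      rw [edge_eq, edge_eq, ← sub_eq_zero, ← neg_eq_zero, ← h']; module
    have := (hK _ _ _ ⟨by linarith, by linarith⟩ _ ⟨hβ', by linarith⟩ e).1
    exact hK.next_ne u (by rw [← this])

/-- The displacement of the points of a polygonal link that results from a displacement `δ` of its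
vertices is Lipschitz on the link, with a constant proportional to the size of `δ`. -/
lemma IsLink.exists_lipschitz_bound (hK : K.IsLink) : ∃ C > 0, ∀ (ε : ℝ) (δ : K.Vertex → Space),
    (∀ v, ‖δ v‖ ≤ ε) → ∀ u w : K.Vertex, ∀ s ∈ Set.Icc (0 : ℝ) 1, ∀ t ∈ Set.Icc (0 : ℝ) 1,
      ‖((1 - s) • δ u + s • δ (K.next u)) - ((1 - t) • δ w + t • δ (K.next w))‖ ≤
        C * ε * ‖K.edge u s - K.edge w t‖ := by
  have hfin := K.finite
  -- for two consecutive edges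
  have hadj : ∀ u : K.Vertex, ∃ C > 0, ∀ (ε : ℝ) (δ : K.Vertex → Space),
      (∀ v, ‖δ v‖ ≤ ε) → ∀ s ∈ Set.Icc (0 : ℝ) 1, ∀ t ∈ Set.Icc (0 : ℝ) 1,
      ‖((1 - s) • δ u + s • δ (K.next u)) -
        ((1 - t) • δ (K.next u) + t • δ (K.next (K.next u)))‖ ≤
        C * ε * ‖K.edge u s - K.edge (K.next u) t‖ := by
    intro u
    obtain ⟨c, hc, hle⟩ := exists_pos_mul_le_norm_add
      (a := K.pos (K.next u) - K.pos u)
      (b := K.pos (K.next (K.next u)) - K.pos (K.next u))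
      (fun α β hα hβ h => hK.add_eq_zero_of_next hα hβ h)
    refine ⟨2 / c, by positivity, fun ε δ hδ s hs t ht => ?_⟩
    have hε : 0 ≤ ε := (norm_nonneg _).trans (hδ u)
    have h1 := hle (1 - s) t (by linarith [hs.2]) ht.1
    have e1 : K.edge u s - K.edge (K.next u) t = -((1 - s) • (K.pos (K.next u) - K.pos u) +
        t • (K.pos (K.next (K.next u)) - K.pos (K.next u))) := by
      rw [edge_eq, edge_eq]; module
    have e2 : ((1 - s) • δ u + s • δ (K.next u)) -
        ((1 - t) • δ (K.next u) + t • δ (K.next (K.next u))) =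
        (1 - s) • (δ u - δ (K.next u)) + t • (δ (K.next u) - δ (K.next (K.next u))) := by module
    rw [e1, e2, norm_neg]
    have hb : ∀ x y, ‖δ x - δ y‖ ≤ 2 * ε := fun x y =>
      (norm_sub_le _ _).trans (by linarith [hδ x, hδ y])
    calc _ ≤ ‖(1 - s) • (δ u - δ (K.next u))‖ + ‖t • (δ (K.next u) - δ (K.next (K.next u)))‖ :=
          norm_add_le _ _
      _ ≤ (1 - s) * (2 * ε) + t * (2 * ε) := by
          rw [norm_smul, norm_smul, Real.norm_of_nonneg (by linarith [hs.2] : (0:ℝ) ≤ 1 - s),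
            Real.norm_of_nonneg ht.1]
          exact add_le_add (mul_le_mul_of_nonneg_left (hb _ _) (by linarith [hs.2]))
            (mul_le_mul_of_nonneg_left (hb _ _) ht.1)
      _ = 2 / c * ε * (c * ((1 - s) + t)) := by field_simp
      _ ≤ _ := mul_le_mul_of_nonneg_left h1 (by positivity)
  have hpair : ∀ q : K.Vertex × K.Vertex, ∃ C > 0, ∀ (ε : ℝ) (δ : K.Vertex → Space),
      (∀ v, ‖δ v‖ ≤ ε) → ∀ s ∈ Set.Icc (0 : ℝ) 1, ∀ t ∈ Set.Icc (0 : ℝ) 1,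
      ‖((1 - s) • δ q.1 + s • δ (K.next q.1)) - ((1 - t) • δ q.2 + t • δ (K.next q.2))‖ ≤
        C * ε * ‖K.edge q.1 s - K.edge q.2 t‖ := by
    rintro ⟨u, w⟩
    by_cases h1 : u = w
    · subst h1
      have hc : 0 < ‖K.pos (K.next u) - K.pos u‖ := norm_pos_iff.2 (sub_ne_zero.2 (hK.next_ne u))
      refine ⟨2 / ‖K.pos (K.next u) - K.pos u‖, by positivity, fun ε δ hδ s hs t ht => ?_⟩
      have hε : 0 ≤ ε := (norm_nonneg _).trans (hδ u)
      have e1 : K.edge u s - K.edge u t = (s - t) • (K.pos (K.next u) - K.pos u) := by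
        rw [edge_eq, edge_eq]; module
      have e2 : ((1 - s) • δ u + s • δ (K.next u)) - ((1 - t) • δ u + t • δ (K.next u)) =
        (s - t) • (δ (K.next u) - δ u) := by module
      simp only [e1, e2, norm_smul]
      have hb : ‖δ (K.next u) - δ u‖ ≤ 2 * ε :=
        (norm_sub_le _ _).trans (by linarith [hδ u, hδ (K.next u)])
      calc _ ≤ ‖s - t‖ * (2 * ε) := mul_le_mul_of_nonneg_left hb (norm_nonneg _)
        _ = _ := by field_simp
    by_cases h2 : K.next u = w
    · subst h2; exact hadj u
    by_cases h3 : K.next w = u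
    · subst h3
      obtain ⟨C, hC, h⟩ := hadj w
      refine ⟨C, hC, fun ε δ hδ s hs t ht => ?_⟩
      rw [norm_sub_rev, norm_sub_rev (K.edge _ _)]
      exact h ε δ hδ t ht s hs
    · have hcont : ContinuousOn (fun x : ℝ × ℝ => ‖K.edge u x.1 - K.edge w x.2‖)
          (Set.Icc 0 1 ×ˢ Set.Icc 0 1) := by
        simp only [edge_eq]; fun_prop
      obtain ⟨x, hx, hmin⟩ := (isCompact_Icc.prod isCompact_Icc).exists_isMinOn
        (by simp : (Set.Icc (0 : ℝ) 1 ×ˢ Set.Icc (0 : ℝ) 1).Nonempty) hcont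
      have hc : 0 < ‖K.edge u x.1 - K.edge w x.2‖ :=
        norm_pos_iff.2 (sub_ne_zero.2 (hK.edge_ne_edge_of_ne h1 h2 h3 hx.1 hx.2))
      refine ⟨2 / ‖K.edge u x.1 - K.edge w x.2‖, by positivity, fun ε δ hδ s hs t ht => ?_⟩
      have hε : 0 ≤ ε := (norm_nonneg _).trans (hδ u)
      have hm : ‖K.edge u x.1 - K.edge w x.2‖ ≤ ‖K.edge u s - K.edge w t‖ :=
        hmin (a := (s, t)) ⟨hs, ht⟩
      have hb : ∀ (v : K.Vertex), ∀ r ∈ Set.Icc (0 : ℝ) 1,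
          ‖(1 - r) • δ v + r • δ (K.next v)‖ ≤ ε := by
        intro v r hr
        refine (norm_add_le _ _).trans ?_
        rw [norm_smul, norm_smul, Real.norm_of_nonneg hr.1,
          Real.norm_of_nonneg (by linarith [hr.2] : (0:ℝ) ≤ 1 - r)]
        nlinarith [hδ v, hδ (K.next v), hr.1, hr.2]
      calc _ ≤ 2 * ε := (norm_sub_le _ _).trans (by linarith [hb u s hs, hb w t ht])
        _ = 2 / ‖K.edge u x.1 - K.edge w x.2‖ * ε * ‖K.edge u x.1 - K.edge w x.2‖ := by
            field_simp
        _ ≤ _ := mul_le_mul_of_nonneg_left hm (by positivity)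
  choose C hC h using hpair
  have := Fintype.ofFinite K.Vertex
  refine ⟨1 + ∑ q, C q, by
    have := Finset.sum_nonneg (s := Finset.univ) fun q _ => (hC q).le
    positivity, fun ε δ hδ u w s hs t ht => (h (u, w) ε δ hδ s hs t ht).trans ?_⟩
  have hε : 0 ≤ ε := (norm_nonneg _).trans (hδ u)
  have : C (u, w) ≤ 1 + ∑ q, C q := by
    have := Finset.single_le_sum (f := C) (s := Finset.univ) (fun q _ => (hC q).le)
      (Finset.mem_univ (u, w))
    linarith
  gcongr

/-- A Lipschitz map into `Space` defined on a subset extends, up to the same constant, to the whole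
space, because the norm of `Space` is the maximum norm. -/
lemma exists_lipschitz_extension {S : Set Space} {g : Space → Space} {c : NNReal}
    (hg : LipschitzOnWith c g S) : ∃ G : Space → Space, LipschitzWith c G ∧ Set.EqOn g G S := by
  obtain ⟨g1, h1, e1⟩ := (LipschitzWith.prod_fst.comp_lipschitzOnWith hg).extend_real
  obtain ⟨g2, h2, e2⟩ := ((LipschitzWith.prod_fst.comp LipschitzWith.prod_snd).comp_lipschitzOnWith
    hg).extend_real
  obtain ⟨g3, h3, e3⟩ := ((LipschitzWith.prod_snd.comp LipschitzWith.prod_snd).comp_lipschitzOnWith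
    hg).extend_real
  refine ⟨fun x => (g1 x, g2 x, g3 x), ?_, fun x hx => ?_⟩
  · simpa using h1.prodMk (h2.prodMk h3)
  · ext
    · exact e1 hx
    · exact e2 hx
    · exact e3 hx

/-- The identity plus a contraction is a homeomorphism. -/
lemma exists_homeomorph_id_add {G : Space → Space} (hG : LipschitzWith (1 / 2) G) :
    ∃ h : Space ≃ₜ Space, ∀ x, h x = x + G x := by
  have ha : ApproximatesLinearOn (fun x => x + G x)
      ((ContinuousLinearEquiv.refl ℝ Space : Space ≃L[ℝ] Space) : Space →L[ℝ] Space)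
      Set.univ (1 / 2) := by
    intro x _ y _
    have := hG.norm_sub_le x y
    simpa [add_sub_add_comm] using this
  have hc : (1 / 2 : NNReal) <
      ‖((ContinuousLinearEquiv.refl ℝ Space).symm : Space →L[ℝ] Space)‖₊⁻¹ := by
    have : ‖((ContinuousLinearEquiv.refl ℝ Space).symm : Space →L[ℝ] Space)‖₊ ≤ 1 :=
      ContinuousLinearMap.norm_id_le
    have hpos : 0 < ‖((ContinuousLinearEquiv.refl ℝ Space).symm : Space →L[ℝ] Space)‖₊ :=
      (ContinuousLinearEquiv.refl ℝ Space).symm.norm_pos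
    calc (1 / 2 : NNReal) < 1 := by
          rw [← NNReal.coe_lt_coe]; norm_num
      _ ≤ _ := (one_le_inv₀ hpos).2 this
  exact ⟨ha.toHomeomorph _ (Or.inr hc), fun x => rfl⟩

/-- A link stays in its isotopy class under small displacements of its vertices: the displacement
of its points extends to a contraction `G` of the space, and `x ↦ x + a • G x` is an ambient
isotopy. -/
lemma IsLink.exists_isotopic_of_near (hK : K.IsLink) : ∃ ε > 0, ∀ q : K.Vertex → Space,
    (∀ v, ‖q v - K.pos v‖ ≤ ε) → Isotopic K (K.withPos q) := by
  obtain ⟨C, hC, hb⟩ := hK.exists_lipschitz_bound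
  refine ⟨1 / (2 * C), by positivity, fun q hq => ?_⟩
  have hb' := hb _ (fun v => q v - K.pos v) hq
  have hex : ∀ x : Space, ∃ y : Space, ∀ v : K.Vertex, ∀ t ∈ Set.Ico (0 : ℝ) 1, x = K.edge v t →
      y = (1 - t) • (q v - K.pos v) + t • (q (K.next v) - K.pos (K.next v)) := by
    intro x
    by_cases hx : ∃ v : K.Vertex, ∃ t ∈ Set.Ico (0 : ℝ) 1, x = K.edge v t
    · obtain ⟨v, t, ht, rfl⟩ := hx
      refine ⟨(1 - t) • (q v - K.pos v) + t • (q (K.next v) - K.pos (K.next v)),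
        fun w s hs e => ?_⟩
      obtain ⟨rfl, rfl⟩ := hK _ _ _ ht _ hs e
      rfl
    · exact ⟨0, fun v t ht e => (hx ⟨v, t, ht, e⟩).elim⟩
  choose g hg using hex
  have hlip : LipschitzOnWith (1 / 2) g K.carrier := by
    refine LipschitzOnWith.of_dist_le_mul fun x hx y hy => ?_
    obtain ⟨v, s, hs, rfl⟩ := exists_edge_of_mem_carrier hx
    obtain ⟨w, t, ht, rfl⟩ := exists_edge_of_mem_carrier hy
    rw [dist_eq_norm, dist_eq_norm, hg _ v s hs rfl, hg _ w t ht rfl]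
    refine (hb' v w s ⟨hs.1, hs.2.le⟩ t ⟨ht.1, ht.2.le⟩).trans (le_of_eq ?_)
    have : C * (1 / (2 * C)) = 1 / 2 := by field_simp
    rw [this]; norm_num
  obtain ⟨G, hG, hGe⟩ := exists_lipschitz_extension hlip
  have hH : ∀ a : unitInterval, ∃ h : Space ≃ₜ Space, ∀ x, h x = x + (a : ℝ) • G x := by
    intro a
    refine exists_homeomorph_id_add (G := fun x => (a : ℝ) • G x) ?_
    refine LipschitzWith.of_dist_le_mul fun x y => ?_
    have h1 := hG.dist_le_mul x y
    rw [dist_smul₀, Real.norm_of_nonneg a.2.1]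
    exact (mul_le_of_le_one_left dist_nonneg a.2.2).trans h1
  choose H hHe using hH
  have hedge : ∀ v : K.Vertex, ∀ t ∈ Set.Ico (0 : ℝ) 1,
      H 1 (K.edge v t) = (K.withPos q).edge v t := by
    intro v t ht
    rw [hHe, ← hGe ⟨v, t, ⟨ht.1, ht.2.le⟩, rfl⟩, hg _ v t ht rfl, withPos_edge, edge_eq,
      Set.Icc.coe_one]
    module
  refine ⟨hK, ?_, H, ?_, ?_, ?_, fun v => ⟨v, OrderIso.refl ℝ, fun t => ?_⟩⟩
  · intro u v s hs t ht e
    rw [← hedge u s hs, ← hedge v t ht] at e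
    exact hK _ _ _ hs _ ht ((H 1).injective e)
  · simp only [hHe]
    have := hG.continuous
    fun_prop
  · ext1 x; simp [hHe]
  · ext x
    constructor
    · rintro ⟨y, hy, rfl⟩
      obtain ⟨v, t, ht, rfl⟩ := exists_edge_of_mem_carrier hy
      exact ⟨v, t, ⟨ht.1, ht.2.le⟩, hedge v t ht⟩
    · intro hx
      obtain ⟨v, t, ht, rfl⟩ := exists_edge_of_mem_carrier hx
      exact ⟨_, ⟨v, t, ⟨ht.1, ht.2.le⟩, rfl⟩, hedge v t ht⟩
  · exact hedge _ _ ⟨Int.fract_nonneg t, Int.fract_lt_one t⟩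

/-- Isotopy extension: if all vertices of a link move along straight lines with constant speed and
the curve is a link at all times, then the initial and the final link are isotopic. -/
theorem isotopic_of_forall_isLink (q : K.Vertex → Space)
    (h : ∀ τ ∈ Set.Icc (0 : ℝ) 1, (K.withPos fun v => (1 - τ) • K.pos v + τ • q v).IsLink) :
    Isotopic K (K.withPos q) := by
  have hfin := K.finite
  have := Fintype.ofFinite K.Vertex
  have key : Isotopic (K.withPos fun v => (1 - (0 : ℝ)) • K.pos v + (0 : ℝ) • q v)
      (K.withPos fun v => (1 - (1 : ℝ)) • K.pos v + (1 : ℝ) • q v) := by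
    refine isPreconnected_Icc.induction₂ (s := Set.Icc (0 : ℝ) 1)
      (fun σ τ => Isotopic (K.withPos fun v => (1 - σ) • K.pos v + σ • q v)
        (K.withPos fun v => (1 - τ) • K.pos v + τ • q v)) (fun σ hσ => ?_)
      (fun _ _ _ _ _ _ => Isotopic.trans) (fun _ _ _ _ => Isotopic.symm) (by simp) (by simp)
    obtain ⟨ε, hε, hnear⟩ := (h σ hσ).exists_isotopic_of_near
    have hcont : ∀ v : K.Vertex, ∀ᶠ τ : ℝ in nhds σ,
        ‖((1 - τ) • K.pos v + τ • q v) - ((1 - σ) • K.pos v + σ • q v)‖ ≤ ε := by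
      intro v
      have hc : Continuous fun τ : ℝ =>
          ‖((1 - τ) • K.pos v + τ • q v) - ((1 - σ) • K.pos v + σ • q v)‖ := by fun_prop
      have := hc.tendsto σ
      rw [sub_self, norm_zero] at this
      exact (this.eventually_lt_const hε).mono fun _ h => h.le
    refine Filter.Eventually.filter_mono nhdsWithin_le_nhds ?_
    filter_upwards [Filter.eventually_all.2 hcont] with τ hτ
    exact hnear _ hτ
  simp only [sub_zero, sub_self, one_smul, zero_smul, add_zero, zero_add] at key
  exact key

/-! ### Subdivision of edges -/

/-- The piecewise linear interpolation of a sequence on the integers whose increments are bounded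
below by a positive number is an order isomorphism of the real line. -/
lemma exists_orderIso_interpolation (Φ : ℤ → ℝ) {ε : ℝ} (hε : 0 < ε)
    (hΦ : ∀ n, Φ n + ε ≤ Φ (n + 1)) :
    ∃ φ : ℝ ≃o ℝ, ∀ t, φ t = Φ ⌊t⌋ + Int.fract t * (Φ (⌊t⌋ + 1) - Φ ⌊t⌋) := by
  have hmono : StrictMono Φ := strictMono_int_of_lt_succ fun n => by linarith [hΦ n]
  have hup : ∀ n : ℕ, Φ 0 + n * ε ≤ Φ n := by
    intro n
    induction n with
    | zero => simp
    | succ n ih => push_cast; linarith [hΦ n]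
  have hdown : ∀ n : ℕ, Φ (-n) ≤ Φ 0 - n * ε := by
    intro n
    induction n with
    | zero => simp
    | succ n ih =>
      have := hΦ (-(n + 1 : ℕ))
      rw [show (-((n + 1 : ℕ) : ℤ) + 1 : ℤ) = -n by push_cast; ring] at this
      push_cast at this ⊢; linarith
  let f : ℝ → ℝ := fun t => Φ ⌊t⌋ + Int.fract t * (Φ (⌊t⌋ + 1) - Φ ⌊t⌋)
  have hf : StrictMono f := by
    intro s t hst
    have hs := Int.fract_lt_one s
    have ht := Int.fract_nonneg t
    rcases (Int.floor_mono hst.le).eq_or_lt with h | h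
    · have : Int.fract s < Int.fract t := by
        rw [Int.fract, Int.fract, ← h]; linarith
      simp only [f, ← h]
      nlinarith [hΦ ⌊s⌋]
    · have h1 : Φ (⌊s⌋ + 1) ≤ Φ ⌊t⌋ := hmono.monotone (by lia)
      calc f s < Φ (⌊s⌋ + 1) := by simp only [f]; nlinarith [hΦ ⌊s⌋]
        _ ≤ Φ ⌊t⌋ := h1
        _ ≤ f t := by simp only [f]; nlinarith [hΦ ⌊t⌋]
  have hsurj : Function.Surjective f := by
    intro y
    obtain ⟨N, hN⟩ := exists_nat_gt ((y - Φ 0) / ε)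
    obtain ⟨M, hM⟩ := exists_nat_gt ((Φ 0 - y) / ε)
    rw [div_lt_iff₀ hε] at hN hM
    obtain ⟨n, hn, hmax⟩ := Int.exists_greatest_of_bdd (P := fun n => Φ n ≤ y)
      ⟨N, fun z hz => by
        by_contra hlt
        have := hmono.monotone (not_le.1 hlt).le
        linarith [hup N]⟩
      ⟨-M, by linarith [hdown M]⟩
    have hn1 : y < Φ (n + 1) := by
      by_contra hlt
      have := hmax _ (not_lt.1 hlt)
      lia
    have hpos : 0 < Φ (n + 1) - Φ n := by linarith
    have hs : (y - Φ n) / (Φ (n + 1) - Φ n) ∈ Set.Ico (0 : ℝ) 1 :=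
      ⟨div_nonneg (by linarith) hpos.le, by rw [div_lt_one hpos]; linarith⟩
    refine ⟨n + (y - Φ n) / (Φ (n + 1) - Φ n), ?_⟩
    have hfl : ⌊(n : ℝ) + (y - Φ n) / (Φ (n + 1) - Φ n)⌋ = n := by
      rw [Int.floor_intCast_add, Int.floor_eq_zero_iff.2 hs, add_zero]
    simp only [f, hfl, Int.fract, add_sub_cancel_left]
    field_simp
    ring
  exact ⟨hf.orderIsoOfSurjective f hsurj, fun t => rfl⟩

/-- `K` arises from the curve `K'` by a subdivision of its edges: the vertex `v` of `K` lies on the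
edge of `K'` at `π v`, in the position given by `a v ∈ [0, 1)`. Every closed polygon of `K'` is
required to carry a vertex of `K`. -/
structure Subdivides (K K' : PolygonalCurve) (π : K.Vertex → K'.Vertex) (a : K.Vertex → ℝ) :
    Prop where
  mem : ∀ v, a v ∈ Set.Ico (0 : ℝ) 1
  pos_eq : ∀ v, K.pos v = K'.edge (π v) (a v)
  step : ∀ v, (π (K.next v) = π v ∧ a v < a (K.next v)) ∨
    (π (K.next v) = K'.next (π v) ∧ a (K.next v) = 0)
  surj : ∀ v' : K'.Vertex, ∃ v : K.Vertex, ∃ m : ℤ, v' = (K'.next ^ m) (π v)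

lemma eq_of_int_recursion {α : Type*} (e : Equiv.Perm α) {f g : ℤ → α} (h0 : f 0 = g 0)
    (hf : ∀ n, f (n + 1) = e (f n)) (hg : ∀ n, g (n + 1) = e (g n)) (n : ℤ) : f n = g n := by
  induction n using Int.induction_on with
  | zero => exact h0
  | succ i ih => rw [hf, hg, ih]
  | pred i ih =>
    apply e.injective
    rw [← hf, ← hg]
    simpa using ih

/-- A curve and its subdivision have the same oriented closed polygons, up to reparametrization. -/
lemma Subdivides.exists_param_eq {π : K.Vertex → K'.Vertex} {a : K.Vertex → ℝ}
    (h : Subdivides K K' π a) (v : K.Vertex) :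
    ∃ φ : ℝ ≃o ℝ, ∀ t, K.param v t = K'.param (π v) (φ t) := by
  classical
  have := K.finite
  -- `δ u` counts the vertices of `K'` passed between `u` and `next u`
  let δ : K.Vertex → ℤ := fun u => if π (K.next u) = π u ∧ a u < a (K.next u) then 0 else 1
  have hδ : ∀ u, (δ u = 0 ∧ π (K.next u) = π u ∧ a u < a (K.next u)) ∨
      (δ u = 1 ∧ π (K.next u) = K'.next (π u) ∧ a (K.next u) = 0) := by
    intro u
    by_cases hu : π (K.next u) = π u ∧ a u < a (K.next u)
    · exact Or.inl ⟨if_pos hu, hu⟩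
    · exact Or.inr ⟨if_neg hu, (h.step u).resolve_left hu⟩
  have hπ : ∀ u, π (K.next u) = (K'.next ^ δ u) (π u) := by
    intro u
    rcases hδ u with ⟨h1, h2, -⟩ | ⟨h1, h2, -⟩ <;> simp [h1, h2]
  have hlt : ∀ u, a u < δ u + a (K.next u) := by
    intro u
    rcases hδ u with ⟨h1, -, h2⟩ | ⟨h1, -, h2⟩
    · simpa [h1] using h2
    · simpa [h1, h2] using (h.mem u).2
  have hend : ∀ u, K.pos (K.next u) = K'.edge (π u) (δ u + a (K.next u)) := by
    intro u
    rcases hδ u with ⟨h1, h2, -⟩ | ⟨h1, h2, h3⟩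
    · rw [h.pos_eq, h1, h2]; simp
    · rw [h.pos_eq, h1, h2, h3, edge_zero]; simp [edge_one]
  -- the number of vertices of `K'` passed after `n` edges of `K`
  let E : Equiv.Perm (K.Vertex × ℤ) :=
    Equiv.prodShear K.next fun u => Equiv.addRight (δ u)
  have hE : ∀ x : K.Vertex × ℤ, E x = (K.next x.1, x.2 + δ x.1) := fun x => rfl
  have hE1 : ∀ n : ℤ, (E ^ (n + 1)) (v, 0) = E ((E ^ n) (v, 0)) := fun n => by
    rw [add_comm, zpow_one_add, Equiv.Perm.mul_apply]
  let m : ℤ → ℤ := fun n => ((E ^ n) (v, 0)).2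
  have hv : ∀ n : ℤ, ((E ^ n) (v, 0)).1 = (K.next ^ n) v := by
    refine eq_of_int_recursion K.next (by simp) (fun n => by rw [hE1, hE]) fun n => ?_
    rw [add_comm, zpow_one_add, Equiv.Perm.mul_apply]
  have hm : ∀ n, m (n + 1) = m n + δ ((K.next ^ n) v) := by
    intro n
    simp only [m, hE1, hE, hv]
  have hvn : ∀ n : ℤ, (K.next ^ (n + 1)) v = K.next ((K.next ^ n) v) := fun n => by
    rw [add_comm, zpow_one_add, Equiv.Perm.mul_apply]
  have hmπ : ∀ n : ℤ, (K'.next ^ (m n)) (π v) = π ((K.next ^ n) v) := by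
    intro n
    induction n using Int.induction_on with
    | zero => simp [m]
    | succ i ih =>
      rw [hm, hvn, hπ, ← ih, ← Equiv.Perm.mul_apply, ← zpow_add, add_comm]
    | pred i ih =>
      have h1 := hm (-i - 1)
      have h2 := hvn (-i - 1)
      rw [sub_add_cancel] at h1 h2
      rw [h1, h2, hπ, add_comm, zpow_add, Equiv.Perm.mul_apply] at ih
      exact (K'.next ^ δ ((K.next ^ (-(i : ℤ) - 1)) v)).injective ih
  let Φ : ℤ → ℝ := fun n => m n + a ((K.next ^ n) v)
  have hΦ1 : ∀ n, Φ (n + 1) = m n + (δ ((K.next ^ n) v) + a (K.next ((K.next ^ n) v))) := by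
    intro n
    simp only [Φ, hm, hvn]
    push_cast
    ring
  obtain ⟨ε, hε, hεle⟩ : ∃ ε > 0, ∀ u, ε ≤ δ u + a (K.next u) - a u := by
    have : Nonempty K.Vertex := ⟨v⟩
    obtain ⟨u₀, hu₀⟩ := Finite.exists_min fun u => δ u + a (K.next u) - a u
    exact ⟨_, sub_pos.2 (hlt u₀), hu₀⟩
  obtain ⟨φ, hφ⟩ := exists_orderIso_interpolation Φ hε fun n => by
    rw [hΦ1]
    have := hεle ((K.next ^ n) v)
    simp only [Φ]
    linarith
  refine ⟨φ, fun t => ?_⟩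
  set u := (K.next ^ ⌊t⌋) v with hu
  have hs0 := Int.fract_nonneg t
  have hs1 := Int.fract_lt_one t
  set s := Int.fract t with hs
  have hb1 : δ u + a (K.next u) ≤ 1 := by
    rcases hδ u with ⟨h1, -, -⟩ | ⟨h1, -, h2⟩
    · simpa [h1] using (h.mem (K.next u)).2.le
    · simp [h1, h2]
  have hval : φ t = (a u + s * ((δ u + a (K.next u)) - a u)) + (m ⌊t⌋ : ℤ) := by
    rw [hφ, hΦ1]
    simp only [Φ, ← hu]
    ring
  have hmem : a u + s * ((δ u + a (K.next u)) - a u) ∈ Set.Ico (0 : ℝ) 1 := by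
    have := h.mem u
    have := hlt u
    constructor <;> nlinarith [(h.mem u).1]
  rw [hval, param_add_int, param_of_mem_Ico _ _ hmem, hmπ, ← hu, param, ← hu, ← hs, edge_eq,
    hend, h.pos_eq]
  simp only [edge_eq]
  module

/-- A curve is isotopic to each of its subdivisions. -/
theorem Subdivides.isotopic {π : K.Vertex → K'.Vertex} {a : K.Vertex → ℝ}
    (h : Subdivides K K' π a) (hK : K.IsLink) (hK' : K'.IsLink) : Isotopic K K' := by
  refine Isotopic.of_carries_refl hK hK' ⟨?_, fun v => ?_⟩
  · ext x
    change x ∈ id '' K.carrier ↔ _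
    rw [Set.image_id]
    constructor
    · intro hx
      obtain ⟨v, t, ht, rfl⟩ := exists_edge_of_mem_carrier hx
      obtain ⟨φ, hφ⟩ := h.exists_param_eq v
      rw [← param_of_mem_Ico _ _ ht, hφ]
      exact param_mem_carrier _ _ _
    · intro hx
      obtain ⟨v', t, ht, rfl⟩ := exists_edge_of_mem_carrier hx
      obtain ⟨v, m, rfl⟩ := h.surj v'
      obtain ⟨φ, hφ⟩ := h.exists_param_eq v
      rw [← param_of_mem_Ico _ _ ht, ← param_add_int, ← φ.apply_symm_apply (t + m), ← hφ]
      exact param_mem_carrier _ _ _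
  · obtain ⟨φ, hφ⟩ := h.exists_param_eq v
    exact ⟨π v, φ, hφ⟩

end PolygonalCurve

/-! ### Curves that run through columns -/

/-- Positions for the vertices of a closed braid on `p` strings: in column `c`, at abscissa `x c`,
the string in position `r` has the height `y c r` and the depth `z c r`. -/
structure ColumnPos (p : ℕ) where
  /-- the abscissa of a column -/
  x : ℕ → ℝ
  /-- the heights in a column -/
  y : ℕ → Fin p → ℝ
  /-- the depths in a column -/
  z : ℕ → Fin p → ℝ

/-- The cyclic successor among the columns `0, …, m + 2`. -/
def nextColumn (m c : ℕ) : ℕ := if c = m + 2 then 0 else c + 1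

/-- The closed braid with columns `0, …, m + 2`, in which the positions of the strings are permuted
by `g c` on the way from column `c` to the next one. Columns `m + 1` and `m + 2` are meant to be the
right and the left end of the back of the closed braid, as in `closedBraid`. -/
abbrev columnCurve {p : ℕ} (m : ℕ) (g : ℕ → Equiv.Perm (Fin p)) (D : ColumnPos p) :
    PolygonalCurve where
  Vertex := Fin (m + 3) × Fin p
  finite := inferInstance
  next := Equiv.prodShear (finRotate (m + 3)) fun c => g c
  pos := fun v => (D.x v.1, D.y v.1 v.2, D.z v.1 v.2)

lemma finRotate_val (m : ℕ) (c : Fin (m + 3)) : (finRotate (m + 3) c : ℕ) = nextColumn m c := by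
  rw [coe_finRotate, nextColumn]
  simp [Fin.ext_iff]

namespace ColumnPos

variable {p : ℕ}

/-- The columns `m + 2, 0, 1, …, m + 1` are ordered from left to right, the first and the last one
lie in the plane `z = -1`, and the others lie in front of it. -/
structure Framed (m : ℕ) (D : ColumnPos p) : Prop where
  x_lt : ∀ c ≤ m, D.x c < D.x (c + 1)
  x_left : D.x (m + 2) < D.x 0
  z_gt : ∀ c ≤ m, ∀ r, -1 < D.z c r
  z_right : ∀ r, D.z (m + 1) r = -1
  z_left : ∀ r, D.z (m + 2) r = -1

/-- The linear form `α y + β z` is larger on the string at `b` than on the string at `a`, throughout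
the edges that start in column `c`. -/
def SepAt (m : ℕ) (g : ℕ → Equiv.Perm (Fin p)) (D : ColumnPos p) (c : ℕ) (a b : Fin p)
    (α β : ℝ) : Prop :=
  0 < α * (D.y c b - D.y c a) + β * (D.z c b - D.z c a) ∧
  0 < α * (D.y (nextColumn m c) (g c b) - D.y (nextColumn m c) (g c a)) +
    β * (D.z (nextColumn m c) (g c b) - D.z (nextColumn m c) (g c a))

/-- Any two strings are separated by a linear form along each edge. -/
def Separated (m : ℕ) (g : ℕ → Equiv.Perm (Fin p)) (D : ColumnPos p) : Prop :=
  ∀ c ≤ m + 2, ∀ a b : Fin p, a < b → ∃ α β, D.SepAt m g c a b α β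

/-- The positions at time `τ` of the straight-line motion from `D` to `D'`. -/
def interp (D D' : ColumnPos p) (τ : ℝ) : ColumnPos p where
  x c := (1 - τ) * D.x c + τ * D'.x c
  y c r := (1 - τ) * D.y c r + τ * D'.y c r
  z c r := (1 - τ) * D.z c r + τ * D'.z c r

lemma lt_of_convex {u v u' v' τ : ℝ} (h : u < v) (h' : u' < v') (hτ : τ ∈ Set.Icc (0 : ℝ) 1) :
    (1 - τ) * u + τ * u' < (1 - τ) * v + τ * v' := by
  rcases hτ.1.eq_or_lt with rfl | h0
  · simpa using h
  · have h1 := mul_le_mul_of_nonneg_left h.le (by linarith [hτ.2] : 0 ≤ 1 - τ)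
    have h2 := mul_lt_mul_of_pos_left h' h0
    linarith

lemma Framed.interp {m : ℕ} {D D' : ColumnPos p} (h : D.Framed m) (h' : D'.Framed m) {τ : ℝ}
    (hτ : τ ∈ Set.Icc (0 : ℝ) 1) : (D.interp D' τ).Framed m where
  x_lt c hc := lt_of_convex (h.x_lt c hc) (h'.x_lt c hc) hτ
  x_left := lt_of_convex h.x_left h'.x_left hτ
  z_gt c hc r := by
    have := lt_of_convex (h.z_gt c hc r) (h'.z_gt c hc r) hτ
    simp only [ColumnPos.interp]; linarith
  z_right r := by simp only [ColumnPos.interp, h.z_right, h'.z_right]; ring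
  z_left r := by simp only [ColumnPos.interp, h.z_left, h'.z_left]; ring

lemma SepAt.interp {m c : ℕ} {g : ℕ → Equiv.Perm (Fin p)} {D D' : ColumnPos p} {a b : Fin p}
    {α β : ℝ} (h : D.SepAt m g c a b α β) (h' : D'.SepAt m g c a b α β) {τ : ℝ}
    (hτ : τ ∈ Set.Icc (0 : ℝ) 1) : (D.interp D' τ).SepAt m g c a b α β := by
  constructor
  · have := lt_of_convex h.1 h'.1 hτ
    simp only [ColumnPos.interp]; linarith
  · have := lt_of_convex h.2 h'.2 hτ
    simp only [ColumnPos.interp]; linarith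

lemma columnCurve_edge {m : ℕ} {g : ℕ → Equiv.Perm (Fin p)} (D : ColumnPos p)
    (c : Fin (m + 3)) (a : Fin p) (s : ℝ) :
    (columnCurve m g D).edge (c, a) s =
      ((1 - s) * D.x c + s * D.x (nextColumn m c),
       (1 - s) * D.y c a + s * D.y (nextColumn m c) (g c a),
       (1 - s) * D.z c a + s * D.z (nextColumn m c) (g c a)) := by
  rw [PolygonalCurve.edge_eq]
  simp [columnCurve, Equiv.prodShear, ← finRotate_val]

lemma Framed.x_mono {m : ℕ} {D : ColumnPos p} (h : D.Framed m) {c c' : ℕ} (hc : c ≤ c')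
    (hc' : c' ≤ m + 1) : D.x c ≤ D.x c' := by
  induction c', hc using Nat.le_induction with
  | base => rfl
  | succ k hk ih => exact (ih (by lia)).trans (h.x_lt k (by lia)).le

/-- Points on edges that start in different columns are different: those in front of the plane
`z = -1` are told apart by their abscissae. -/
lemma Framed.column_eq {m : ℕ} {g : ℕ → Equiv.Perm (Fin p)} {D : ColumnPos p} (h : D.Framed m)
    {c c' : ℕ} (hc : c ≤ m + 2) (hc' : c' ≤ m + 2) {a b : Fin p} {s t : ℝ}
    (hs : s ∈ Set.Ico (0 : ℝ) 1) (ht : t ∈ Set.Ico (0 : ℝ) 1)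
    (hx : (1 - s) * D.x c + s * D.x (nextColumn m c) =
      (1 - t) * D.x c' + t * D.x (nextColumn m c'))
    (hz : (1 - s) * D.z c a + s * D.z (nextColumn m c) (g c a) =
      (1 - t) * D.z c' b + t * D.z (nextColumn m c') (g c' b)) : c = c' ∧ s = t := by
  wlog hcc : c ≤ c' generalizing c c' a b s t
  · obtain ⟨h1, h2⟩ := this hc' hc ht hs hx.symm hz.symm (not_le.1 hcc).le
    exact ⟨h1.symm, h2.symm⟩
  have hL := h.x_left
  have hR : D.x 0 < D.x (m + 1) :=
    (h.x_mono (Nat.zero_le m) (by lia)).trans_lt (h.x_lt m le_rfl)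
  have hzge : ∀ c ≤ m + 1, ∀ r, -1 ≤ D.z c r := by
    intro c hc r
    rcases Nat.le_succ_iff.1 hc with hc | rfl
    · exact (h.z_gt c hc r).le
    · exact (h.z_right r).ge
  obtain ⟨hs0, hs1⟩ := hs
  obtain ⟨ht0, ht1⟩ := ht
  have n1 : ∀ {c}, c ≤ m + 1 → nextColumn m c = c + 1 := fun {c} hc => if_neg (by lia)
  have n2 : nextColumn m (m + 2) = 0 := if_pos rfl
  rcases Nat.lt_or_ge m c with h1 | h1
  · obtain rfl | rfl : c = m + 1 ∨ c = m + 2 := by lia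
    · rw [n1 le_rfl, h.z_right, h.z_left] at hz
      obtain rfl | rfl : c' = m + 1 ∨ c' = m + 2 := by lia
      · refine ⟨rfl, ?_⟩
        rw [n1 le_rfl] at hx
        have : (s - t) * (D.x (m + 2) - D.x (m + 1)) = 0 := by linarith
        rcases mul_eq_zero.1 this with h0 | h0 <;> linarith
      · exfalso
        rw [n1 le_rfl, n2] at hx
        rw [n2, h.z_left] at hz
        have h3 := h.z_gt 0 (Nat.zero_le m) (g (m + 2) b)
        have h4 : t * (D.z 0 (g (m + 2) b) + 1) = 0 := by linarith
        have h5 : t = 0 := by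
          rcases mul_eq_zero.1 h4 with h0 | h0
          · exact h0
          · linarith
        subst h5
        nlinarith
    · obtain rfl : c' = m + 2 := by lia
      refine ⟨rfl, ?_⟩
      rw [n2] at hx
      have : (s - t) * (D.x 0 - D.x (m + 2)) = 0 := by linarith
      rcases mul_eq_zero.1 this with h0 | h0 <;> linarith
  · have hxc := h.x_lt c h1
    have hzc := h.z_gt c h1 a
    have hzc1 := hzge (c + 1) (by lia) (g c a)
    have hx0 := h.x_mono (Nat.zero_le c) (by lia)
    rw [n1 (by lia)] at hx hz
    rcases Nat.lt_or_ge m c' with h2 | h2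
    · exfalso
      obtain rfl | rfl : c' = m + 1 ∨ c' = m + 2 := by lia
      · rw [n1 le_rfl, h.z_right, h.z_left] at hz
        nlinarith
      · rw [n2] at hx
        nlinarith
    · have hxc' := h.x_lt c' h2
      rw [n1 (by lia)] at hx
      rcases hcc.eq_or_lt with rfl | hlt
      · refine ⟨rfl, ?_⟩
        have : (s - t) * (D.x (c + 1) - D.x c) = 0 := by linarith
        rcases mul_eq_zero.1 this with h0 | h0 <;> linarith
      · exfalso
        have := h.x_mono (show c + 1 ≤ c' from hlt) (by lia)
        nlinarith

lemma isLink {m : ℕ} {g : ℕ → Equiv.Perm (Fin p)} {D : ColumnPos p} (h : D.Framed m)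
    (hs : D.Separated m g) : (columnCurve m g D).IsLink := by
  rintro ⟨c, a⟩ ⟨c', b⟩ s hs01 t ht01 e
  rw [columnCurve_edge, columnCurve_edge, Prod.mk.injEq, Prod.mk.injEq] at e
  obtain ⟨hx, hy, hz⟩ := e
  obtain ⟨h1, rfl⟩ := h.column_eq (by lia) (by lia) hs01 ht01 hx hz
  obtain rfl : c = c' := Fin.ext h1
  refine ⟨?_, rfl⟩
  by_contra hne
  have hab : a ≠ b := fun h => hne (by rw [h])
  have key : ∀ a b : Fin p, a < b →
      ((1 - s) * D.y c a + s * D.y (nextColumn m c) (g c a) =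
        (1 - s) * D.y c b + s * D.y (nextColumn m c) (g c b)) →
      ((1 - s) * D.z c a + s * D.z (nextColumn m c) (g c a) =
        (1 - s) * D.z c b + s * D.z (nextColumn m c) (g c b)) → False := by
    intro a b hab hy hz
    obtain ⟨α, β, h1, h2⟩ := hs c (by lia) a b hab
    have := lt_of_convex h1 h2 ⟨hs01.1, hs01.2.le⟩
    have e1 := congrArg (α * ·) hy
    have e2 := congrArg (β * ·) hz
    linarith
  rcases lt_or_gt_of_ne hab with hab | hab
  · exact key a b hab hy hz
  · exact key b a hab hy.symm hz.symm

/-- Two closed braids with the same columns and permutations are isotopic by the straight-line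
motion, if the same linear forms separate their strings. -/
theorem isotopic_of_sepAt {m : ℕ} {g : ℕ → Equiv.Perm (Fin p)} {D D' : ColumnPos p}
    (h : D.Framed m) (h' : D'.Framed m)
    (hs : ∀ c ≤ m + 2, ∀ a b : Fin p, a < b →
      ∃ α β, D.SepAt m g c a b α β ∧ D'.SepAt m g c a b α β) :
    (columnCurve m g D).Isotopic (columnCurve m g D') := by
  refine PolygonalCurve.isotopic_of_forall_isLink (K := columnCurve m g D)
    (columnCurve m g D').pos fun τ hτ => ?_
  have : (columnCurve m g (D.interp D' τ)).IsLink := by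
    refine isLink (h.interp h' hτ) fun c hc a b hab => ?_
    obtain ⟨α, β, h1, h2⟩ := hs c hc a b hab
    exact ⟨α, β, h1.interp h2 hτ⟩
  exact this

/-! ### Inserting columns -/

/-- The column of the original braid that the column `c` is a copy of, when column `e` is
doubled. -/
def merge (e c : ℕ) : ℕ := if c ≤ e then c else c - 1

/-- The permutations after column `e` has been doubled. -/
def dupPerm (e : ℕ) (g : ℕ → Equiv.Perm (Fin p)) (c : ℕ) : Equiv.Perm (Fin p) :=
  if c = e then 1 else g (merge e c)

/-- The abscissae after the insertion of a column halfway between the columns `e` and `e + 1`. -/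
noncomputable def dupX (e : ℕ) (x : ℕ → ℝ) (c : ℕ) : ℝ :=
  if c = e + 1 then (x e + x (e + 1)) / 2 else x (merge e c)

/-- The positions after column `e` has been doubled: the new column `e + 1` is a copy of column `e`
with an abscissa halfway between the columns `e` and `e + 1`. -/
noncomputable def dup (e : ℕ) (D : ColumnPos p) : ColumnPos p where
  x := dupX e D.x
  y c := D.y (merge e c)
  z c := D.z (merge e c)

/-- The positions after the insertion of a column halfway between the columns `e` and `e + 1`, which
leaves the curve as it is. -/
noncomputable def halve (e : ℕ) (g : ℕ → Equiv.Perm (Fin p)) (D : ColumnPos p) : ColumnPos p where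
  x := dupX e D.x
  y c r := if c = e + 1 then (D.y e r + D.y (e + 1) (g e r)) / 2 else D.y (merge e c) r
  z c r := if c = e + 1 then (D.z e r + D.z (e + 1) (g e r)) / 2 else D.z (merge e c) r

lemma merge_of_le {e c : ℕ} (h : c ≤ e) : merge e c = c := if_pos h

lemma merge_of_gt {e c : ℕ} (h : e < c) : merge e c = c - 1 := if_neg (by lia)

lemma merge_nextColumn {m e c : ℕ} (he : e ≤ m) (hc : c ≤ m + 3) (hce : c ≠ e) :
    merge e (nextColumn (m + 1) c) = nextColumn m (merge e c) := by
  unfold merge nextColumn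
  grind

lemma dupX_lt {m e : ℕ} {D : ColumnPos p} (h : D.Framed m) (he : e ≤ m) :
    (∀ c ≤ m + 1, dupX e D.x c < dupX e D.x (c + 1)) ∧
      dupX e D.x (m + 1 + 2) < dupX e D.x 0 := by
  have h1 := h.x_lt e he
  constructor
  · intro c hc
    unfold dupX
    rcases lt_trichotomy c e with h2 | rfl | h2
    · rw [if_neg (by lia), if_neg (by lia), merge_of_le (by lia), merge_of_le (by lia)]
      exact h.x_lt c (by lia)
    · rw [if_neg (by lia), if_pos rfl, merge_of_le le_rfl]; linarith
    · rw [merge_of_gt h2, merge_of_gt (by lia)]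
      obtain ⟨c, rfl⟩ : ∃ c', c = c' + 1 := ⟨c - 1, by lia⟩
      simp only [add_tsub_cancel_right]
      rw [if_neg (show c + 1 + 1 ≠ e + 1 by lia)]
      by_cases h3 : c = e
      · subst h3; rw [if_pos rfl]; linarith
      · rw [if_neg (by lia)]; exact h.x_lt c (by lia)
  · unfold dupX
    rw [if_neg (by lia), if_neg (by lia), merge_of_gt (by lia), merge_of_le (by lia)]
    exact h.x_left

lemma Framed.dup {m e : ℕ} {D : ColumnPos p} (h : D.Framed m) (he : e ≤ m) :
    (D.dup e).Framed (m + 1) where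
  x_lt := (dupX_lt h he).1
  x_left := (dupX_lt h he).2
  z_gt c hc r := h.z_gt _ (by unfold merge; split_ifs <;> lia) r
  z_right r := by
    simp only [ColumnPos.dup, merge_of_gt (show e < m + 1 + 1 by lia)]; exact h.z_right r
  z_left r := by
    simp only [ColumnPos.dup, merge_of_gt (show e < m + 1 + 2 by lia)]; exact h.z_left r

lemma Framed.halve {m e : ℕ} {g : ℕ → Equiv.Perm (Fin p)} {D : ColumnPos p} (h : D.Framed m)
    (he : e ≤ m) : (D.halve e g).Framed (m + 1) where
  x_lt := (dupX_lt h he).1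
  x_left := (dupX_lt h he).2
  z_gt c hc r := by
    simp only [ColumnPos.halve]
    split_ifs
    · have h1 := h.z_gt e he r
      rcases he.eq_or_lt with rfl | h2
      · have := h.z_right (g e r); linarith
      · have := h.z_gt (e + 1) h2 (g e r); linarith
    · exact h.z_gt _ (by unfold merge; split_ifs <;> lia) r
  z_right r := by
    have h1 := h.z_right r
    simp only [ColumnPos.halve]
    rw [if_neg (by lia), merge_of_gt (by lia)]
    exact h1
  z_left r := by
    simp only [ColumnPos.halve]
    rw [if_neg (by lia), merge_of_gt (by lia)]
    exact h.z_left r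

lemma sepAt_dup_halve {m e : ℕ} {g : ℕ → Equiv.Perm (Fin p)} {D : ColumnPos p}
    (hs : D.Separated m g) (he : e ≤ m) {c : ℕ} (hc : c ≤ m + 3) {a b : Fin p} (hab : a < b) :
    ∃ α β, (D.dup e).SepAt (m + 1) (dupPerm e g) c a b α β ∧
      (D.halve e g).SepAt (m + 1) (dupPerm e g) c a b α β := by
  obtain ⟨α, β, h1, h2⟩ := hs (merge e c) (by unfold merge; split_ifs <;> lia) a b hab
  have n1 : ∀ {c}, c ≤ m + 1 → nextColumn m c = c + 1 := fun {c} hc => if_neg (by lia)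
  have n2 : ∀ {c}, c ≤ m + 1 + 1 → nextColumn (m + 1) c = c + 1 := fun {c} hc => if_neg (by lia)
  refine ⟨α, β, ⟨h1, ?_⟩, ?_, ?_⟩
  · by_cases hce : c = e
    · subst hce
      rw [merge_of_le le_rfl] at h1
      simp only [dup, dupPerm, if_pos, Equiv.Perm.one_apply, n2 (show c ≤ m + 1 + 1 by lia),
        merge_of_gt (Nat.lt_succ_self c), Nat.succ_eq_add_one, add_tsub_cancel_right]
      exact h1
    · simp only [dup, dupPerm, if_neg hce, merge_nextColumn he hc hce]
      exact h2
  · by_cases hce : c = e + 1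
    · subst hce
      rw [merge_of_gt (by lia), add_tsub_cancel_right] at h1 h2
      rw [n1 (by lia)] at h2
      simp only [halve, if_pos]
      linarith
    · simp only [halve, if_neg hce]
      exact h1
  · by_cases hce : c = e
    · subst hce
      rw [merge_of_le le_rfl] at h1 h2
      rw [n1 (by lia)] at h2
      simp only [halve, dupPerm, if_pos, Equiv.Perm.one_apply, n2 (show c ≤ m + 1 + 1 by lia)]
      linarith
    · have : nextColumn (m + 1) c ≠ e + 1 := by unfold nextColumn; split_ifs <;> lia
      simp only [halve, dupPerm, if_neg hce, merge_nextColumn he hc hce, if_neg this]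
      exact h2

lemma Separated.dup {m e : ℕ} {g : ℕ → Equiv.Perm (Fin p)} {D : ColumnPos p}
    (hs : D.Separated m g) (he : e ≤ m) : (D.dup e).Separated (m + 1) (dupPerm e g) :=
  fun _ hc _ _ hab =>
    let ⟨α, β, h1, _⟩ := sepAt_dup_halve hs he hc hab
    ⟨α, β, h1⟩

/-- Doubling a column does not change the closed braid: it is halving the edges that start in that
column, followed by a straight-line motion. -/
theorem isotopic_dup {m e : ℕ} {g : ℕ → Equiv.Perm (Fin p)} {D : ColumnPos p} (h : D.Framed m)
    (hs : D.Separated m g) (he : e ≤ m) :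
    (columnCurve m g D).Isotopic (columnCurve (m + 1) (dupPerm e g) (D.dup e)) := by
  have h1 : (columnCurve (m + 1) (dupPerm e g) (D.halve e g)).Isotopic
      (columnCurve (m + 1) (dupPerm e g) (D.dup e)) :=
    isotopic_of_sepAt (h.halve he) (h.dup he) fun c hc a b hab =>
      let ⟨α, β, h1, h2⟩ := sepAt_dup_halve hs he hc hab
      ⟨α, β, h2, h1⟩
  refine PolygonalCurve.Isotopic.trans (PolygonalCurve.Isotopic.symm ?_) h1
  have hm : ∀ c : Fin (m + 1 + 3), merge e c < m + 3 := fun c => by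
    have := c.2
    unfold merge; split_ifs <;> lia
  let π : (columnCurve (m + 1) (dupPerm e g) (D.halve e g)).Vertex → (columnCurve m g D).Vertex :=
    fun v => (⟨merge e v.1, hm v.1⟩, v.2)
  let a : (columnCurve (m + 1) (dupPerm e g) (D.halve e g)).Vertex → ℝ :=
    fun v => if (v.1 : ℕ) = e + 1 then 1 / 2 else 0
  refine PolygonalCurve.Subdivides.isotopic (π := π) (a := a) ⟨?_, ?_, ?_, ?_⟩ h1.1 (isLink h hs)
  · intro v
    simp only [a]
    split_ifs <;> norm_num
  · rintro ⟨c, r⟩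
    have n1 : nextColumn m e = e + 1 := if_neg (by lia)
    simp only [a, π]
    rw [columnCurve_edge]
    by_cases hc : (c : ℕ) = e + 1
    · simp only [hc, merge_of_gt (Nat.lt_succ_self e), Nat.succ_eq_add_one, add_tsub_cancel_right,
        n1, if_pos, halve, dupX]
      refine Prod.ext ?_ (Prod.ext ?_ ?_) <;> simp only <;> ring
    · simp [halve, dupX, hc]
  · rintro ⟨c, r⟩
    have hcl := c.2
    have hnext : (columnCurve (m + 1) (dupPerm e g) (D.halve e g)).next (c, r) =
      (finRotate (m + 1 + 3) c, dupPerm e g c r) := rfl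
    have hn := finRotate_val (m + 1) c
    rw [hnext]
    by_cases hc : (c : ℕ) = e
    · left
      have n2 : nextColumn (m + 1) e = e + 1 := if_neg (by lia)
      rw [hc, n2] at hn
      generalize finRotate (m + 1 + 3) c = c' at hn
      simp [π, a, hn, hc, dupPerm, merge]
    · right
      have h3 : nextColumn (m + 1) c ≠ e + 1 := by unfold nextColumn; split_ifs <;> lia
      refine ⟨Prod.ext (Fin.ext ?_) ?_, ?_⟩
      · change merge e (finRotate (m + 1 + 3) c) = (finRotate (m + 3) ⟨merge e c, hm c⟩ : ℕ)
        rw [hn, finRotate_val, merge_nextColumn he (by lia) hc]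
      · change dupPerm e g c r = g (merge e c) r
        rw [dupPerm, if_neg hc]
      · change (if (finRotate (m + 1 + 3) c : ℕ) = e + 1 then (1 / 2 : ℝ) else 0) = 0
        rw [hn, if_neg h3]
  · rintro ⟨c, r⟩
    have hcl := c.2
    by_cases hc : (c : ℕ) ≤ e
    · refine ⟨(⟨c, by lia⟩, r), 0, ?_⟩
      simp [π, merge_of_le hc]
    · refine ⟨(⟨c + 1, by lia⟩, r), 0, ?_⟩
      simp [π, merge_of_gt (show e < (c : ℕ) + 1 by lia)]

/-! ### Closed braids and trivial letters -/

/-- The positions of the vertices of `closedBraid p w`. -/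
noncomputable def ofWord (p : ℕ) (w : List ℕ) : ColumnPos p where
  x c := if c = 2 * w.length + 2 then -1
    else if c = 2 * w.length + 1 then (w.length : ℝ) + 1 else (c : ℝ) / 2
  y c r := ((((r : ℕ) : ℝ) + 1) + (((columnPerm p w c r : ℕ) : ℝ) + 1)) / 2
  z c r := if 2 * w.length + 1 ≤ c then -1 else if r < columnPerm p w c r then 1 else 0

lemma columnPerm_of_le {w : List ℕ} {c : ℕ} (h : 2 * w.length ≤ c) : columnPerm p w c = 1 :=
  dif_neg (by lia)

lemma columnPerm_even (w : List ℕ) (l : ℕ) : columnPerm p w (2 * l) = 1 :=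
  dif_neg (by lia)

lemma columnPerm_odd {w : List ℕ} {l : ℕ} (h : l < w.length) :
    columnPerm p w (2 * l + 1) = artinPerm p w[l] := by
  have : (2 * l + 1) / 2 = l := by lia
  rw [columnPerm, dif_pos ⟨by lia, by lia⟩]
  simp only [this]

lemma closedBraid_eq (w : List ℕ) :
    closedBraid p w = columnCurve (2 * w.length) (columnPerm p w) (ofWord p w) := by
  unfold closedBraid columnCurve
  congr 1
  funext v
  obtain ⟨c, r⟩ := v
  have hc := c.2
  simp only [ofWord]
  simp only [add_lt_add_iff_right, Nat.cast_lt, Fin.val_fin_lt]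
  split_ifs <;> try lia
  · simp [columnPerm_of_le (show 2 * w.length ≤ (c : ℕ) by lia)]
  · simp [columnPerm_of_le (show 2 * w.length ≤ (c : ℕ) by lia)]

lemma framed_ofWord (w : List ℕ) : (ofWord p w).Framed (2 * w.length) where
  x_lt c hc := by
    simp only [ofWord]
    rw [if_neg (by lia), if_neg (by lia), if_neg (by lia)]
    split_ifs with h
    · have : c = 2 * w.length := by lia
      subst this; push_cast; linarith
    · push_cast; linarith
  x_left := by simp [ofWord]
  z_gt c hc r := by
    simp only [ofWord]
    rw [if_neg (by lia)]
    split_ifs <;> norm_num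
  z_right r := by simp [ofWord]
  z_left r := by simp [ofWord]

/-- The permutation of a letter preserves the order of two positions, unless it exchanges them. -/
lemma artinPerm_lt_or {i : ℕ} {a b : Fin p} (hab : a < b) :
    artinPerm p i a < artinPerm p i b ∨ (artinPerm p i a = b ∧ artinPerm p i b = a) := by
  unfold artinPerm
  split_ifs with h
  · simp only [Equiv.swap_apply_def, Fin.ext_iff, Fin.lt_def] at *
    split_ifs <;> simp_all <;> lia
  · exact Or.inl hab

/-- In a letter, two strings that are not exchanged are separated by their heights, and the two that
are exchanged by a combination of height and depth. -/
lemma separated_ofWord (w : List ℕ) : (ofWord p w).Separated (2 * w.length) (columnPerm p w) := by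
  intro c hc a b hab
  have hab' : ((a : ℕ) : ℝ) < ((b : ℕ) : ℝ) := by exact_mod_cast hab
  by_cases hc1 : 2 * w.length ≤ c
  · refine ⟨1, 0, ?_, ?_⟩
    · simp only [ofWord, columnPerm_of_le hc1, Equiv.Perm.one_apply]
      linarith
    · have : columnPerm p w (nextColumn (2 * w.length) c) = 1 := by
        unfold nextColumn
        split_ifs
        · exact columnPerm_even w 0
        · exact columnPerm_of_le (by lia)
      simp only [ofWord, columnPerm_of_le hc1, this, Equiv.Perm.one_apply]
      linarith
  · push Not at hc1
    have hn : nextColumn (2 * w.length) c = c + 1 := if_neg (by lia)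
    rcases Nat.even_or_odd' c with ⟨l, rfl | rfl⟩
    · have hg : columnPerm p w (2 * l) = 1 := columnPerm_even w l
      have hg' := columnPerm_odd (p := p) (w := w) (l := l) (by lia)
      simp only [SepAt, hn, ofWord, hg, hg', Equiv.Perm.one_apply, lt_self_iff_false, if_false,
        if_neg (show ¬ 2 * w.length + 1 ≤ 2 * l by lia),
        if_neg (show ¬ 2 * w.length + 1 ≤ 2 * l + 1 by lia)]
      rcases artinPerm_lt_or (i := w[l]) hab with h | ⟨h1, h2⟩
      · have h' : ((artinPerm p w[l] a : ℕ) : ℝ) < ((artinPerm p w[l] b : ℕ) : ℝ) := by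
          exact_mod_cast h
        exact ⟨1, 0, by linarith, by linarith⟩
      · refine ⟨1, -1, ?_⟩
        rw [h1, h2, if_pos hab, if_neg hab.not_gt]
        constructor <;> linarith
    · have hg : columnPerm p w (2 * l + 1 + 1) = 1 := columnPerm_even w (l + 1)
      have hg' := columnPerm_odd (p := p) (w := w) (l := l) (by lia)
      simp only [SepAt, hn, ofWord, hg, hg', Equiv.Perm.one_apply, lt_self_iff_false, if_false,
        if_neg (show ¬ 2 * w.length + 1 ≤ 2 * l + 1 by lia),
        if_neg (show ¬ 2 * w.length + 1 ≤ 2 * l + 1 + 1 by lia)]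
      rcases artinPerm_lt_or (i := w[l]) hab with h | ⟨h1, h2⟩
      · have h' : ((artinPerm p w[l] a : ℕ) : ℝ) < ((artinPerm p w[l] b : ℕ) : ℝ) := by
          exact_mod_cast h
        exact ⟨1, 0, by linarith, by linarith⟩
      · refine ⟨-1, -1, ?_⟩
        rw [h1, h2, if_pos hab, if_neg hab.not_gt]
        constructor <;> linarith

lemma isLink_closedBraid (w : List ℕ) : (closedBraid p w).IsLink := by
  rw [closedBraid_eq]
  exact isLink (framed_ofWord w) (separated_ofWord w)

lemma columnPerm_insert_zero (u v : List ℕ) (c : ℕ) : columnPerm p (u ++ 0 :: v) c =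
    dupPerm (2 * u.length) (dupPerm (2 * u.length) (columnPerm p (u ++ v))) c := by
  have key : ∀ {w : List ℕ} {l : ℕ}, columnPerm p w (2 * l + 1) =
      (w[l]?).elim 1 (artinPerm p) := by
    intro w l
    by_cases h : l < w.length
    · rw [columnPerm_odd h, List.getElem?_eq_getElem h]; rfl
    · rw [columnPerm_of_le (by lia), List.getElem?_eq_none (by lia)]; rfl
  rcases Nat.even_or_odd' c with ⟨l, rfl | rfl⟩
  · rw [columnPerm_even]
    unfold dupPerm
    split_ifs with h1 h2
    · rfl
    · rfl
    · unfold merge at *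
      by_cases h3 : l ≤ u.length
      · rw [if_pos (by lia : 2 * l ≤ 2 * u.length), if_pos (by lia), columnPerm_even]
      · rw [if_neg (by lia : ¬ 2 * l ≤ 2 * u.length)] at h2 ⊢
        rw [if_neg (by lia), show 2 * l - 1 - 1 = 2 * (l - 1) by lia, columnPerm_even]
  · rw [key]
    unfold dupPerm
    rw [if_neg (by lia)]
    by_cases h3 : l < u.length
    · rw [merge_of_le (by lia), if_neg (by lia), merge_of_le (by lia), key,
        List.getElem?_append_left h3, List.getElem?_append_left h3]
    · rw [merge_of_gt (by lia), List.getElem?_append_right (by lia)]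
      by_cases h4 : l = u.length
      · subst h4
        simp [artinPerm]
      · rw [if_neg (by lia), merge_of_gt (by lia), show 2 * l + 1 - 1 - 1 = 2 * (l - 1) + 1 by lia,
          key, List.getElem?_append_right (by lia),
          show l - u.length = (l - 1 - u.length) + 1 by lia, List.getElem?_cons_succ]

/-- A trivial letter may be inserted into the word of a closed braid. -/
theorem isotopic_insert_zero (u v : List ℕ) :
    (closedBraid p (u ++ v)).Isotopic (closedBraid p (u ++ 0 :: v)) := by
  set e := 2 * u.length with he
  have hlen : (u ++ v).length = u.length + v.length := by simp
  have hlen' : (u ++ 0 :: v).length = u.length + v.length + 1 := by simp; lia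
  have hF := framed_ofWord (p := p) (u ++ v)
  have hS := separated_ofWord (p := p) (u ++ v)
  have h1 : e ≤ 2 * (u ++ v).length := by lia
  have hF' := hF.dup h1
  have hS' := hS.dup h1
  have h2 : e ≤ 2 * (u ++ v).length + 1 := by lia
  have hF'' := hF'.dup h2
  have hS'' := hS'.dup h2
  have hm : 2 * (u ++ v).length + 1 + 1 = 2 * (u ++ 0 :: v).length := by lia
  have hg : dupPerm e (dupPerm e (columnPerm p (u ++ v))) = columnPerm p (u ++ 0 :: v) :=
    funext fun c => (columnPerm_insert_zero u v c).symm
  have i1 := isotopic_dup hF hS h1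
  have i2 := isotopic_dup hF' hS' h2
  rw [hm] at hF'' hS'' i2
  rw [hg] at hS'' i2
  rw [closedBraid_eq, closedBraid_eq]
  refine (i1.trans i2).trans (isotopic_of_sepAt hF'' (framed_ofWord _) fun c hc a b hab => ?_)
  have hcp : ∀ c, columnPerm p (u ++ v) (merge e (merge e c)) = columnPerm p (u ++ 0 :: v) c := by
    intro c
    rw [columnPerm_insert_zero]
    have h0 : columnPerm p (u ++ v) e = 1 := columnPerm_even _ _
    by_cases h3 : c = e
    · rw [h3, merge_of_le le_rfl, merge_of_le le_rfl, h0]; simp [dupPerm, ← he]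
    · simp only [dupPerm, ← he, if_neg h3]
      split_ifs with h4
      · rw [h4, merge_of_le le_rfl, h0]
      · rfl
  have hy : ((ofWord p (u ++ v)).dup e |>.dup e).y = (ofWord p (u ++ 0 :: v)).y := by
    funext c r
    simp only [dup, ofWord, hcp]
  have hz : ((ofWord p (u ++ v)).dup e |>.dup e).z = (ofWord p (u ++ 0 :: v)).z := by
    funext c r
    simp only [dup, ofWord, hcp]
    have : 2 * (u ++ v).length + 1 ≤ merge e (merge e c) ↔ 2 * (u ++ 0 :: v).length + 1 ≤ c := by
      unfold merge; split_ifs <;> lia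
    simp only [this]
  obtain ⟨α, β, h3⟩ := hS'' c hc a b hab
  refine ⟨α, β, h3, ?_⟩
  unfold SepAt at *
  rwa [hy, hz] at h3

/-- A closed braid is determined up to isotopy by the nontrivial letters of its word. -/
theorem isotopic_filter_zero (w : List ℕ) :
    (closedBraid p (w.filter (· ≠ 0))).Isotopic (closedBraid p w) := by
  suffices h : ∀ u : List ℕ, (closedBraid p (u ++ w.filter (· ≠ 0))).Isotopic
      (closedBraid p (u ++ w)) by simpa using h []
  induction w with
  | nil => exact fun u => PolygonalCurve.Isotopic.refl (isLink_closedBraid _)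
  | cons i w ih =>
    intro u
    by_cases hi : i = 0
    · subst hi
      simp only [ne_eq, not_true_eq_false, decide_false, Bool.false_eq_true, not_false_eq_true,
        List.filter_cons_of_neg]
      exact (ih u).trans (isotopic_insert_zero u w)
    · rw [List.filter_cons_of_pos (by simpa using hi)]
      simpa using ih (u ++ [i])

end ColumnPos

/-! ### Curves made of arcs between points of the diagonal -/

/-- The curve made of one arc for each `i : Fin n`, with the four vertices `P 0 i, …, P 3 i`,
followed by the arc for `σ i`. -/
abbrev arcCurve {n : ℕ} (σ : Equiv.Perm (Fin n)) (P : Fin 4 → Fin n → Space) :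
    PolygonalCurve where
  Vertex := Fin 4 × Fin n
  finite := inferInstance
  next := Equiv.prodShear (finRotate 4) fun c => if c = 3 then σ else 1
  pos := fun v => P v.1 v.2

/-- The coordinate of the `i`-th point of the diagonal. -/
def coord {n : ℕ} (i : Fin n) : ℝ := ((i : ℕ) : ℝ) + 1

namespace ArcCurve

variable {n : ℕ} {σ : Equiv.Perm (Fin n)}

lemma one_le_coord (i : Fin n) : 1 ≤ coord i := by simp [coord]

lemma coord_inj {i j : Fin n} (h : coord i = coord j) : i = j := by
  simpa [coord, Fin.ext_iff] using h

lemma coord_add_one_le {i j : Fin n} (h : i < j) : coord i + 1 ≤ coord j := by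
  have : ((i : ℕ) : ℝ) + 1 ≤ (j : ℕ) := by exact_mod_cast h
  simp only [coord]; linarith

lemma coord_le_of_lt {k : ℕ} {i : Fin n} (h : (i : ℕ) < k) : coord i ≤ k := by
  have : ((i : ℕ) : ℝ) + 1 ≤ k := by exact_mod_cast h
  simpa [coord] using this

lemma le_coord_of_le {k : ℕ} {i : Fin n} (h : ¬ (i : ℕ) < k) : (k : ℝ) + 1 ≤ coord i := by
  have : (k : ℝ) ≤ (i : ℕ) := by exact_mod_cast not_lt.1 h
  simpa [coord] using this

/-- Coordinates that differ by less than one are equal. -/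
lemma eq_of_coord_lt {i j : Fin n} (h1 : coord i < coord j + 1) (h2 : coord j < coord i + 1) :
    i = j := by
  rcases lt_trichotomy i j with h | h | h
  · linarith [coord_add_one_le h]
  · exact h
  · linarith [coord_add_one_le h]

/-- A curve of arcs is a link if its edges `E 0 i, …, E 3 i` are simple, and disjoint unless they
agree. -/
lemma isLink_of_edges {P : Fin 4 → Fin n → Space} (E : Fin 4 → Fin n → ℝ → Space)
    (h0 : ∀ i s, (1 - s) • P 0 i + s • P 1 i = E 0 i s)
    (h1 : ∀ i s, (1 - s) • P 1 i + s • P 2 i = E 1 i s)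
    (h2 : ∀ i s, (1 - s) • P 2 i + s • P 3 i = E 2 i s)
    (h3 : ∀ i s, (1 - s) • P 3 i + s • P 0 (σ i) = E 3 i s)
    (hself : ∀ c i j, ∀ s ∈ Set.Ico (0 : ℝ) 1, ∀ t ∈ Set.Ico (0 : ℝ) 1,
      E c i s = E c j t → i = j ∧ s = t)
    (hcross : ∀ c d, c < d → ∀ i j, ∀ s ∈ Set.Ico (0 : ℝ) 1, ∀ t ∈ Set.Ico (0 : ℝ) 1,
      E c i s ≠ E d j t) : (arcCurve σ P).IsLink := by
  have key : ∀ c i s, (arcCurve σ P).edge (c, i) s = E c i s := by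
    intro c i s
    rw [PolygonalCurve.edge_eq]
    fin_cases c
    · exact h0 i s
    · exact h1 i s
    · exact h2 i s
    · exact h3 i s
  rintro ⟨c, i⟩ ⟨d, j⟩ s hs t ht e
  rw [key, key] at e
  rcases lt_trichotomy c d with h | rfl | h
  · exact (hcross c d h i j s hs t ht e).elim
  · obtain ⟨rfl, rfl⟩ := hself c i j s hs t ht e
    exact ⟨rfl, rfl⟩
  · exact (hcross d c h j i t ht s hs e.symm).elim

/-! ### The deformation of a diagonal link to its closed form -/

/-- The grid diagram of `diagLink σ`. -/
def diagPos (σ : Equiv.Perm (Fin n)) (c : Fin 4) (i : Fin n) : Space :=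
  ![(coord i, coord i, 0), (coord i, coord i, 1), (coord i, coord (σ i), 1),
    (coord i, coord (σ i), 0)] c

lemma diagLink_eq (σ : Equiv.Perm (Fin n)) : diagLink σ = arcCurve σ (diagPos σ) := rfl

/-- The arcs below the diagonal have been stretched behind the diagram, each in the plane of its
horizontal edge, as far as the plane `x = 0`. -/
def hookPos (k : ℕ) (σ : Equiv.Perm (Fin n)) (c : Fin 4) (i : Fin n) : Space :=
  if (i : ℕ) < k then diagPos σ c i else
  ![(coord i, coord i, 0), (coord i, coord i, 1), (coord i, coord (σ i), 1),
    (0, coord (σ i), -coord i)] c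

/-- The vertical edges below the diagonal have been lowered, each in its plane. -/
noncomputable def lowPos (k : ℕ) (σ : Equiv.Perm (Fin n)) (c : Fin 4) (i : Fin n) : Space :=
  if (i : ℕ) < k then diagPos σ c i else
  ![(coord i, coord i, 0), (coord i, coord i - 1 / 2, 0), (coord i, coord (σ i), -coord i),
    (0, coord (σ i), -coord i)] c

/-- The arcs below the diagonal have become closing strings, which leave to the right of the arcs
above the diagonal and return behind them, and the vertical edges above the diagonal are tilted. -/
noncomputable def closedPos (k : ℕ) (σ : Equiv.Perm (Fin n)) (c : Fin 4) (i : Fin n) : Space :=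
  if (i : ℕ) < k then
    ![(coord i, coord i, 0), (coord i + 1 / 4, coord i, 1), (coord i + 1 / 2, coord (σ i), 1),
      (coord i + 3 / 4, coord (σ i), 0)] c
  else
    ![((k : ℝ) + 1, coord i, 0), ((k : ℝ) + 3 / 2, coord i - 1 / 2, -1 / 2),
      ((k : ℝ) + 2, coord (σ i), -1), (0, coord (σ i), -1)] c

variable {k : ℕ}

/-- The curve is a link throughout the motion that stretches the arcs below the diagonal. -/
lemma isLink_diag_hook (hup : ∀ i : Fin n, (i : ℕ) < k → i < σ i)
    (hdown : ∀ i : Fin n, ¬ (i : ℕ) < k → σ i < i) {τ : ℝ} (hτ : τ ∈ Set.Icc (0 : ℝ) 1) :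
    (arcCurve σ fun c i => (1 - τ) • diagPos σ c i + τ • hookPos k σ c i).IsLink := by
  obtain ⟨hτ0, hτ1⟩ := hτ
  -- the motion concerns the arcs below the diagonal only
  let θ : Fin n → ℝ := fun i => if (i : ℕ) < k then 0 else τ
  have hθ : ∀ i, 0 ≤ θ i := fun i => by simp only [θ]; split_ifs <;> simp [hτ0]
  have hXY : ∀ i, (θ i = 0 ∧ coord i + 1 ≤ coord (σ i)) ∨ coord (σ i) + 1 ≤ coord i := by
    intro i
    by_cases h : (i : ℕ) < k
    · exact Or.inl ⟨if_pos h, coord_add_one_le (hup i h)⟩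
    · exact Or.inr (coord_add_one_le (hdown i h))
  have hne : ∀ i, coord i - coord (σ i) ≠ 0 := by
    intro i h; rcases hXY i with ⟨-, h1⟩ | h1 <;> linarith
  have hθX : ∀ i, 0 ≤ θ i * coord i := fun i =>
    mul_nonneg (hθ i) (by linarith [one_le_coord i])
  let E : Fin 4 → Fin n → ℝ → Space := fun c i s =>
    ![(coord i, coord i, s), (coord i, (1 - s) * coord i + s * coord (σ i), 1),
      (coord i - s * (θ i * coord i), coord (σ i), 1 - s * (1 + θ i * coord i)),
      ((1 - s) * (coord i - θ i * coord i) + s * coord (σ i), coord (σ i),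
        -(1 - s) * (θ i * coord i))] c
  refine isLink_of_edges E ?_ ?_ ?_ ?_ ?_ ?_
  iterate 4
    intro i s
    simp only [E, θ, hookPos, diagPos]
    split_ifs <;> ext <;> simp <;> ring
  · intro c i j s hs t ht e
    fin_cases c <;> simp [E] at e
    · obtain ⟨h1, h2⟩ := e
      exact ⟨coord_inj h1, h2⟩
    · obtain ⟨h1, h2⟩ := e
      obtain rfl := coord_inj h1
      refine ⟨rfl, ?_⟩
      have : (s - t) * (coord i - coord (σ i)) = 0 := by linarith
      linarith [(mul_eq_zero.1 this).resolve_right (hne i)]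
    · obtain ⟨-, h1, h2⟩ := e
      obtain rfl := σ.injective (coord_inj h1)
      refine ⟨rfl, ?_⟩
      exact mul_right_cancel₀ (by linarith [hθX i]) h2
    · obtain ⟨h2, h1, h3⟩ := e
      obtain rfl := σ.injective (coord_inj h1)
      refine ⟨rfl, ?_⟩
      have h4 : (s - t) * (θ i * coord i) = 0 := by linarith
      rcases mul_eq_zero.1 h4 with h5 | h5
      · linarith
      · rw [h5] at h2
        have : (s - t) * (coord i - coord (σ i)) = 0 := by linarith
        linarith [(mul_eq_zero.1 this).resolve_right (hne i)]
  · intro c d hcd i j s hs t ht e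
    obtain ⟨hs0, hs1⟩ := hs
    obtain ⟨ht0, ht1⟩ := ht
    have hX' := hθX j
    fin_cases c <;> fin_cases d <;> first | exact absurd hcd (by decide) | skip
    all_goals simp [E] at e
    · exact hs1.ne e.2.2
    · obtain ⟨h1, h2, h3⟩ := e
      rcases hXY j with ⟨h4, h5⟩ | h4
      · rw [h4] at h1; linarith
      · have : t * (θ j * coord j) = coord j - coord (σ j) := by linarith
        have ht : t = 0 := by linarith
        rw [ht] at this; linarith
    · obtain ⟨h1, h2, h3⟩ := e
      have h4 : (1 - t) * (θ j * coord j) = 0 := by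
        have := mul_nonneg (by linarith : 0 ≤ 1 - t) hX'
        linarith
      have h5 := (mul_eq_zero.1 h4).resolve_left (by linarith)
      rw [h5] at h1
      have h6 : (1 - t) * (coord j - coord (σ j)) = 0 := by linarith
      exact (mul_ne_zero (by linarith) (hne j)) h6
    · obtain ⟨h1, h2, h3⟩ := e
      have h4 : t * (1 + θ j * coord j) = 0 := by linarith
      obtain rfl := (mul_eq_zero.1 h4).resolve_right (by linarith)
      rw [zero_mul, sub_zero] at h1
      obtain rfl := coord_inj h1
      have h6 : (1 - s) * (coord i - coord (σ i)) = 0 := by linarith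
      exact (mul_ne_zero (by linarith) (hne i)) h6
    · obtain ⟨h1, h2, h3⟩ := e
      have := mul_nonneg (by linarith : 0 ≤ 1 - t) hX'
      linarith
    · obtain ⟨h1, h2, h3⟩ := e
      obtain rfl := σ.injective (coord_inj h2)
      rcases hXY i with ⟨h4, -⟩ | h4
      · rw [h4] at h3; linarith
      · -- the two edges in the plane of the horizontal edge form a proper angle
        have h5 : t * (coord i - coord (σ i)) = 1 - s := by linarith
        have h6 : t ≤ 1 - s := by nlinarith
        have h7 : θ i * coord i * (s - (1 - t)) = 1 - s := by linarith
        nlinarith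

/-- The half-open segments of a family are disjoint and not degenerate. -/
def Simple (F : Fin n → ℝ → Space) : Prop :=
  ∀ i j, ∀ s ∈ Set.Ico (0 : ℝ) 1, ∀ t ∈ Set.Ico (0 : ℝ) 1, F i s = F j t → i = j ∧ s = t

/-- The half-open segments of one family are disjoint from those of the other one. -/
def Apart (F G : Fin n → ℝ → Space) : Prop :=
  ∀ i j, ∀ s ∈ Set.Ico (0 : ℝ) 1, ∀ t ∈ Set.Ico (0 : ℝ) 1, F i s ≠ G j t

lemma isLink_of_apart {P : Fin 4 → Fin n → Space} (E₀ E₁ E₂ E₃ : Fin n → ℝ → Space)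
    (h0 : ∀ i s, (1 - s) • P 0 i + s • P 1 i = E₀ i s)
    (h1 : ∀ i s, (1 - s) • P 1 i + s • P 2 i = E₁ i s)
    (h2 : ∀ i s, (1 - s) • P 2 i + s • P 3 i = E₂ i s)
    (h3 : ∀ i s, (1 - s) • P 3 i + s • P 0 (σ i) = E₃ i s)
    (h00 : Simple E₀) (h11 : Simple E₁) (h22 : Simple E₂) (h33 : Simple E₃)
    (h01 : Apart E₀ E₁) (h02 : Apart E₀ E₂) (h03 : Apart E₀ E₃) (h12 : Apart E₁ E₂)
    (h13 : Apart E₁ E₃) (h23 : Apart E₂ E₃) : (arcCurve σ P).IsLink := by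
  refine isLink_of_edges ![E₀, E₁, E₂, E₃] h0 h1 h2 h3 (fun c => ?_) fun c d hcd => ?_
  · fin_cases c
    exacts [h00, h11, h22, h33]
  · fin_cases c <;> fin_cases d <;> first | exact absurd hcd (by decide) | skip
    exacts [h01, h02, h03, h12, h13, h23]

/-- The curve is a link throughout the motion that lowers the vertical edges below the diagonal. -/
lemma isLink_hook_low (hup : ∀ i : Fin n, (i : ℕ) < k → i < σ i)
    (hdown : ∀ i : Fin n, ¬ (i : ℕ) < k → σ i < i) {τ : ℝ} (hτ : τ ∈ Set.Icc (0 : ℝ) 1) :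
    (arcCurve σ fun c i => (1 - τ) • hookPos k σ c i + τ • lowPos k σ c i).IsLink := by
  obtain ⟨hτ0, hτ1⟩ := hτ
  let θ : Fin n → ℝ := fun i => if (i : ℕ) < k then 0 else τ
  have hθ0 : ∀ i, 0 ≤ θ i := fun i => by simp only [θ]; split_ifs <;> simp [hτ0]
  have hθ1 : ∀ i, θ i ≤ 1 := fun i => by simp only [θ]; split_ifs <;> simp [hτ1]
  have hθu : ∀ i : Fin n, (i : ℕ) < k → θ i = 0 := fun i h => if_pos h
  have hθd : ∀ i : Fin n, ¬ (i : ℕ) < k → θ i = τ := fun i h => if_neg h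
  have hu : ∀ i : Fin n, (i : ℕ) < k → coord i + 1 ≤ coord (σ i) := fun i h =>
    coord_add_one_le (hup i h)
  have hd : ∀ i : Fin n, ¬ (i : ℕ) < k → coord (σ i) + 1 ≤ coord i := fun i h =>
    coord_add_one_le (hdown i h)
  have hX : ∀ i : Fin n, 1 ≤ coord i := one_le_coord
  have hV : ∀ i, coord i - θ i / 2 - coord (σ i) ≠ 0 := by
    intro i h
    by_cases hi : (i : ℕ) < k
    · linarith [hu i hi, hθ0 i]
    · linarith [hd i hi, hθ1 i]
  let E₀ : Fin n → ℝ → Space := fun i s => (coord i, coord i - s * (θ i / 2), s * (1 - θ i))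
  let E₁ : Fin n → ℝ → Space := fun i s =>
    (coord i, (1 - s) * (coord i - θ i / 2) + s * coord (σ i), 1 - θ i - s * (θ i * coord i))
  let E₂ : Fin n → ℝ → Space := fun i s =>
    if (i : ℕ) < k then (coord i, coord (σ i), 1 - s)
    else ((1 - s) * coord i, coord (σ i), (1 - s) * ((1 + coord i) * (1 - τ)) - coord i)
  let E₃ : Fin n → ℝ → Space := fun i s =>
    if (i : ℕ) < k then ((1 - s) * coord i + s * coord (σ i), coord (σ i), 0)
    else (s * coord (σ i), coord (σ i), -(1 - s) * coord i)
  -- a vertical edge reaches the height of a diagonal point only there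
  have hE₀ : ∀ {i j : Fin n} {s : ℝ}, s ∈ Set.Ico (0 : ℝ) 1 →
      coord i - s * (θ i / 2) = coord j → i = j ∧ s * θ i = 0 := by
    intro i j s hs h
    have h1 : s * θ i ≤ 1 := mul_le_one₀ hs.2.le (hθ0 i) (hθ1 i)
    have h2 : 0 ≤ s * θ i := mul_nonneg hs.1 (hθ0 i)
    have hij : i = j := eq_of_coord_lt (by linarith) (by linarith)
    subst hij
    exact ⟨rfl, by linarith⟩
  have hE₀z : ∀ {i : Fin n} {s : ℝ}, s * θ i = 0 → s * (1 - θ i) = s := by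
    intro i s h; linarith
  refine isLink_of_apart E₀ E₁ E₂ E₃ ?_ ?_ ?_ ?_ ?_ ?_ ?_ ?_ ?_ ?_ ?_ ?_ ?_ ?_
  iterate 4
    intro i s
    simp only [E₀, E₁, E₂, E₃, θ, hookPos, lowPos, diagPos]
    split_ifs <;>
      simp only [Matrix.cons_val, Prod.smul_mk, Prod.mk_add_mk, smul_eq_mul, Prod.mk.injEq] <;>
      refine ⟨?_, ?_, ?_⟩ <;> ring
  · intro i j s hs t ht e
    simp only [E₀, Prod.mk.injEq] at e
    obtain ⟨h1, h2, h3⟩ := e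
    obtain rfl := coord_inj h1
    refine ⟨rfl, ?_⟩
    have : (s - t) * (1 - θ i / 2) = 0 := by linarith
    linarith [(mul_eq_zero.1 this).resolve_right (by linarith [hθ1 i])]
  · intro i j s hs t ht e
    simp only [E₁, Prod.mk.injEq] at e
    obtain ⟨h1, h2, h3⟩ := e
    obtain rfl := coord_inj h1
    refine ⟨rfl, ?_⟩
    have : (s - t) * (coord i - θ i / 2 - coord (σ i)) = 0 := by linarith
    linarith [(mul_eq_zero.1 this).resolve_right (hV i)]
  · intro i j s hs t ht e
    have hij : i = j := σ.injective (coord_inj (by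
      have := congrArg (fun v : Space => v.2.1) e
      simp only [E₂] at this
      split_ifs at this <;> exact this))
    subst hij
    refine ⟨rfl, ?_⟩
    by_cases hi : (i : ℕ) < k
    · simp only [E₂, if_pos hi, Prod.mk.injEq] at e
      linarith [e.2.2]
    · simp only [E₂, if_neg hi, Prod.mk.injEq] at e
      have : (s - t) * coord i = 0 := by linarith [e.1]
      linarith [(mul_eq_zero.1 this).resolve_right (by linarith [hX i])]
  · intro i j s hs t ht e
    have hij : i = j := σ.injective (coord_inj (by
      have := congrArg (fun v : Space => v.2.1) e
      simp only [E₃] at this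
      split_ifs at this <;> exact this))
    subst hij
    refine ⟨rfl, ?_⟩
    by_cases hi : (i : ℕ) < k
    · simp only [E₃, if_pos hi, Prod.mk.injEq] at e
      have : (s - t) * (coord (σ i) - coord i) = 0 := by linarith [e.1]
      linarith [(mul_eq_zero.1 this).resolve_right (by linarith [hu i hi])]
    · simp only [E₃, if_neg hi, Prod.mk.injEq] at e
      have : (s - t) * coord i = 0 := by linarith [e.2.2]
      linarith [(mul_eq_zero.1 this).resolve_right (by linarith [hX i])]
  · rintro i j s ⟨hs0, hs1⟩ t ⟨ht0, ht1⟩ e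
    simp only [E₀, E₁, Prod.mk.injEq] at e
    obtain ⟨h1, h2, h3⟩ := e
    obtain rfl := coord_inj h1
    by_cases hi : (i : ℕ) < k
    · rw [hθu i hi] at h3; linarith
    · have h4 := mul_nonneg ht0 (by linarith [hd i hi, hθ1 i] :
        0 ≤ coord i - θ i / 2 - coord (σ i))
      have h5 := mul_nonneg (by linarith : 0 ≤ 1 - s) (hθ0 i)
      have h6 : (1 - s) * θ i = 0 := by linarith
      have h7 := (mul_eq_zero.1 h6).resolve_left (by linarith)
      rw [h7] at h3; linarith
  · rintro i j s hs t ⟨ht0, ht1⟩ e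
    by_cases hj : (j : ℕ) < k
    · simp only [E₀, E₂, if_pos hj, Prod.mk.injEq] at e
      obtain ⟨h1, h2, h3⟩ := e
      obtain ⟨h4, -⟩ := hE₀ hs h2
      rw [h4] at h1
      linarith [hu j hj]
    · simp only [E₀, E₂, if_neg hj, Prod.mk.injEq] at e
      obtain ⟨h1, h2, h3⟩ := e
      obtain ⟨h4, h5⟩ := hE₀ hs h2
      rw [h4] at h1
      rw [hE₀z h5] at h3
      have h6 : (1 - t) * ((1 + coord j) * (1 - τ)) ≤ (1 - t) * (1 + coord j) := by
        have h7 := mul_nonneg (mul_nonneg (by linarith : 0 ≤ 1 - t)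
          (by linarith [hX j] : 0 ≤ 1 + coord j)) hτ0
        linarith
      have h8 : t = 0 := by linarith [hd j hj, hs.1]
      rw [h8] at h1
      linarith [hd j hj]
  · rintro i j s hs t ⟨ht0, ht1⟩ e
    by_cases hj : (j : ℕ) < k
    · simp only [E₀, E₃, if_pos hj, Prod.mk.injEq] at e
      obtain ⟨h1, h2, h3⟩ := e
      obtain ⟨h4, -⟩ := hE₀ hs h2
      rw [h4] at h1
      have : (1 - t) * (coord (σ j) - coord j) = 0 := by linarith
      exact mul_ne_zero (by linarith) (by linarith [hu j hj]) this
    · simp only [E₀, E₃, if_neg hj, Prod.mk.injEq] at e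
      obtain ⟨h1, h2, h3⟩ := e
      obtain ⟨h4, -⟩ := hE₀ hs h2
      rw [h4] at h1
      have : (1 - t) * coord (σ j) = 0 := by linarith
      exact mul_ne_zero (by linarith) (by linarith [hX (σ j)]) this
  · rintro i j s ⟨hs0, hs1⟩ t ⟨ht0, ht1⟩ e
    by_cases hj : (j : ℕ) < k
    · simp only [E₁, E₂, if_pos hj, Prod.mk.injEq] at e
      obtain ⟨h1, h2, h3⟩ := e
      obtain rfl := coord_inj h1
      have : (1 - s) * (coord i - θ i / 2 - coord (σ i)) = 0 := by linarith
      exact mul_ne_zero (by linarith) (hV i) this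
    · simp only [E₁, E₂, if_neg hj, Prod.mk.injEq] at e
      obtain ⟨h1, h2, h3⟩ := e
      by_cases hij : i = j
      · subst hij
        have : (1 - s) * (coord i - θ i / 2 - coord (σ i)) = 0 := by
          have : t * coord i = 0 := by linarith
          have := (mul_eq_zero.1 this).resolve_right (by linarith [hX i])
          linarith
        exact mul_ne_zero (by linarith) (hV i) this
      have hlt : coord i < coord j := by
        have h4 := mul_nonneg ht0 (by linarith [hX j] : 0 ≤ coord j)
        refine lt_of_le_of_ne (by linarith) fun h => hij (coord_inj h)
      by_cases hi : (i : ℕ) < k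
      · rw [hθu i hi] at h3
        have h6 : (1 - t) * ((1 + coord j) * (1 - τ)) ≤ (1 - t) * (1 + coord j) := by
          have h7 := mul_nonneg (mul_nonneg (by linarith : 0 ≤ 1 - t)
            (by linarith [hX j] : 0 ≤ 1 + coord j)) hτ0
          linarith
        linarith
      · -- the lowered vertical edge at `i` passes over the lower horizontal edge of `j`
        rw [hθd i hi] at h3
        have h5 : (1 - t) * ((1 + coord j) * (1 - τ)) = (1 - t + coord i) * (1 - τ) := by
          rw [h1]; ring
        have h6 := mul_nonneg (mul_nonneg (by linarith : 0 ≤ 1 - s) hτ0)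
          (by linarith [hX i] : 0 ≤ coord i)
        have h7 := mul_nonneg ht0 (by linarith : 0 ≤ 1 - τ)
        linarith
  · rintro i j s ⟨hs0, hs1⟩ t ⟨ht0, ht1⟩ e
    by_cases hj : (j : ℕ) < k
    · simp only [E₁, E₃, if_pos hj, Prod.mk.injEq] at e
      obtain ⟨h1, h2, h3⟩ := e
      by_cases hi : (i : ℕ) < k
      · rw [hθu i hi] at h3; linarith
      · have h4 := mul_nonneg hs0 (by linarith [hd i hi, hθ1 i] :
          0 ≤ coord i - θ i / 2 - coord (σ i))
        have h5 := mul_pos (by linarith : 0 < 1 - t)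
          (by linarith [hu j hj] : 0 < coord (σ j) - coord j)
        linarith [hθ0 i]
    · simp only [E₁, E₃, if_neg hj, Prod.mk.injEq] at e
      obtain ⟨h1, h2, h3⟩ := e
      by_cases hi : (i : ℕ) < k
      · rw [hθu i hi] at h3
        have := mul_nonneg (by linarith : 0 ≤ 1 - t) (by linarith [hX j] : 0 ≤ coord j)
        linarith
      · have h4 := mul_nonneg hs0 (by linarith [hd i hi, hθ1 i] :
          0 ≤ coord i - θ i / 2 - coord (σ i))
        have h5 := mul_pos (by linarith : 0 < 1 - t) (by linarith [hX (σ j)] : 0 < coord (σ j))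
        linarith [hθ0 i]
  · rintro i j s ⟨hs0, hs1⟩ t ⟨ht0, ht1⟩ e
    have hij : i = j := σ.injective (coord_inj (by
      have := congrArg (fun v : Space => v.2.1) e
      simp only [E₂, E₃] at this
      split_ifs at this <;> exact this))
    subst hij
    by_cases hi : (i : ℕ) < k
    · simp only [E₂, E₃, if_pos hi, Prod.mk.injEq] at e
      linarith [e.2.2]
    · simp only [E₂, E₃, if_neg hi, Prod.mk.injEq] at e
      obtain ⟨h1, -, h3⟩ := e
      -- otherwise the two edges would have the same slope
      have h4 : (1 - s) * ((1 + coord i) * (1 - τ) * coord (σ i) - coord i * coord i) = 0 := by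
        linear_combination coord (σ i) * h3 - coord i * h1
      have h5 := (mul_eq_zero.1 h4).resolve_left (by linarith)
      have h6 : (1 + coord i) * coord (σ i) ≤ (1 + coord i) * (coord i - 1) :=
        mul_le_mul_of_nonneg_left (by linarith [hd i hi]) (by linarith [hX i])
      have h7 := mul_nonneg (mul_nonneg (by linarith [hX i] : 0 ≤ 1 + coord i) hτ0)
        (by linarith [hX (σ i)] : 0 ≤ coord (σ i))
      linarith

lemma coord_ne_sub_half (i j : Fin n) : coord i ≠ coord j - 1 / 2 := by
  intro h
  obtain rfl := eq_of_coord_lt (i := i) (j := j) (by linarith) (by linarith)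
  linarith

/-- The curve is a link throughout the motion that turns the arcs below the diagonal into closing
strings. That `σ` is increasing below the diagonal keeps these arcs disjoint. -/
lemma isLink_low_closed (hup : ∀ i : Fin n, (i : ℕ) < k → i < σ i)
    (hdown : ∀ i : Fin n, ¬ (i : ℕ) < k → σ i < i)
    (hmono : ∀ i j : Fin n, ¬ (i : ℕ) < k → i < j → σ i < σ j)
    {τ : ℝ} (hτ : τ ∈ Set.Icc (0 : ℝ) 1) :
    (arcCurve σ fun c i => (1 - τ) • lowPos k σ c i + τ • closedPos k σ c i).IsLink := by
  obtain ⟨hτ0, hτ1⟩ := hτ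
  -- the abscissa of the first vertex of an arc, and the depth of a closing string
  let A : Fin n → ℝ := fun i =>
    if (i : ℕ) < k then coord i else (1 - τ) * coord i + τ * ((k : ℝ) + 1)
  let ζ : Fin n → ℝ := fun i => (1 - τ) * coord i + τ
  have hu : ∀ i : Fin n, (i : ℕ) < k → coord i + 1 ≤ coord (σ i) := fun i h =>
    coord_add_one_le (hup i h)
  have hd : ∀ i : Fin n, ¬ (i : ℕ) < k → coord (σ i) + 1 ≤ coord i := fun i h =>
    coord_add_one_le (hdown i h)
  have hX : ∀ i : Fin n, 1 ≤ coord i := one_le_coord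
  have hk0 : (0 : ℝ) ≤ k := Nat.cast_nonneg k
  have hku : ∀ i : Fin n, (i : ℕ) < k → coord i ≤ k := fun i h => coord_le_of_lt h
  have hkd : ∀ i : Fin n, ¬ (i : ℕ) < k → (k : ℝ) + 1 ≤ coord i := fun i h => le_coord_of_le h
  have hAu : ∀ i : Fin n, (i : ℕ) < k → A i = coord i := fun i h => if_pos h
  have hAd : ∀ i : Fin n, ¬ (i : ℕ) < k → A i = (1 - τ) * coord i + τ * ((k : ℝ) + 1) :=
    fun i h => if_neg h
  have hAk : ∀ i : Fin n, ¬ (i : ℕ) < k → (k : ℝ) + 1 ≤ A i := by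
    intro i h
    rw [hAd i h]
    have := mul_le_mul_of_nonneg_left (hkd i h) (by linarith : 0 ≤ 1 - τ)
    linarith
  have hA0 : ∀ i : Fin n, 1 ≤ A i := by
    intro i
    by_cases hi : (i : ℕ) < k
    · rw [hAu i hi]; exact hX i
    · linarith [hAk i hi]
  have hAmono : ∀ i j : Fin n, i < j → ¬ (j : ℕ) < k → A i ≤ A j := by
    intro i j hij hj
    by_cases hi : (i : ℕ) < k
    · rw [hAu i hi]; linarith [hAk j hj, hku i hi]
    · rw [hAd i hi, hAd j hj]
      have := mul_le_mul_of_nonneg_left (coord_add_one_le hij) (by linarith : 0 ≤ 1 - τ)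
      linarith
  have hAσ : ∀ i : Fin n, (i : ℕ) < k → coord i + 1 ≤ A (σ i) := by
    intro i hi
    by_cases h : (σ i : ℕ) < k
    · rw [hAu _ h]; exact hu i hi
    · linarith [hAk _ h, hku i hi]
  have hζ : ∀ i, 1 ≤ ζ i := by
    intro i
    have := mul_le_mul_of_nonneg_left (hX i) (by linarith : 0 ≤ 1 - τ)
    simp only [ζ]; linarith
  let E₀ : Fin n → ℝ → Space := fun i s =>
    if (i : ℕ) < k then (coord i + s * (τ / 4), coord i, s)
    else (A i + s * (τ / 2), coord i - s / 2, -(s * (τ / 2)))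
  let E₁ : Fin n → ℝ → Space := fun i s =>
    if (i : ℕ) < k then
      (coord i + τ / 4 + s * (τ / 4), (1 - s) * coord i + s * coord (σ i), 1)
    else (A i + τ / 2 + s * (τ / 2), (1 - s) * (coord i - 1 / 2) + s * coord (σ i),
      -((1 - s) * (τ / 2) + s * ζ i))
  let E₂ : Fin n → ℝ → Space := fun i s =>
    if (i : ℕ) < k then (coord i + τ / 2 + s * (τ / 4), coord (σ i), 1 - s)
    else ((1 - s) * (A i + τ), coord (σ i), -ζ i)
  let E₃ : Fin n → ℝ → Space := fun i s =>
    if (i : ℕ) < k then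
      ((1 - s) * (coord i + 3 / 4 * τ) + s * A (σ i), coord (σ i), 0)
    else (s * A (σ i), coord (σ i), -((1 - s) * ζ i))
  have hb : ∀ {s : ℝ}, s ∈ Set.Ico (0 : ℝ) 1 → 0 ≤ s * τ ∧ s * τ ≤ τ := by
    intro s hs
    exact ⟨mul_nonneg hs.1 hτ0, mul_le_of_le_one_left hτ0 hs.2.le⟩
  -- the depth of the second edge of an arc below the diagonal
  have hz1 : ∀ {s : ℝ} (i : Fin n), s ∈ Set.Ico (0 : ℝ) 1 →
      0 ≤ (1 - s) * (τ / 2) + s * ζ i ∧ (1 - s) * (τ / 2) + s * ζ i < ζ i := by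
    intro s i hs
    have h1 := mul_nonneg (by linarith [hs.2] : 0 ≤ 1 - s) hτ0
    have h2 := mul_nonneg hs.1 (by linarith [hζ i] : 0 ≤ ζ i)
    have h3 := mul_pos (by linarith [hs.2] : 0 < 1 - s) (by linarith [hζ i] : 0 < ζ i - τ / 2)
    constructor <;> linarith
  -- the height of the second edge of an arc below the diagonal
  have hy1 : ∀ {s : ℝ} (i : Fin n), ¬ (i : ℕ) < k → s ∈ Set.Ico (0 : ℝ) 1 →
      coord (σ i) < (1 - s) * (coord i - 1 / 2) + s * coord (σ i) ∧
      (1 - s) * (coord i - 1 / 2) + s * coord (σ i) ≤ coord i - 1 / 2 := by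
    intro s i hi hs
    have h1 := mul_pos (by linarith [hs.2] : 0 < 1 - s)
      (by linarith [hd i hi] : 0 < coord i - 1 / 2 - coord (σ i))
    have h2 := mul_nonneg hs.1 (by linarith [hd i hi] : 0 ≤ coord i - 1 / 2 - coord (σ i))
    constructor <;> linarith
  have hhalf : ∀ {i j : Fin n} {s : ℝ}, s ∈ Set.Ico (0 : ℝ) 1 → coord i - s / 2 = coord j →
      i = j ∧ s = 0 := by
    intro i j s hs h
    have hij : i = j := eq_of_coord_lt (by linarith [hs.2]) (by linarith [hs.1])
    subst hij
    exact ⟨rfl, by linarith⟩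
  refine isLink_of_apart E₀ E₁ E₂ E₃ ?_ ?_ ?_ ?_ ?_ ?_ ?_ ?_ ?_ ?_ ?_ ?_ ?_ ?_
  iterate 4
    intro i s
    simp only [E₀, E₁, E₂, E₃, A, ζ, lowPos, closedPos, diagPos]
    split_ifs <;>
      simp only [Matrix.cons_val, Prod.smul_mk, Prod.mk_add_mk, smul_eq_mul, Prod.mk.injEq] <;>
      refine ⟨?_, ?_, ?_⟩ <;> ring
  · intro i j s hs t ht e
    by_cases hi : (i : ℕ) < k <;> by_cases hj : (j : ℕ) < k <;>
      simp only [E₀, hi, hj, if_true, if_false, Prod.mk.injEq] at e <;> obtain ⟨h1, h2, h3⟩ := e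
    · exact ⟨coord_inj h2, h3⟩
    · have := hb ht
      have hs0 : s = 0 := by linarith [hs.1]
      rw [hs0] at h1
      linarith [hku i hi, hAk j hj]
    · have := hb hs
      have ht0 : t = 0 := by linarith [ht.1]
      rw [ht0] at h1
      linarith [hku j hj, hAk i hi]
    · have hij : i = j :=
        eq_of_coord_lt (by linarith [hs.2, ht.1]) (by linarith [ht.2, hs.1])
      subst hij
      exact ⟨rfl, by linarith⟩
  · have key : ∀ i j : Fin n, i < j → ¬ (i : ℕ) < k → ¬ (j : ℕ) < k → ∀ s ∈ Set.Ico (0 : ℝ) 1,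
        ∀ t ∈ Set.Ico (0 : ℝ) 1, A i + τ / 2 + s * (τ / 2) = A j + τ / 2 + t * (τ / 2) →
        (1 - s) * (coord i - 1 / 2) + s * coord (σ i) =
          (1 - t) * (coord j - 1 / 2) + t * coord (σ j) → False := by
      -- the abscissae force `s ≥ t`, and then the heights cannot agree
      intro i j hij hi hj s hs t ht h1 h2
      rw [hAd i hi, hAd j hj] at h1
      have h3 := coord_add_one_le hij
      have h4 := coord_add_one_le (hmono i j hi hij)
      rcases le_or_gt t s with hst | hst
      · have h5 := mul_nonneg (by linarith : 0 ≤ s - t)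
          (by linarith [hd i hi] : 0 ≤ coord i - 1 / 2 - coord (σ i))
        have h6 := mul_pos (by linarith [ht.2] : 0 < 1 - t)
          (by linarith : 0 < coord j - coord i)
        have h7 := mul_nonneg ht.1 (by linarith : 0 ≤ coord (σ j) - coord (σ i))
        linarith
      · have h5 := mul_nonneg (by linarith : 0 ≤ t - s) hτ0
        have h6 := mul_nonneg (by linarith : 0 ≤ 1 - τ) (by linarith : 0 ≤ coord j - coord i - 1)
        have h7 : τ = 1 := by linarith
        rw [h7] at h1; linarith
    intro i j s hs t ht e
    by_cases hi : (i : ℕ) < k <;> by_cases hj : (j : ℕ) < k <;>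
      simp only [E₁, hi, hj, if_true, if_false, Prod.mk.injEq] at e <;> obtain ⟨h1, h2, h3⟩ := e
    · have := hb hs
      have := hb ht
      obtain rfl := eq_of_coord_lt (i := i) (j := j) (by linarith) (by linarith)
      have : (s - t) * (coord (σ i) - coord i) = 0 := by linarith
      exact ⟨rfl, by linarith [(mul_eq_zero.1 this).resolve_right (by linarith [hu i hi])]⟩
    · linarith [(hz1 j ht).1]
    · linarith [(hz1 i hs).1]
    · rcases lt_trichotomy i j with hij | rfl | hij
      · exact (key i j hij hi hj s hs t ht h1 h2).elim
      · have : (s - t) * (coord i - 1 / 2 - coord (σ i)) = 0 := by linarith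
        exact ⟨rfl, by linarith [(mul_eq_zero.1 this).resolve_right (by linarith [hd i hi])]⟩
      · exact (key j i hij hj hi t ht s hs h1.symm h2.symm).elim
  · intro i j s hs t ht e
    have hij : i = j := σ.injective (coord_inj (by
      have := congrArg (fun v : Space => v.2.1) e
      simp only [E₂] at this
      split_ifs at this <;> exact this))
    subst hij
    refine ⟨rfl, ?_⟩
    by_cases hi : (i : ℕ) < k <;>
      simp only [E₂, hi, if_true, if_false, Prod.mk.injEq] at e
    · linarith [e.2.2]
    · have : (s - t) * (A i + τ) = 0 := by linarith [e.1]
      linarith [(mul_eq_zero.1 this).resolve_right (by linarith [hA0 i])]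
  · intro i j s hs t ht e
    have hij : i = j := σ.injective (coord_inj (by
      have := congrArg (fun v : Space => v.2.1) e
      simp only [E₃] at this
      split_ifs at this <;> exact this))
    subst hij
    refine ⟨rfl, ?_⟩
    by_cases hi : (i : ℕ) < k <;>
      simp only [E₃, hi, if_true, if_false, Prod.mk.injEq] at e
    · have : (s - t) * (A (σ i) - (coord i + 3 / 4 * τ)) = 0 := by linarith [e.1]
      linarith [(mul_eq_zero.1 this).resolve_right (by linarith [hAσ i hi])]
    · have : (s - t) * ζ i = 0 := by linarith [e.2.2]
      linarith [(mul_eq_zero.1 this).resolve_right (by linarith [hζ i])]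
  · intro i j s hs t ht e
    have hbs := hb hs
    have hbt := hb ht
    by_cases hi : (i : ℕ) < k <;> by_cases hj : (j : ℕ) < k <;>
      simp only [E₀, E₁, hi, hj, if_true, if_false, Prod.mk.injEq] at e <;>
      obtain ⟨h1, h2, h3⟩ := e
    · linarith [hs.2]
    · linarith [hku i hi, hAk j hj]
    · linarith
    · have hy := hy1 j hj ht
      rcases lt_trichotomy i j with hij | rfl | hij
      · have h4 := hAmono i j hij hj
        have h5 : τ * (1 + t - s) = 0 := by
          have := mul_nonneg hτ0 (by linarith [hs.2, ht.1] : 0 ≤ 1 + t - s)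
          linarith
        have h6 := (mul_eq_zero.1 h5).resolve_right (by linarith [hs.2, ht.1])
        rw [hAd i hi, hAd j hj, h6] at h1
        linarith [coord_add_one_le hij]
      · linarith [hs.2]
      · linarith [coord_add_one_le hij, hs.2]
  · intro i j s hs t ht e
    have hbs := hb hs
    have hbt := hb ht
    by_cases hi : (i : ℕ) < k <;> by_cases hj : (j : ℕ) < k <;>
      simp only [E₀, E₂, hi, hj, if_true, if_false, Prod.mk.injEq] at e <;>
      obtain ⟨h1, h2, h3⟩ := e
    · linarith [hu j hj]
    · linarith [hζ j, hs.1]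
    · linarith [ht.2]
    · linarith [hζ j]
  · intro i j s hs t ht e
    have hbs := hb hs
    have hbt := hb ht
    by_cases hi : (i : ℕ) < k <;> by_cases hj : (j : ℕ) < k <;>
      simp only [E₀, E₃, hi, hj, if_true, if_false, Prod.mk.injEq] at e <;>
      obtain ⟨h1, h2, h3⟩ := e
    · obtain rfl := coord_inj h2
      rw [hAu _ hi, h3] at h1
      have := mul_pos (by linarith [ht.2] : 0 < 1 - t)
        (by linarith [hu j hj] : 0 < coord (σ j) - (coord j + 3 / 4 * τ))
      linarith
    · have := mul_pos (by linarith [ht.2] : 0 < 1 - t) (by linarith [hζ j] : 0 < ζ j)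
      linarith [hs.1]
    · obtain ⟨rfl, rfl⟩ := hhalf hs h2
      have := mul_pos (by linarith [ht.2] : 0 < 1 - t)
        (by linarith [hAσ j hj] : 0 < A (σ j) - (coord j + 3 / 4 * τ))
      linarith
    · obtain ⟨rfl, rfl⟩ := hhalf hs h2
      have := mul_pos (by linarith [ht.2] : 0 < 1 - t) (by linarith [hζ j] : 0 < ζ j)
      linarith
  · intro i j s hs t ht e
    have hbs := hb hs
    have hbt := hb ht
    by_cases hi : (i : ℕ) < k <;> by_cases hj : (j : ℕ) < k <;>
      simp only [E₁, E₂, hi, hj, if_true, if_false, Prod.mk.injEq] at e <;>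
      obtain ⟨h1, h2, h3⟩ := e
    · have ht0 : t = 0 := by linarith
      rw [ht0] at h1
      obtain rfl := eq_of_coord_lt (i := i) (j := j) (by linarith) (by linarith)
      have := mul_pos (by linarith [hs.2] : 0 < 1 - s)
        (by linarith [hu i hi] : 0 < coord (σ i) - coord i)
      linarith
    · linarith [hζ j]
    · linarith [(hz1 i hs).1, ht.2]
    · have hz := hz1 i hs
      have hy := hy1 i hi hs
      have h4 : ζ j < ζ i := by linarith
      have hji : j < i := by
        rcases lt_trichotomy j i with h | rfl | h
        · exact h
        · exact absurd h4 (lt_irrefl _)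
        · have := mul_le_mul_of_nonneg_left (coord_add_one_le h) (by linarith : 0 ≤ 1 - τ)
          simp only [ζ] at h4
          linarith
      linarith [coord_add_one_le (hmono j i hj hji)]
  · intro i j s hs t ht e
    have hbs := hb hs
    have hbt := hb ht
    by_cases hi : (i : ℕ) < k <;> by_cases hj : (j : ℕ) < k <;>
      simp only [E₁, E₃, hi, hj, if_true, if_false, Prod.mk.injEq] at e <;>
      obtain ⟨h1, h2, h3⟩ := e
    · linarith
    · have := mul_pos (by linarith [ht.2] : 0 < 1 - t) (by linarith [hζ j] : 0 < ζ j)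
      linarith
    · have h4 := mul_nonneg (by linarith [hs.2] : 0 ≤ 1 - s) hτ0
      have h5 := mul_nonneg hs.1 (by linarith [hζ i] : 0 ≤ ζ i)
      have h6 : s * ζ i = 0 := by linarith
      have h7 := (mul_eq_zero.1 h6).resolve_right (by linarith [hζ i])
      rw [h7] at h2
      exact coord_ne_sub_half (σ j) i (by linarith)
    · have hy := hy1 i hi hs
      have h4 : σ j < i := by
        rcases lt_trichotomy (σ j) i with h | h | h
        · exact h
        · rw [h] at h2; linarith
        · linarith [coord_add_one_le h]
      have h5 := hAmono _ _ h4 hi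
      have h6 := mul_pos (by linarith [ht.2] : 0 < 1 - t) (by linarith [hA0 (σ j)] : 0 < A (σ j))
      linarith
  · intro i j s hs t ht e
    have hij : i = j := σ.injective (coord_inj (by
      have := congrArg (fun v : Space => v.2.1) e
      simp only [E₂, E₃] at this
      split_ifs at this <;> exact this))
    subst hij
    by_cases hi : (i : ℕ) < k <;>
      simp only [E₂, E₃, hi, if_true, if_false, Prod.mk.injEq] at e
    · linarith [e.2.2, hs.2]
    · obtain ⟨h1, -, h3⟩ := e
      have h4 : t * ζ i = 0 := by linarith
      have h5 := (mul_eq_zero.1 h4).resolve_right (by linarith [hζ i])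
      rw [h5] at h1
      have h6 := mul_pos (by linarith [hs.2] : 0 < 1 - s) (by linarith [hA0 i] : 0 < A i + τ)
      linarith

/-- The diagonal link is isotopic to the curve all of whose arcs below the diagonal are closing
strings behind the arcs above the diagonal. -/
theorem isotopic_diagLink_closed (hup : ∀ i : Fin n, (i : ℕ) < k → i < σ i)
    (hdown : ∀ i : Fin n, ¬ (i : ℕ) < k → σ i < i)
    (hmono : ∀ i j : Fin n, ¬ (i : ℕ) < k → i < j → σ i < σ j) :
    (diagLink σ).Isotopic (arcCurve σ (closedPos k σ)) := by
  have h1 : (arcCurve σ (diagPos σ)).Isotopic (arcCurve σ (hookPos k σ)) :=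
    PolygonalCurve.isotopic_of_forall_isLink (K := arcCurve σ (diagPos σ))
      (fun v => hookPos k σ v.1 v.2) fun τ hτ => isLink_diag_hook hup hdown hτ
  have h2 : (arcCurve σ (hookPos k σ)).Isotopic (arcCurve σ (lowPos k σ)) :=
    PolygonalCurve.isotopic_of_forall_isLink (K := arcCurve σ (hookPos k σ))
      (fun v => lowPos k σ v.1 v.2) fun τ hτ => isLink_hook_low hup hdown hτ
  have h3 : (arcCurve σ (lowPos k σ)).Isotopic (arcCurve σ (closedPos k σ)) :=
    PolygonalCurve.isotopic_of_forall_isLink (K := arcCurve σ (lowPos k σ))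
      (fun v => closedPos k σ v.1 v.2) fun τ hτ => isLink_low_closed hup hdown hmono hτ
  rw [diagLink_eq]
  exact (h1.trans h2).trans h3

end ArcCurve

/-! ### Lorenz data and the columns of the braid of a shuffle -/

/-- The description of a shuffle `σ ∈ S_n` without fixed points by its Lorenz vector
`⟨d 0, …, d (k - 1)⟩` and the conjugate vector `ι`, where `ι r` is the number of entries of the
Lorenz vector that are at most `r`. All points are counted from `0`. -/
structure LorenzData (n k p : ℕ) (d ι : ℕ → ℕ) (σ : Equiv.Perm (Fin n)) : Prop where
  card : n = k + p
  k_pos : 0 < k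
  d_pos : ∀ i < k, 0 < d i
  d_le : ∀ i < k, d i ≤ p
  ι_le_iff : ∀ i < k, ∀ r, ι r ≤ i ↔ r < d i
  ι_lt : ∀ r < p, ι r < k
  ι_mono : Monotone ι
  σ_up : ∀ i : Fin n, (i : ℕ) < k → (σ i : ℕ) = i + d i
  σ_down : ∀ i : Fin n, k ≤ (i : ℕ) → (σ i : ℕ) = (i - k) + ι (i - k)

namespace LorenzData

/-- The word `σ₁ ⋯ σ_{m-1}` between two trivial letters. -/
def blockWord (m : ℕ) : List ℕ := 0 :: (List.range' 1 (m - 1) ++ [0])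

/-- The braid word of the T-link with additional trivial letters: one at the start and one at the
end of each block, and one at the end of the word. -/
def paddedWord (k : ℕ) (d : ℕ → ℕ) : List ℕ :=
  (List.range k).flatMap (fun i => blockWord (d i)) ++ [0]

/-- The number of letters before block `i`. -/
def blockStart (d : ℕ → ℕ) (i : ℕ) : ℕ := ∑ j ∈ Finset.range i, (d j + 1)

/-- The successor of the column with number `o` of block `i`. Block `i < k` has `2 (d i + 1)`
columns, two for each letter; block `k` is not bounded. -/
def nextCursor (k : ℕ) (d : ℕ → ℕ) (q : ℕ × ℕ) : ℕ × ℕ :=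
  if q.1 < k ∧ q.2 = 2 * d q.1 + 1 then (q.1 + 1, 0) else (q.1, q.2 + 1)

/-- The block of a column and its number within the block. -/
def cursor (k : ℕ) (d : ℕ → ℕ) : ℕ → ℕ × ℕ
  | 0 => (0, 0)
  | c + 1 => nextCursor k d (cursor k d c)

/-- The permutation of the strings after the column with number `o` of block `i`. -/
def blockPerm (p k : ℕ) (d : ℕ → ℕ) (q : ℕ × ℕ) : Equiv.Perm (Fin p) :=
  if q.1 < k ∧ q.2 % 2 = 1 ∧ q.2 / 2 < d q.1 then artinPerm p (q.2 / 2) else 1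

lemma blockWord_length {m : ℕ} (hm : 0 < m) : (blockWord m).length = m + 1 := by
  simp only [blockWord, List.length_cons, List.length_append, List.length_range', List.length_nil]
  lia

lemma blockWord_getElem? {m l : ℕ} (hm : 0 < m) (hl : l ≤ m) :
    (blockWord m)[l]? = some (if l < m then l else 0) := by
  unfold blockWord
  cases l with
  | zero => simp
  | succ l =>
    rw [List.getElem?_cons_succ]
    by_cases h : l + 1 < m
    · rw [if_pos h, List.getElem?_append_left (by simp; lia), List.getElem?_range' (by lia)]
      simp; lia
    · rw [if_neg h, List.getElem?_append_right (by simp; lia)]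
      have : l - (List.range' 1 (m - 1)).length = 0 := by simp; lia
      rw [this]; rfl

variable {n k p : ℕ} {d ι : ℕ → ℕ} {σ : Equiv.Perm (Fin n)}

lemma blockStart_succ (d : ℕ → ℕ) (i : ℕ) :
    blockStart d (i + 1) = blockStart d i + (d i + 1) := by
  rw [blockStart, Finset.sum_range_succ]; rfl

lemma flatMap_length (hd : ∀ i < k, 0 < d i) :
    ((List.range k).flatMap fun i => blockWord (d i)).length = blockStart d k := by
  induction k with
  | zero => rfl
  | succ k ih =>
    rw [List.range_succ, List.flatMap_append, List.length_append,
      ih (fun i hi => hd i (by lia)), blockStart_succ]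
    simp [blockWord_length (hd k (by lia))]

lemma flatMap_getElem? (hd : ∀ i < k, 0 < d i) {i l : ℕ} (hi : i < k) (hl : l ≤ d i) :
    ((List.range k).flatMap fun i => blockWord (d i))[blockStart d i + l]? =
      (blockWord (d i))[l]? := by
  induction k with
  | zero => lia
  | succ k ih =>
    have hd' : ∀ i < k, 0 < d i := fun i hi => hd i (by lia)
    have hlen := flatMap_length hd'
    rw [List.range_succ, List.flatMap_append]
    rcases Nat.lt_succ_iff_lt_or_eq.1 hi with h | rfl
    · rw [← ih hd' h, List.getElem?_append_left]
      by_contra hge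
      have h2 := ih hd' h
      rw [List.getElem?_eq_none (by lia), blockWord_getElem? (hd' i h) hl] at h2
      exact Option.some_ne_none _ h2.symm
    · rw [List.getElem?_append_right (by lia), hlen, Nat.add_sub_cancel_left]
      simp

lemma paddedWord_length (hd : ∀ i < k, 0 < d i) :
    (paddedWord k d).length = blockStart d k + 1 := by
  rw [paddedWord, List.length_append, flatMap_length hd]; rfl

lemma paddedWord_getElem? (hd : ∀ i < k, 0 < d i) {i l : ℕ} (hi : i < k) (hl : l ≤ d i) :
    (paddedWord k d)[blockStart d i + l]? = some (if l < d i then l else 0) := by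
  have h := flatMap_getElem? hd hi hl
  rw [blockWord_getElem? (hd i hi) hl] at h
  rw [paddedWord, List.getElem?_append_left, h]
  exact (List.getElem?_eq_some_iff.1 h).1

lemma cursor_spec (k : ℕ) (d : ℕ → ℕ) (c : ℕ) :
    (cursor k d c).1 ≤ k ∧ c = 2 * blockStart d (cursor k d c).1 + (cursor k d c).2 ∧
      ((cursor k d c).1 < k → (cursor k d c).2 ≤ 2 * d (cursor k d c).1 + 1) := by
  induction c with
  | zero => simp [cursor, blockStart]
  | succ c ih =>
    obtain ⟨h1, h2, h3⟩ := ih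
    simp only [cursor, nextCursor]
    split_ifs with h
    · refine ⟨h.1, ?_, fun _ => Nat.zero_le _⟩
      simp only [blockStart_succ]
      lia
    · refine ⟨h1, by simp only; lia, fun h4 => ?_⟩
      have := h3 h4
      have : (cursor k d c).2 ≠ 2 * d (cursor k d c).1 + 1 := fun h5 => h ⟨h4, h5⟩
      simp only; lia

lemma cursor_add {c i o : ℕ} (h : cursor k d c = (i, 0)) (ho : i < k → o ≤ 2 * d i + 1) :
    cursor k d (c + o) = (i, o) := by
  induction o with
  | zero => exact h
  | succ o ih =>
    rw [← add_assoc, cursor, ih (fun hi => by have := ho hi; lia), nextCursor, if_neg]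
    rintro ⟨h1, h2⟩
    have := ho h1
    simp only at h2
    lia

lemma cursor_blockStart {i : ℕ} (hi : i ≤ k) : cursor k d (2 * blockStart d i) = (i, 0) := by
  induction i with
  | zero => rfl
  | succ i ih =>
    have h := cursor_add (ih (by lia)) (o := 2 * d i + 1) fun _ => le_rfl
    rw [blockStart_succ,
      show 2 * (blockStart d i + (d i + 1)) = 2 * blockStart d i + (2 * d i + 1) + 1 by lia,
      cursor, h, nextCursor, if_pos ⟨by simp only; lia, rfl⟩]

lemma cursor_eq {i o : ℕ} (hi : i ≤ k) (ho : i < k → o ≤ 2 * d i + 1) :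
    cursor k d (2 * blockStart d i + o) = (i, o) :=
  cursor_add (cursor_blockStart hi) ho

/-- The permutation at a column of the closed braid, in terms of the block of the column. -/
lemma columnPerm_paddedWord (hd : ∀ i < k, 0 < d i) (c : ℕ) :
    columnPerm p (paddedWord k d) c = blockPerm p k d (cursor k d c) := by
  obtain ⟨h1, h2, h3⟩ := cursor_spec k d c
  generalize cursor k d c = q at h1 h2 h3 ⊢
  obtain ⟨i, o⟩ := q
  simp only at h1 h2 h3
  unfold blockPerm
  simp only
  by_cases ho : o % 2 = 1
  swap
  · rw [if_neg (fun h => ho h.2.1), columnPerm, dif_neg]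
    lia
  obtain ⟨l, hl⟩ : ∃ l, o = 2 * l + 1 := ⟨o / 2, by lia⟩
  have hc : c = 2 * (blockStart d i + l) + 1 := by lia
  have hol : o / 2 = l := by lia
  by_cases hi : i < k
  · have hld : l ≤ d i := by have := h3 hi; lia
    obtain ⟨hlt, hw⟩ := List.getElem?_eq_some_iff.1 (paddedWord_getElem? hd hi hld)
    rw [hc, ColumnPos.columnPerm_odd hlt, hw, hol]
    split_ifs with h4 h5 h5
    · rfl
    · exact (h5 ⟨hi, ho, h4⟩).elim
    · exact (h4 h5.2.2).elim
    · simp [artinPerm]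
  · rw [if_neg (fun h => hi h.1)]
    have hik : i = k := by lia
    have hlen := paddedWord_length hd
    rcases Nat.eq_zero_or_pos l with rfl | hl0
    · have hlt : blockStart d i + 0 < (paddedWord k d).length := by rw [hlen, hik]; lia
      have hw : (paddedWord k d)[blockStart d i + 0] = 0 := by
        have : (paddedWord k d)[blockStart d i + 0]? = some 0 := by
          rw [hik, paddedWord, List.getElem?_append_right (by rw [flatMap_length hd]; lia),
            flatMap_length hd]
          simp
        rw [List.getElem?_eq_getElem hlt] at this
        exact Option.some_injective _ this
      rw [hc, ColumnPos.columnPerm_odd hlt, hw]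
      simp [artinPerm]
    · exact ColumnPos.columnPerm_of_le (by rw [hlen, hc, hik]; lia)

lemma filter_paddedWord :
    (paddedWord k d).filter (· ≠ 0) =
      (List.range k).flatMap fun i => List.range' 1 (d i - 1) := by
  have h : ∀ m, (List.range' 1 m).filter (· ≠ 0) = List.range' 1 m := by
    intro m
    rw [List.filter_eq_self]
    intro a ha
    rw [List.mem_range'_1] at ha
    simp; lia
  rw [paddedWord, List.filter_append, List.filter_flatMap]
  simp only [blockWord]
  simp
  congr 1
  funext i
  simpa using h (d i - 1)

end LorenzData

namespace LorenzData

open ArcCurve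

/-! ### The arcs of the closed form as strings of a braid -/

variable {n k p : ℕ} {d ι : ℕ → ℕ} {σ : Equiv.Perm (Fin n)}

/-- The height of the string in position `r`, in the column with number `o` of block `i`. The
string in position `o / 2 - 1`, which is about to run along arc `i`, is excepted. -/
def height (ι : ℕ → ℕ) (q : ℕ × ℕ) (r : ℕ) : ℕ :=
  if r < q.2 / 2 - 1 then q.1 + 1 + r else r + max q.1 (ι r)

/-- The edge of the closed form that carries the string in position `r`. In block `i < k`, the
string in position `o / 2 - 1` runs along arc `i`, and the others are on the last edges of their
arcs. In block `k` each string runs along an arc below the diagonal. -/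
def arcVertex [NeZero n] (k : ℕ) (d ι : ℕ → ℕ) (σ : Equiv.Perm (Fin n)) (q : ℕ × ℕ) (r : ℕ) :
    Fin 4 × Fin n :=
  if q.1 < k then
    if r = q.2 / 2 - 1 then
      (if q.2 = 0 then 0 else if q.2 < 2 * d q.1 then 1 else if q.2 = 2 * d q.1 then 2 else 3,
        Fin.ofNat n q.1)
    else (3, σ.symm (Fin.ofNat n (height ι q r)))
  else (if q.2 = 0 then 0 else if q.2 ≤ 2 then 1 else if q.2 = 3 then 2 else 3,
    Fin.ofNat n (k + r))

/-- The abscissa of a column. -/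
noncomputable def columnX (k : ℕ) (d : ℕ → ℕ) (q : ℕ × ℕ) : ℝ :=
  if q.1 < k then
    if q.2 = 0 then q.1 + 1
    else if q.2 ≤ 2 * d q.1 then q.1 + 5 / 4 + (q.2 - 1) / (4 * (2 * d q.1 - 1))
    else q.1 + 7 / 4
  else if q.2 = 0 then k + 1 else if q.2 = 1 then k + 3 / 2 else if q.2 = 2 then k + 7 / 4
  else if q.2 = 3 then k + 2 else 0

/-- The abscissa of the start of the last edge of arc `j`. -/
noncomputable def edgeStart (k : ℕ) (j : Fin n) : ℝ := if (j : ℕ) < k then coord j + 3 / 4 else 0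

/-- The abscissa of the start of arc `j`. -/
noncomputable def arcStart (k : ℕ) (j : Fin n) : ℝ := if (j : ℕ) < k then coord j else k + 1

/-- The place on the last edge of arc `j` that has the abscissa `x`. -/
noncomputable def passParam (k : ℕ) (σ : Equiv.Perm (Fin n)) (j : Fin n) (x : ℝ) : ℝ :=
  (x - edgeStart k j) / (arcStart k (σ j) - edgeStart k j)

/-- The place of the string in position `r` on the edge `arcVertex k d ι σ q r`. -/
noncomputable def arcParam [NeZero n] (k : ℕ) (d ι : ℕ → ℕ) (σ : Equiv.Perm (Fin n)) (q : ℕ × ℕ)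
    (r : ℕ) : ℝ :=
  if q.1 < k then
    if r = q.2 / 2 - 1 then
      if 1 ≤ q.2 ∧ q.2 < 2 * d q.1 then ((q.2 : ℝ) - 1) / (2 * d q.1 - 1) else 0
    else passParam k σ (σ.symm (Fin.ofNat n (height ι q r))) (columnX k d q)
  else if q.2 = 2 then 1 / 2 else 0

lemma columnX_zero {i : ℕ} (hi : i ≤ k) : columnX k d (i, 0) = i + 1 := by
  rcases hi.lt_or_eq with hi | rfl <;> simp [columnX, *]

lemma columnX_mid {i o : ℕ} (hi : i < k) (h1 : 1 ≤ o) (h2 : o ≤ 2 * d i) :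
    columnX k d (i, o) = i + 5 / 4 + (o - 1) / (4 * (2 * d i - 1)) := by
  simp only [columnX]
  rw [if_pos hi, if_neg (by lia), if_pos h2]

lemma columnX_last {i : ℕ} (hi : i < k) : columnX k d (i, 2 * d i + 1) = i + 7 / 4 := by
  simp only [columnX]
  rw [if_pos hi, if_neg (by lia), if_neg (by lia)]

lemma two_mul_sub_one_pos {m : ℕ} (hm : 0 < m) : (0 : ℝ) < 2 * m - 1 := by
  have : (1 : ℝ) ≤ m := by exact_mod_cast hm
  linarith

lemma columnX_last_lt {i : ℕ} (hi : i < k) :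
    columnX k d (i, 2 * d i + 1) < columnX k d (i + 1, 0) := by
  rw [columnX_last hi, columnX_zero hi]; push_cast; linarith

variable (h : LorenzData n k p d ι σ)
include h

lemma columnX_bounds {i o : ℕ} (hi : i < k) (ho : o ≤ 2 * d i + 1) :
    (i : ℝ) + 1 ≤ columnX k d (i, o) ∧ columnX k d (i, o) ≤ i + 7 / 4 := by
  have hd := two_mul_sub_one_pos (h.d_pos i hi)
  rcases Nat.eq_zero_or_pos o with rfl | h1
  · rw [columnX_zero hi.le]; constructor <;> linarith
  rcases ho.lt_or_eq with h2 | rfl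
  · rw [columnX_mid hi h1 (by lia)]
    have h3 : (1 : ℝ) ≤ o := by exact_mod_cast h1
    have h4 : (o : ℝ) ≤ 2 * d i := by exact_mod_cast (by lia : o ≤ 2 * d i)
    have h5 : 0 ≤ ((o : ℝ) - 1) / (4 * (2 * d i - 1)) := div_nonneg (by linarith) (by linarith)
    have h6 : ((o : ℝ) - 1) / (4 * (2 * d i - 1)) ≤ 1 / 4 := by
      rw [div_le_iff₀ (by linarith)]; linarith
    constructor <;> linarith
  · rw [columnX_last hi]; constructor <;> linarith

lemma columnX_lt {i o : ℕ} (hi : i < k) (ho : o ≤ 2 * d i) :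
    columnX k d (i, o) < columnX k d (i, o + 1) := by
  have hdi := h.d_pos i hi
  have hd := two_mul_sub_one_pos hdi
  rcases Nat.eq_zero_or_pos o with rfl | h1
  · rw [columnX_zero hi.le, columnX_mid hi le_rfl (by lia)]
    simp; norm_num
  rw [columnX_mid hi h1 ho]
  rcases ho.lt_or_eq with h2 | rfl
  · rw [columnX_mid hi (by lia) (by lia)]
    gcongr
    linarith
  · rw [columnX_last hi]
    have : (((2 * d i : ℕ) : ℝ) - 1) / (4 * (2 * d i - 1)) = 1 / 4 := by
      push_cast; field_simp
    rw [this]; linarith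

lemma n_pos : 0 < n := by have := h.card; have := h.k_pos; lia

lemma d_mono {i j : ℕ} (hij : i ≤ j) (hj : j < k) : d i ≤ d j := by
  have h1 := h.d_pos i (by lia)
  have h2 := (h.ι_le_iff i (by lia) (d i - 1)).2 (by lia)
  have h3 := (h.ι_le_iff j hj (d i - 1)).1 (by lia)
  lia

/-- A string that passes arc `i` does so on the last edge of an arc that crosses the abscissae of
arc `i`. -/
lemma height_spec [NeZero n] {i o r : ℕ} (hi : i < k) (ho : o ≤ 2 * d i + 1) (hr : r < p)
    (hne : r ≠ o / 2 - 1) :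
    height ι (i, o) r < n ∧ i < height ι (i, o) r ∧
      ((σ.symm (Fin.ofNat n (height ι (i, o) r)) : ℕ) < i ∨
        k ≤ (σ.symm (Fin.ofNat n (height ι (i, o) r)) : ℕ)) := by
  have hcard := h.card
  have hdp := h.d_le i hi
  have hιr := h.ι_lt r hr
  have h1 : height ι (i, o) r < n := by
    simp only [height]; split_ifs <;> lia
  refine ⟨h1, by simp only [height]; split_ifs <;> lia, ?_⟩
  by_contra hj
  push Not at hj
  obtain ⟨hj1, hj2⟩ := hj
  have hup := h.σ_up _ hj2
  rw [Equiv.apply_symm_apply, Fin.val_ofNat, Nat.mod_eq_of_lt h1] at hup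
  generalize (σ.symm (Fin.ofNat n (height ι (i, o) r)) : ℕ) = j at hj1 hj2 hup
  have hmono := h.d_mono hj1 hj2
  have hιj := h.ι_le_iff j hj2 r
  simp only [height] at hup
  split_ifs at hup <;> lia

lemma pass_lt [NeZero n] {i o r : ℕ} (hi : i < k) (ho : o ≤ 2 * d i + 1) (hr : r < p)
    (hne : r ≠ o / 2 - 1) {j : Fin n} (hj : j = σ.symm (Fin.ofNat n (height ι (i, o) r))) :
    edgeStart k j < columnX k d (i, o) ∧ columnX k d (i, o) < arcStart k (σ j) := by
  obtain ⟨h1, h2, h3⟩ := h.height_spec hi ho hr hne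
  have hσ : (σ j : ℕ) = height ι (i, o) r := by
    rw [hj, Equiv.apply_symm_apply, Fin.val_ofNat, Nat.mod_eq_of_lt h1]
  rw [← hj] at h3
  rw [← hσ] at h2
  obtain ⟨b1, b2⟩ := h.columnX_bounds hi ho
  have hi0 : (0 : ℝ) ≤ i := Nat.cast_nonneg i
  constructor
  · unfold edgeStart
    split_ifs with h4
    · have : ((j : ℕ) : ℝ) + 1 ≤ i := by exact_mod_cast (by lia : (j : ℕ) + 1 ≤ i)
      unfold coord; linarith
    · linarith
  · unfold arcStart
    split_ifs with h4
    · have : (i : ℝ) + 1 ≤ (σ j : ℕ) := by exact_mod_cast h2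
      unfold coord; linarith
    · have : (i : ℝ) + 1 ≤ k := by exact_mod_cast hi
      linarith

/-- A passing string moves along the last edge of its arc. -/
lemma pass_step [NeZero n] {i o r i' o' r' : ℕ} (hi : i < k) (ho : o ≤ 2 * d i + 1) (hr : r < p)
    (hne : r ≠ o / 2 - 1) (hi' : i' < k) (hne' : r' ≠ o' / 2 - 1)
    (hx : columnX k d (i, o) < columnX k d (i', o'))
    (hh : height ι (i', o') r' = height ι (i, o) r) :
    arcVertex k d ι σ (i', o') r' = arcVertex k d ι σ (i, o) r ∧
      arcParam k d ι σ (i, o) r < arcParam k d ι σ (i', o') r' := by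
  constructor
  · simp only [arcVertex]
    rw [if_pos hi, if_neg hne, if_pos hi', if_neg hne', hh]
  · simp only [arcParam]
    rw [if_pos hi, if_neg hne, if_pos hi', if_neg hne', hh]
    obtain ⟨h1, h2⟩ := h.pass_lt hi ho hr hne rfl
    unfold passParam
    gcongr
    linarith

end LorenzData

namespace LorenzData

open ArcCurve

variable {n k p : ℕ} {d ι : ℕ → ℕ} {σ : Equiv.Perm (Fin n)}

/-! ### The way of the strings from column to column -/

/-- The vertex `u'` with parameter `a'` comes after `u` with parameter `a` in a subdivision of an
arc curve. -/
def IsStep (σ : Equiv.Perm (Fin n)) (u u' : Fin 4 × Fin n) (a a' : ℝ) : Prop :=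
  (u' = u ∧ a < a') ∨
    (u' = Equiv.prodShear (finRotate 4) (fun c => if c = 3 then σ else 1) u ∧ a' = 0)

lemma IsStep.of_succ {e e' : Fin 4} {j : Fin n} {a : ℝ} (he : e ≠ 3) (he' : e' = e + 1) :
    IsStep σ (e, j) (e', j) a 0 := by
  right
  subst he'
  simp [Equiv.prodShear, he]

lemma IsStep.of_three {j : Fin n} {a : ℝ} : IsStep σ (3, j) (0, σ j) a 0 := by
  right
  simp [Equiv.prodShear]

lemma ofNat_eq [NeZero n] {m : ℕ} {j : Fin n} (hm : (j : ℕ) = m) : Fin.ofNat n m = j := by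
  subst hm
  ext
  simp

/-- The steps along the arcs below the diagonal. -/
lemma isStep_back [NeZero n] {o : ℕ} (ho : o < 4) (r : Fin p) :
    IsStep σ (arcVertex k d ι σ (k, o) r) (arcVertex k d ι σ (k, o + 1) r)
      (arcParam k d ι σ (k, o) r) (arcParam k d ι σ (k, o + 1) r) := by
  simp only [arcVertex, arcParam, lt_irrefl, if_false]
  interval_cases o
  · simpa using IsStep.of_succ (by decide) (by decide)
  · left; norm_num
  · simpa using IsStep.of_succ (by decide) (by decide)
  · simpa using IsStep.of_succ (by decide) (by decide)

variable (h : LorenzData n k p d ι σ)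
include h

lemma blockPerm_val {i o : ℕ} (hi : i < k) (r : Fin p) :
    (blockPerm p k d (i, o) r : ℕ) =
      if o % 2 = 1 ∧ 3 ≤ o ∧ o < 2 * d i ∧ (r : ℕ) = o / 2 - 1 then (r : ℕ) + 1
      else if o % 2 = 1 ∧ 3 ≤ o ∧ o < 2 * d i ∧ (r : ℕ) = o / 2 then (r : ℕ) - 1
      else r := by
  have hdp := h.d_le i hi
  simp only [blockPerm, artinPerm]
  by_cases h1 : i < k ∧ o % 2 = 1 ∧ o / 2 < d i
  swap
  · rw [if_neg h1, if_neg (by lia), if_neg (by lia)]; rfl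
  rw [if_pos h1]
  by_cases h2 : 1 ≤ o / 2 ∧ o / 2 < p
  swap
  · rw [dif_neg h2, if_neg (by lia), if_neg (by lia)]; rfl
  rw [dif_pos h2, Equiv.swap_apply_def]
  simp only [Fin.ext_iff]
  split_ifs <;> lia

/-- The step from a column to the next one within a block. -/
lemma isStep_block [NeZero n] {i o : ℕ} (hi : i < k) (ho : o ≤ 2 * d i) (r : Fin p) :
    IsStep σ (arcVertex k d ι σ (i, o) r)
      (arcVertex k d ι σ (i, o + 1) (blockPerm p k d (i, o) r))
      (arcParam k d ι σ (i, o) r) (arcParam k d ι σ (i, o + 1) (blockPerm p k d (i, o) r)) := by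
  have hdi := h.d_pos i hi
  have hdp := h.d_le i hi
  have hr' := h.blockPerm_val (o := o) hi r
  have hlt := (blockPerm p k d (i, o) r).2
  generalize (blockPerm p k d (i, o) r : ℕ) = r' at hr' hlt ⊢
  by_cases hm : (r : ℕ) = o / 2 - 1
  · have hm' : r' = (o + 1) / 2 - 1 := by split_ifs at hr' <;> lia
    simp only [arcVertex, arcParam]
    rw [if_pos hi, if_pos hm, if_pos hi, if_pos hm', if_pos hi, if_pos hm, if_pos hi, if_pos hm']
    rcases Nat.eq_zero_or_pos o with rfl | h1
    · rw [if_pos rfl, if_neg (by lia), if_pos (by lia), if_neg (by lia), if_pos (by lia)]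
      simpa using IsStep.of_succ (by decide) (by decide)
    rcases ho.lt_or_eq with h2 | rfl
    · rw [if_neg (by lia), if_pos h2, if_pos (show 1 ≤ o ∧ o < 2 * d i from ⟨h1, h2⟩)]
      rcases (show o + 1 ≤ 2 * d i by lia).lt_or_eq with h3 | h3
      · rw [if_neg (by lia), if_pos h3, if_pos (by lia)]
        refine Or.inl ⟨rfl, ?_⟩
        have := two_mul_sub_one_pos hdi
        gcongr
        lia
      · rw [if_neg (by lia), if_neg (by lia), if_pos h3, if_neg (by lia)]
        exact IsStep.of_succ (by decide) (by decide)
    · rw [if_neg (by lia), if_neg (by lia), if_pos rfl, if_neg (by lia), if_neg (by lia),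
        if_neg (by lia), if_neg (by lia), if_neg (by lia)]
      exact IsStep.of_succ (by decide) (by decide)
  · refine Or.inl (h.pass_step hi (by lia) r.2 hm hi ?_ (h.columnX_lt hi ho) ?_)
    · split_ifs at hr' <;> lia
    · -- a string with which the moving one changes places lies over at most `i` arcs
      have hιr := h.ι_le_iff i hi r
      have hιr' := h.ι_le_iff i hi r'
      simp only [height]
      split_ifs at hr' <;> (subst hr'; split_ifs <;> lia)

/-- The step from the last column of a block to the next block. -/
lemma isStep_last [NeZero n] {i : ℕ} (hi : i < k) (r : Fin p) :
    IsStep σ (arcVertex k d ι σ (i, 2 * d i + 1) r) (arcVertex k d ι σ (i + 1, 0) r)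
      (arcParam k d ι σ (i, 2 * d i + 1) r) (arcParam k d ι σ (i + 1, 0) r) := by
  have hcard := h.card
  have hdi := h.d_pos i hi
  have hιr := h.ι_le_iff i hi r
  have hιk := h.ι_lt r r.2
  by_cases hm : (r : ℕ) = (2 * d i + 1) / 2 - 1
  · have hσ := h.σ_up ⟨i, by lia⟩ hi
    have hv : arcVertex k d ι σ (i, 2 * d i + 1) r = (3, ⟨i, by lia⟩) := by
      simp only [arcVertex]
      rw [if_pos hi, if_pos hm, if_neg (by lia), if_neg (by lia), if_neg (by lia),
        ofNat_eq (j := ⟨i, by lia⟩) rfl]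
    rw [hv]
    rcases (show i + 1 ≤ k from hi).lt_or_eq with h1 | h1
    · by_cases h0 : (r : ℕ) = 0
      · have hv' : arcVertex k d ι σ (i + 1, 0) r = (0, σ ⟨i, by lia⟩) := by
          simp only [arcVertex]
          rw [if_pos h1, if_pos h0, if_pos trivial, ofNat_eq]
          simp only at hσ; lia
        have ha' : arcParam k d ι σ (i + 1, 0) r = 0 := by
          simp only [arcParam]
          rw [if_pos h1, if_pos h0, if_neg (by lia)]
        rw [hv', ha']
        exact IsStep.of_three
      · left
        have hj : σ.symm (Fin.ofNat n (height ι (i + 1, 0) r)) = ⟨i, by lia⟩ := by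
          rw [ofNat_eq (j := σ ⟨i, by lia⟩), Equiv.symm_apply_apply]
          simp only [height] at hσ ⊢
          split_ifs <;> lia
        constructor
        · simp only [arcVertex]
          rw [if_pos h1, if_neg h0, hj]
        · have ha : arcParam k d ι σ (i, 2 * d i + 1) r = 0 := by
            simp only [arcParam]
            rw [if_pos hi, if_pos hm, if_neg (by lia)]
          have ha' : arcParam k d ι σ (i + 1, 0) r =
              passParam k σ ⟨i, by lia⟩ (columnX k d (i + 1, 0)) := by
            simp only [arcParam]
            rw [if_pos h1, if_neg h0, hj]
          obtain ⟨b1, b2⟩ := h.pass_lt h1 (by lia) r.2 h0 hj.symm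
          rw [ha, ha']
          exact div_pos (by linarith) (by linarith)
    · have hv' : arcVertex k d ι σ (i + 1, 0) r = (0, σ ⟨i, by lia⟩) := by
        simp only [arcVertex]
        rw [if_neg (by lia), if_pos trivial, ofNat_eq]
        simp only at hσ; lia
      have ha' : arcParam k d ι σ (i + 1, 0) r = 0 := by
        simp only [arcParam]
        rw [if_neg (by lia), if_neg (by lia)]
      rw [hv', ha']
      exact IsStep.of_three
  · have hspec := h.height_spec hi le_rfl r.2 hm
    have hout : height ι (i, 2 * d i + 1) r = if (r : ℕ) < d i then i + 1 + r else r + ι r := by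
      simp only [height]
      split_ifs <;> lia
    by_cases hstay : i + 1 < k ∧ (r : ℕ) ≠ 0
    · refine Or.inl (h.pass_step hi le_rfl r.2 hm hstay.1 hstay.2 (columnX_last_lt hi) ?_)
      rw [hout]
      simp only [height]
      split_ifs <;> lia
    · have hv : arcVertex k d ι σ (i, 2 * d i + 1) r =
          (3, σ.symm (Fin.ofNat n (height ι (i, 2 * d i + 1) r))) := by
        simp only [arcVertex]
        rw [if_pos hi, if_neg hm]
      have ha' : arcParam k d ι σ (i + 1, 0) r = 0 := by
        simp only [arcParam]
        split_ifs with h1 h2 h3 <;> first | rfl | lia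
      have hv' : arcVertex k d ι σ (i + 1, 0) r =
          (0, σ (σ.symm (Fin.ofNat n (height ι (i, 2 * d i + 1) r)))) := by
        have hr1 : (r : ℕ) < d i := by
          by_contra hge
          have := hιr.not.2 hge
          lia
        rw [Equiv.apply_symm_apply, hout, if_pos hr1]
        simp only [arcVertex]
        split_ifs with h1 h2
        · rw [show (r : ℕ) = 0 by lia, add_zero]
        · lia
        · rw [show k + (r : ℕ) = i + 1 + r by lia]
      rw [hv, hv', ha']
      exact IsStep.of_three

/-- The step from the left end of the back to the first column. -/
lemma isStep_front [NeZero n] (r : Fin p) :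
    IsStep σ (arcVertex k d ι σ (k, 4) r) (arcVertex k d ι σ (0, 0) r)
      (arcParam k d ι σ (k, 4) r) (arcParam k d ι σ (0, 0) r) := by
  have hcard := h.card
  have hk := h.k_pos
  have hd := h.d_pos 0 hk
  have hσ := h.σ_down ⟨k + r, by lia⟩ (by simp)
  simp only [Nat.add_sub_cancel_left] at hσ
  have hv : arcVertex k d ι σ (k, 4) r = (3, ⟨k + r, by lia⟩) := by
    simp only [arcVertex]
    rw [if_neg (by lia), if_neg (by lia), if_neg (by lia), if_neg (by lia),
      ofNat_eq (j := ⟨k + r, by lia⟩) rfl]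
  have ha : arcParam k d ι σ (k, 4) r = 0 := by simp [arcParam]
  rw [hv, ha]
  by_cases h0 : (r : ℕ) = 0
  · have hι : ι 0 = 0 := by have := (h.ι_le_iff 0 hk 0).2 hd; lia
    have hv' : arcVertex k d ι σ (0, 0) r = (0, σ ⟨k + r, by lia⟩) := by
      simp only [arcVertex]
      rw [if_pos hk, if_pos h0, if_pos trivial, ofNat_eq]
      rw [hσ, h0, hι]
    have ha' : arcParam k d ι σ (0, 0) r = 0 := by
      simp only [arcParam]
      rw [if_pos hk, if_pos h0, if_neg (by lia)]
    rw [hv', ha']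
    exact IsStep.of_three
  · left
    have hj : σ.symm (Fin.ofNat n (height ι (0, 0) r)) = ⟨k + r, by lia⟩ := by
      rw [ofNat_eq (j := σ ⟨k + r, by lia⟩), Equiv.symm_apply_apply]
      simp only [height] at hσ ⊢
      split_ifs <;> lia
    constructor
    · simp only [arcVertex]
      rw [if_pos hk, if_neg h0, hj]
    · have ha' : arcParam k d ι σ (0, 0) r =
          passParam k σ ⟨k + r, by lia⟩ (columnX k d (0, 0)) := by
        simp only [arcParam]
        rw [if_pos hk, if_neg h0, hj]
      obtain ⟨b1, b2⟩ := h.pass_lt hk (by lia) r.2 h0 hj.symm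
      rw [ha']
      exact div_pos (by linarith) (by linarith)

end LorenzData

namespace LorenzData

open ArcCurve

variable {n k p : ℕ} {d ι : ℕ → ℕ} {σ : Equiv.Perm (Fin n)}

/-! ### The points of the strings in the columns -/

/-- The point of the closed form in which the string in position `r` meets a column. -/
noncomputable def braidPoint [NeZero n] (k : ℕ) (d ι : ℕ → ℕ) (σ : Equiv.Perm (Fin n)) (q : ℕ × ℕ)
    (r : ℕ) : Space :=
  (arcCurve σ (closedPos k σ)).edge (arcVertex k d ι σ q r) (arcParam k d ι σ q r)

lemma edge_of_ne_three (P : Fin 4 → Fin n → Space) {e : Fin 4} (he : e ≠ 3) (j : Fin n) (a : ℝ) :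
    (arcCurve σ P).edge (e, j) a = (1 - a) • P e j + a • P (e + 1) j := by
  rw [PolygonalCurve.edge_eq]
  simp [Equiv.prodShear, he]

lemma edge_three (P : Fin 4 → Fin n → Space) (j : Fin n) (a : ℝ) :
    (arcCurve σ P).edge (3, j) a = (1 - a) • P 3 j + a • P 0 (σ j) := by
  rw [PolygonalCurve.edge_eq]
  simp [Equiv.prodShear]

lemma edge_three_closed (j : Fin n) (a : ℝ) :
    (arcCurve σ (closedPos k σ)).edge (3, j) a =
      ((1 - a) * edgeStart k j + a * arcStart k (σ j), coord (σ j),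
        if (j : ℕ) < k then 0 else a - 1) := by
  rw [edge_three, closedPos, closedPos]
  unfold edgeStart arcStart
  split_ifs <;>
    simp only [Matrix.cons_val, Prod.smul_mk, Prod.mk_add_mk, smul_eq_mul, Prod.mk.injEq] <;>
    refine ⟨trivial, ?_, ?_⟩ <;> ring

lemma braidPoint_back [NeZero n] {o r : ℕ} (hr : k + r < n) :
    braidPoint k d ι σ (k, o) r = (columnX k d (k, o),
      if o = 0 then (k : ℝ) + r + 1 else if o = 1 then (k : ℝ) + r + 1 / 2
      else if o = 2 then ((k : ℝ) + r + 1 / 2 + coord (σ ⟨k + r, hr⟩)) / 2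
      else coord (σ ⟨k + r, hr⟩),
      if o = 0 then 0 else if o = 1 then -1 / 2 else if o = 2 then -3 / 4 else -1) := by
  unfold braidPoint
  simp only [arcVertex, arcParam, columnX, lt_irrefl, if_false,
    ofNat_eq (j := (⟨k + r, hr⟩ : Fin n)) rfl]
  split_ifs <;> try lia
  all_goals
    first
    | rw [edge_three_closed]; simp [edgeStart, arcStart]
    | rw [edge_of_ne_three _ (by decide), closedPos, closedPos]
      simp [coord, Prod.ext_iff]
      try first | ring1 | (refine ⟨?_, ?_, ?_⟩ <;> ring1)

variable (h : LorenzData n k p d ι σ)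
include h

lemma coord_σ_up {i : ℕ} (hi : i < k) (hin : i < n) :
    coord (σ ⟨i, hin⟩) = (i : ℝ) + d i + 1 := by
  rw [coord, h.σ_up _ hi]; push_cast; ring

lemma braidPoint_pass [NeZero n] {i o r : ℕ} (hi : i < k) (ho : o ≤ 2 * d i + 1) (hr : r < p)
    (hne : r ≠ o / 2 - 1) :
    ∃ z, -1 < z ∧ z ≤ 0 ∧
      braidPoint k d ι σ (i, o) r = (columnX k d (i, o), (height ι (i, o) r : ℝ) + 1, z) := by
  have hspec := h.height_spec hi ho hr hne
  obtain ⟨j, hj⟩ : ∃ j, j = σ.symm (Fin.ofNat n (height ι (i, o) r)) := ⟨_, rfl⟩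
  obtain ⟨h1, h2⟩ := h.pass_lt hi ho hr hne hj
  have hv : arcVertex k d ι σ (i, o) r = (3, j) := by
    simp only [arcVertex]
    rw [if_pos hi, if_neg hne, hj]
  have ha : arcParam k d ι σ (i, o) r = passParam k σ j (columnX k d (i, o)) := by
    simp only [arcParam]
    rw [if_pos hi, if_neg hne, hj]
  have hσ : coord (σ j) = (height ι (i, o) r : ℝ) + 1 := by
    rw [hj, Equiv.apply_symm_apply, coord, Fin.val_ofNat, Nat.mod_eq_of_lt hspec.1]
  obtain ⟨a, hadef⟩ : ∃ a, a = passParam k σ j (columnX k d (i, o)) := ⟨_, rfl⟩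
  have hpos : 0 < arcStart k (σ j) - edgeStart k j := by linarith
  have ha0 : 0 < a := by rw [hadef]; exact div_pos (by linarith) hpos
  have ha1 : a < 1 := by rw [hadef]; exact (div_lt_one hpos).2 (by linarith)
  have hx : (1 - a) * edgeStart k j + a * arcStart k (σ j) = columnX k d (i, o) := by
    rw [hadef]; unfold passParam; field_simp; ring
  refine ⟨if (j : ℕ) < k then 0 else a - 1, ?_, ?_, ?_⟩
  · split_ifs <;> linarith
  · split_ifs <;> linarith
  · rw [braidPoint, hv, ha, ← hadef, edge_three_closed, hx, hσ]

lemma braidPoint_first [NeZero n] {i r : ℕ} (hi : i < k) (hr : r = 0) :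
    braidPoint k d ι σ (i, 0) r = (columnX k d (i, 0), (i : ℝ) + 1, 0) := by
  have hcard := h.card
  subst hr
  have hv : arcVertex k d ι σ (i, 0) 0 = (0, ⟨i, by lia⟩) := by
    simp only [arcVertex]
    rw [if_pos hi, if_pos trivial, if_pos trivial, ofNat_eq (j := (⟨i, by lia⟩ : Fin n)) rfl]
  have ha : arcParam k d ι σ (i, 0) 0 = 0 := by simp [arcParam, hi]
  rw [braidPoint, hv, ha, edge_of_ne_three _ (by decide), columnX_zero hi.le]
  simp [closedPos, hi, coord]

lemma braidPoint_last [NeZero n] {i r : ℕ} (hi : i < k) (hr : r = (2 * d i + 1) / 2 - 1) :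
    braidPoint k d ι σ (i, 2 * d i + 1) r =
      (columnX k d (i, 2 * d i + 1), (i : ℝ) + d i + 1, 0) := by
  have hcard := h.card
  have hv : arcVertex k d ι σ (i, 2 * d i + 1) r = (3, ⟨i, by lia⟩) := by
    simp only [arcVertex]
    rw [if_pos hi, if_pos hr, if_neg (by lia), if_neg (by lia), if_neg (by lia),
      ofNat_eq (j := (⟨i, by lia⟩ : Fin n)) rfl]
  have ha : arcParam k d ι σ (i, 2 * d i + 1) r = 0 := by
    simp only [arcParam]
    rw [if_pos hi, if_pos hr, if_neg (by lia)]
  rw [braidPoint, hv, ha, edge_three_closed, h.coord_σ_up hi, columnX_last hi]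
  simp [edgeStart, hi, coord]
  ring

/-- The string that moves along arc `i` is in front of the others. -/
lemma braidPoint_mid [NeZero n] {i o r : ℕ} (hi : i < k) (h1 : 1 ≤ o) (h2 : o ≤ 2 * d i)
    (hr : r = o / 2 - 1) :
    braidPoint k d ι σ (i, o) r =
      (columnX k d (i, o), (i : ℝ) + 1 + (o - 1) / (2 * d i - 1) * d i, 1) := by
  have hcard := h.card
  have hd := two_mul_sub_one_pos (h.d_pos i hi)
  have hin : i < n := by lia
  rcases h2.lt_or_eq with h2 | rfl
  · have hv : arcVertex k d ι σ (i, o) r = (1, ⟨i, hin⟩) := by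
      simp only [arcVertex]
      rw [if_pos hi, if_pos hr, if_neg (by lia), if_pos h2,
        ofNat_eq (j := (⟨i, hin⟩ : Fin n)) rfl]
    have ha : arcParam k d ι σ (i, o) r = ((o : ℝ) - 1) / (2 * d i - 1) := by
      simp only [arcParam]
      rw [if_pos hi, if_pos hr, if_pos ⟨h1, h2⟩]
    rw [braidPoint, hv, ha, edge_of_ne_three _ (by decide), columnX_mid hi h1 h2.le, closedPos,
      closedPos, if_pos hi, if_pos hi, h.coord_σ_up hi hin]
    simp only [Fin.reduceAdd, Matrix.cons_val, Prod.smul_mk, Prod.mk_add_mk, smul_eq_mul,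
      Prod.mk.injEq, coord]
    refine ⟨?_, ?_, ?_⟩ <;> field_simp <;> ring
  · have hv : arcVertex k d ι σ (i, 2 * d i) r = (2, ⟨i, hin⟩) := by
      simp only [arcVertex]
      rw [if_pos hi, if_pos hr, if_neg (by lia), if_neg (by lia), if_pos trivial,
        ofNat_eq (j := (⟨i, hin⟩ : Fin n)) rfl]
    have ha : arcParam k d ι σ (i, 2 * d i) r = 0 := by
      simp only [arcParam]
      rw [if_pos hi, if_pos hr, if_neg (by lia)]
    rw [braidPoint, hv, ha, edge_of_ne_three _ (by decide), columnX_mid hi h1 le_rfl, closedPos,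
      closedPos, if_pos hi, if_pos hi, h.coord_σ_up hi hin]
    simp only [Fin.reduceAdd, Matrix.cons_val, Prod.smul_mk, Prod.mk_add_mk, smul_eq_mul,
      Prod.mk.injEq, coord]
    push_cast
    refine ⟨?_, ?_, by ring⟩
    · field_simp; ring
    · rw [div_self hd.ne']; ring

lemma braidPoint_fst [NeZero n] {i o r : ℕ} (hi : i ≤ k) (ho : i < k → o ≤ 2 * d i + 1)
    (hr : r < p) : (braidPoint k d ι σ (i, o) r).1 = columnX k d (i, o) := by
  have hcard := h.card
  rcases hi.lt_or_eq with hi | rfl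
  · have ho := ho hi
    by_cases hne : r = o / 2 - 1
    · rcases Nat.eq_zero_or_pos o with rfl | h1
      · rw [h.braidPoint_first hi hne]
      rcases ho.lt_or_eq with h2 | rfl
      · rw [h.braidPoint_mid hi h1 (by lia) hne]
      · rw [h.braidPoint_last hi hne]
    · obtain ⟨z, -, -, e⟩ := h.braidPoint_pass hi ho hr hne
      rw [e]
  · rw [braidPoint_back (by lia)]

lemma arcParam_mem [NeZero n] {i o r : ℕ} (ho : i < k → o ≤ 2 * d i + 1)
    (hr : r < p) : arcParam k d ι σ (i, o) r ∈ Set.Ico (0 : ℝ) 1 := by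
  simp only [arcParam]
  split_ifs with h1 h2 h3 h4
  · have hd := two_mul_sub_one_pos (h.d_pos i h1)
    have h5 : (1 : ℝ) ≤ o := by exact_mod_cast h3.1
    have h6 : (o : ℝ) < 2 * d i := by exact_mod_cast h3.2
    exact ⟨div_nonneg (by linarith) hd.le, (div_lt_one hd).2 (by linarith)⟩
  · simp
  · obtain ⟨b1, b2⟩ := h.pass_lt h1 (ho h1) hr h2 rfl
    exact ⟨div_nonneg (by linarith) (by linarith), (div_lt_one (by linarith)).2 (by linarith)⟩
  · norm_num
  · norm_num

end LorenzData

namespace LorenzData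

open ArcCurve ColumnPos

/-! ### The closed form as a closed braid -/

variable {n k p : ℕ} {d ι : ℕ → ℕ} {σ : Equiv.Perm (Fin n)}

/-- The positions in the columns of the strings that make up the closed form. -/
noncomputable def braidPos [NeZero n] (p k : ℕ) (d ι : ℕ → ℕ) (σ : Equiv.Perm (Fin n)) :
    ColumnPos p where
  x c := columnX k d (cursor k d c)
  y c r := (braidPoint k d ι σ (cursor k d c) r).2.1
  z c r := (braidPoint k d ι σ (cursor k d c) r).2.2

/-- The number of the last column in front of the back of the closed braid. -/
lemma two_mul_length (hd : ∀ i < k, 0 < d i) :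
    2 * (paddedWord k d).length = 2 * blockStart d k + 2 := by
  rw [paddedWord_length hd]; lia

/-- The four kinds of edges in terms of blocks: within a block, from a block to the next one,
along the arcs below the diagonal, and from the left end of the back to the first column. -/
lemma column_cases (hd : ∀ i < k, 0 < d i) {m c : ℕ} (hm : m = 2 * (paddedWord k d).length)
    (hc : c ≤ m + 2) :
    (∃ i o, i < k ∧ o ≤ 2 * d i ∧ cursor k d c = (i, o) ∧
      cursor k d (nextColumn m c) = (i, o + 1) ∧ nextColumn m c = c + 1 ∧ c < m) ∨
    (∃ i, i < k ∧ cursor k d c = (i, 2 * d i + 1) ∧ cursor k d (nextColumn m c) = (i + 1, 0) ∧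
      nextColumn m c = c + 1 ∧ c ≤ m) ∨
    (∃ o < 4, cursor k d c = (k, o) ∧ cursor k d (nextColumn m c) = (k, o + 1) ∧
      nextColumn m c = c + 1 ∧ c + 2 = m + o) ∨
    (c = m + 2 ∧ cursor k d c = (k, 4) ∧ cursor k d (nextColumn m c) = (0, 0)) := by
  rw [two_mul_length hd] at hm
  rcases Nat.lt_or_ge c (2 * blockStart d k) with hlt | hge
  · have hn : nextColumn m c = c + 1 := if_neg (by lia)
    obtain ⟨h1, h2, h3⟩ := cursor_spec k d c
    obtain ⟨i, o, hio⟩ : ∃ i o, cursor k d c = (i, o) := ⟨_, _, rfl⟩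
    have hs : cursor k d (c + 1) = nextCursor k d (cursor k d c) := rfl
    rw [hn, hs, hio]
    simp only [hio] at h1 h2 h3
    have hi : i < k := by
      rcases h1.lt_or_eq with h1 | rfl <;> lia
    by_cases ho : o = 2 * d i + 1
    · exact Or.inr (Or.inl ⟨i, hi, by rw [ho], if_pos ⟨hi, ho⟩, rfl, by lia⟩)
    · refine Or.inl ⟨i, o, hi, by have := h3 hi; lia, rfl, ?_, rfl, by lia⟩
      exact if_neg fun h4 => ho h4.2
  · have hcur : ∀ o, cursor k d (2 * blockStart d k + o) = (k, o) := fun o =>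
      cursor_eq le_rfl fun h => (lt_irrefl k h).elim
    obtain ⟨o, rfl⟩ := Nat.exists_eq_add_of_le hge
    right; right
    rcases (show o ≤ 4 by lia).lt_or_eq with ho | rfl
    · have hn : nextColumn m (2 * blockStart d k + o) = 2 * blockStart d k + o + 1 :=
        if_neg (by lia)
      exact Or.inl ⟨o, ho, hcur o, by rw [hn]; exact hcur (o + 1), hn, by lia⟩
    · have hn : nextColumn m (2 * blockStart d k + 4) = 0 := if_pos (by lia)
      exact Or.inr ⟨by lia, hcur 4, by rw [hn]; rfl⟩

lemma blockPerm_eq_one {i o : ℕ} (h : ¬ (i < k ∧ o % 2 = 1 ∧ 3 ≤ o ∧ o < 2 * d i)) :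
    blockPerm p k d (i, o) = 1 := by
  simp only [blockPerm, artinPerm]
  split_ifs <;> first | rfl | lia

variable (h : LorenzData n k p d ι σ)
include h

lemma framed_braidPos [NeZero n] {m : ℕ} (hm : m = 2 * (paddedWord k d).length) :
    (braidPos p k d ι σ).Framed m := by
  have hcard := h.card
  have hcases := fun c => column_cases (c := c) h.d_pos hm
  have hcur : ∀ o, cursor k d (m - 2 + o) = (k, o) := fun o => by
    rw [hm, two_mul_length h.d_pos, Nat.add_sub_cancel]
    exact cursor_eq le_rfl fun h => (lt_irrefl k h).elim
  have hm2 : 2 ≤ m := by rw [hm, two_mul_length h.d_pos]; lia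
  have hc3 : cursor k d (m + 1) = (k, 3) := by rw [← hcur 3]; congr 1; lia
  have hc4 : cursor k d (m + 2) = (k, 4) := by rw [← hcur 4]; congr 1; lia
  constructor
  · intro c hc
    rcases hcases c (by lia) with ⟨i, o, hi, ho, e1, e2, e3, -⟩ | ⟨i, hi, e1, e2, e3, -⟩ |
      ⟨o, ho, e1, e2, e3, e4⟩ | ⟨e, -⟩
    · rw [e3] at e2
      simp only [braidPos, e1, e2]
      exact h.columnX_lt hi ho
    · rw [e3] at e2
      simp only [braidPos, e1, e2]
      exact columnX_last_lt hi
    · rw [e3] at e2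
      simp only [braidPos, e1, e2, columnX, lt_irrefl, if_false]
      have : o ≤ 2 := by lia
      interval_cases o <;> norm_num
    · lia
  · simp only [braidPos, hc4]
    rw [show cursor k d 0 = (0, 0) from rfl, columnX_zero (Nat.zero_le k)]
    simp [columnX]
  · intro c hc r
    have hr : k + (r : ℕ) < n := by lia
    simp only [braidPos]
    rcases hcases c (by lia) with ⟨i, o, hi, ho, e1, e2, e3, -⟩ | ⟨i, hi, e1, e2, e3, -⟩ |
      ⟨o, ho, e1, e2, e3, e4⟩ | ⟨e, -⟩
    · rw [e1]
      by_cases hne : (r : ℕ) = o / 2 - 1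
      · rcases Nat.eq_zero_or_pos o with rfl | h1
        · rw [h.braidPoint_first hi hne]; norm_num
        · rw [h.braidPoint_mid hi h1 ho hne]; norm_num
      · obtain ⟨z, hz, -, e⟩ := h.braidPoint_pass hi (by lia) r.2 hne
        rwa [e]
    · rw [e1]
      by_cases hne : (r : ℕ) = (2 * d i + 1) / 2 - 1
      · rw [h.braidPoint_last hi hne]; norm_num
      · obtain ⟨z, hz, -, e⟩ := h.braidPoint_pass hi le_rfl r.2 hne
        rwa [e]
    · rw [e1, braidPoint_back hr]
      have : o ≤ 2 := by lia
      interval_cases o <;> norm_num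
    · lia
  · intro r
    simp only [braidPos, hc3]
    rw [braidPoint_back (by lia)]
    norm_num
  · intro r
    simp only [braidPos, hc4]
    rw [braidPoint_back (by lia)]
    norm_num

/-- Cut at its columns, the closed form is the closed braid with the word `paddedWord k d`. -/
lemma subdivides_braidPos [NeZero n] {m : ℕ} (hm : m = 2 * (paddedWord k d).length) :
    PolygonalCurve.Subdivides
      (columnCurve m (columnPerm p (paddedWord k d)) (braidPos p k d ι σ))
      (arcCurve σ (closedPos k σ))
      (fun v => arcVertex k d ι σ (cursor k d v.1) v.2)
      (fun v => arcParam k d ι σ (cursor k d v.1) v.2) := by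
  have hcard := h.card
  constructor
  · rintro ⟨c, r⟩
    obtain ⟨h1, -, h3⟩ := cursor_spec k d c
    exact h.arcParam_mem h3 r.2
  · rintro ⟨c, r⟩
    obtain ⟨h1, -, h3⟩ := cursor_spec k d c
    have := h.braidPoint_fst h1 h3 r.2
    exact Prod.ext this.symm rfl
  · rintro ⟨c, r⟩
    have hnext : (columnCurve m (columnPerm p (paddedWord k d)) (braidPos p k d ι σ)).next (c, r) =
      (finRotate (m + 3) c, columnPerm p (paddedWord k d) c r) := rfl
    rw [hnext]
    simp only [finRotate_val]
    suffices IsStep σ (arcVertex k d ι σ (cursor k d c) r)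
      (arcVertex k d ι σ (cursor k d (nextColumn m c)) (columnPerm p (paddedWord k d) c r))
      (arcParam k d ι σ (cursor k d c) r)
      (arcParam k d ι σ (cursor k d (nextColumn m c)) (columnPerm p (paddedWord k d) c r)) from this
    rw [columnPerm_paddedWord h.d_pos]
    rcases column_cases (c := c) h.d_pos hm (by lia) with ⟨i, o, hi, ho, e1, e2, -⟩ |
      ⟨i, hi, e1, e2, -⟩ | ⟨o, ho, e1, e2, -⟩ | ⟨-, e1, e2⟩
    · rw [e1, e2]
      exact h.isStep_block hi ho r
    · rw [e1, e2, blockPerm_eq_one (by lia)]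
      exact h.isStep_last hi r
    · rw [e1, e2, blockPerm_eq_one (by lia)]
      exact isStep_back ho r
    · rw [e1, e2, blockPerm_eq_one (by lia)]
      exact h.isStep_front r
  · -- every arc starts at a vertex of the braid
    have key : ∀ j : Fin n, ∃ v : Fin (m + 3) × Fin p,
        arcVertex k d ι σ (cursor k d v.1) v.2 = (0, j) := by
      intro j
      have hm' := two_mul_length h.d_pos
      by_cases hj : (j : ℕ) < k
      · have hp := (h.d_pos j hj).trans_le (h.d_le j hj)
        have hlt : 2 * blockStart d j < m := by
          by_contra hge
          have h1 := cursor_blockStart (d := d) hj.le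
          obtain ⟨o, ho⟩ := Nat.exists_eq_add_of_le
            (show 2 * blockStart d k ≤ 2 * blockStart d j by lia)
          rw [ho, cursor_eq le_rfl fun h => (lt_irrefl k h).elim] at h1
          have := congrArg Prod.fst h1
          simp only at this
          lia
        refine ⟨(⟨2 * blockStart d j, by lia⟩, ⟨0, hp⟩), ?_⟩
        simp only [cursor_blockStart hj.le, arcVertex]
        rw [if_pos hj, if_pos trivial, if_pos trivial, ofNat_eq rfl]
      · refine ⟨(⟨2 * blockStart d k, by lia⟩, ⟨j - k, by lia⟩), ?_⟩
        simp only [cursor_blockStart le_rfl, arcVertex]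
        rw [if_neg (lt_irrefl k), if_pos trivial, ofNat_eq]
        lia
    rintro ⟨e, j⟩
    obtain ⟨v, hv⟩ := key j
    refine ⟨v, (e : ℕ), ?_⟩
    simp only [hv, zpow_natCast]
    fin_cases e
    · rfl
    · simp [Equiv.prodShear]
    · simp [pow_succ, Equiv.prodShear]
    · simp [pow_succ, Equiv.prodShear]

end LorenzData

/-! ### Linear forms that separate the strings -/

namespace ColumnPos

variable {p m c : ℕ} {g : ℕ → Equiv.Perm (Fin p)} {D : ColumnPos p}

lemma SepAt.symm {a b : Fin p} {α β : ℝ} (h : D.SepAt m g c a b α β) :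
    D.SepAt m g c b a (-α) (-β) := by
  constructor
  · have := h.1; linarith
  · have := h.2; linarith

lemma sepAt_of_y_lt {a b : Fin p} (h1 : D.y c a < D.y c b)
    (h2 : D.y (nextColumn m c) (g c a) < D.y (nextColumn m c) (g c b)) :
    D.SepAt m g c a b 1 0 := by
  constructor <;> linarith

lemma ofWord_y_lt {w : List ℕ} {a b : Fin p}
    (h : (a : ℕ) + columnPerm p w c a < (b : ℕ) + columnPerm p w c b) :
    (ofWord p w).y c a < (ofWord p w).y c b := by
  have h' : (((a : ℕ) : ℝ) + (columnPerm p w c a : ℕ)) <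
      ((b : ℕ) : ℝ) + (columnPerm p w c b : ℕ) := by
    exact_mod_cast h
  simp only [ofWord]
  linarith

/-- In a column of the closed braid, the string in position `a` is separated from the string in
position `b` if it lies in front of it or if it lies on the side of it given by the sign `s`. -/
lemma ofWord_sep {w : List ℕ} {a b : Fin p} {s ν : ℝ} (hν : 0 < ν) (hc : c ≤ 2 * w.length)
    (hb : ¬ b < columnPerm p w c b)
    (hs : (s = 1 ∧ (a : ℕ) + columnPerm p w c a ≤ (b : ℕ) + columnPerm p w c b) ∨
      (s = -1 ∧ (b : ℕ) + columnPerm p w c b ≤ (a : ℕ) + columnPerm p w c a))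
    (hab : (a : ℕ) + columnPerm p w c a ≠ (b : ℕ) + columnPerm p w c b ∨
      a < columnPerm p w c a) :
    0 < s / ν * ((ofWord p w).y c b - (ofWord p w).y c a) +
      -1 * ((ofWord p w).z c b - (ofWord p w).z c a) := by
  simp only [ofWord]
  rw [if_neg (by lia), if_neg hb, if_neg (by lia)]
  obtain ⟨u, hu⟩ : ∃ u, u = (a : ℕ) + columnPerm p w c a := ⟨_, rfl⟩
  obtain ⟨v, hv⟩ : ∃ v, v = (b : ℕ) + columnPerm p w c b := ⟨_, rfl⟩
  have hu' : (u : ℝ) = ((a : ℕ) : ℝ) + (columnPerm p w c a : ℕ) := by rw [hu]; push_cast; ring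
  have hv' : (v : ℝ) = ((b : ℕ) : ℝ) + (columnPerm p w c b : ℕ) := by rw [hv]; push_cast; ring
  rw [← hu, ← hv] at hs hab
  have hyy : s / ν * ((((b : ℕ) : ℝ) + 1 + ((columnPerm p w c b : ℕ) + 1)) / 2 -
      (((a : ℕ) : ℝ) + 1 + ((columnPerm p w c a : ℕ) + 1)) / 2) = s * (v - u) / (2 * ν) := by
    rw [hu', hv']; field_simp; ring
  rw [hyy]
  have h0 : 0 ≤ s * (v - u) := by
    rcases hs with ⟨rfl, h⟩ | ⟨rfl, h⟩
    · have : (u : ℝ) ≤ v := by exact_mod_cast h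
      linarith
    · have : (v : ℝ) ≤ u := by exact_mod_cast h
      linarith
  have h0' : 0 ≤ s * (v - u) / (2 * ν) := by positivity
  by_cases hz : a < columnPerm p w c a
  · rw [if_pos hz]; linarith
  · rw [if_neg hz]
    have hne : (v : ℝ) - u ≠ 0 := by
      rw [sub_ne_zero]
      have := hab.resolve_right hz
      exact_mod_cast this.symm
    have hs0 : s ≠ 0 := by
      rcases hs with ⟨rfl, -⟩ | ⟨rfl, -⟩ <;> norm_num
    have : 0 < s * (v - u) := h0.lt_of_ne (mul_ne_zero hs0 hne).symm
    have : 0 < s * (v - u) / (2 * ν) := by positivity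
    linarith

end ColumnPos

namespace LorenzData

open ArcCurve ColumnPos

variable {n k p : ℕ} {d ι : ℕ → ℕ} {σ : Equiv.Perm (Fin n)}

lemma ofWord_y_lt_of_trivial {c : ℕ} {a b : Fin p} (hd : ∀ i < k, 0 < d i)
    (h1 : blockPerm p k d (cursor k d c) = 1) (hab : a < b) :
    (ofWord p (paddedWord k d)).y c a < (ofWord p (paddedWord k d)).y c b := by
  apply ofWord_y_lt
  rw [columnPerm_paddedWord hd, h1]
  simp only [Equiv.Perm.coe_one, id_eq]
  lia

variable (h : LorenzData n k p d ι σ)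
include h

lemma ι_zero : ι 0 = 0 := by
  have := (h.ι_le_iff 0 h.k_pos 0).2 (h.d_pos 0 h.k_pos)
  lia

lemma braidPoint_y_first [NeZero n] {i o r : ℕ} (hi : i < k) (ho : o ≤ 1) (hr : r < p) :
    (braidPoint k d ι σ (i, o) r).2.1 = ((r + max i (ι r) : ℕ) : ℝ) + 1 := by
  have hd := h.d_pos i hi
  by_cases hne : r = o / 2 - 1
  · have h0 : r = 0 := by lia
    rw [h0, h.ι_zero]
    rcases Nat.le_one_iff_eq_zero_or_eq_one.1 ho with rfl | rfl
    · rw [h.braidPoint_first hi rfl]; simp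
    · rw [h.braidPoint_mid hi le_rfl (by lia) rfl]; simp
  · obtain ⟨z, -, -, e⟩ := h.braidPoint_pass hi (by lia) hr hne
    rw [e]
    simp only [height]
    rw [if_neg (by lia)]

lemma braidPoint_y_last [NeZero n] {i o r : ℕ} (hi : i < k) (ho : o = 2 * d i ∨ o = 2 * d i + 1)
    (hr : r < p) :
    (braidPoint k d ι σ (i, o) r).2.1 = ((r + max (i + 1) (ι r) : ℕ) : ℝ) + 1 := by
  have hd := h.d_pos i hi
  have hd' := two_mul_sub_one_pos hd
  have hι := h.ι_le_iff i hi r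
  by_cases hne : r = o / 2 - 1
  · have h0 : r + max (i + 1) (ι r) = i + d i := by lia
    rw [h0]
    rcases ho with rfl | rfl
    · rw [h.braidPoint_mid hi (by lia) le_rfl hne]
      push_cast
      rw [div_self hd'.ne']; ring
    · rw [h.braidPoint_last hi hne]; push_cast; ring
  · obtain ⟨z, -, -, e⟩ := h.braidPoint_pass hi (by lia) hr hne
    rw [e]
    simp only [height]
    congr 2
    split_ifs <;> lia

lemma braidPoint_y_back [NeZero n] {o r s : ℕ} (hrs : r < s) (hs : s < p) :
    (braidPoint k d ι σ (k, o) r).2.1 < (braidPoint k d ι σ (k, o) s).2.1 := by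
  have hcard := h.card
  rw [braidPoint_back (by lia), braidPoint_back (by lia)]
  have h1 := h.σ_down ⟨k + r, by lia⟩ (by simp)
  have h2 := h.σ_down ⟨k + s, by lia⟩ (by simp)
  simp only [Nat.add_sub_cancel_left] at h1 h2
  have h3 := h.ι_mono hrs.le
  have h4 : ((r + ι r : ℕ) : ℝ) < (s + ι s : ℕ) := by exact_mod_cast (by lia)
  have h5 : (r : ℝ) < s := by exact_mod_cast hrs
  simp only [coord, h1, h2]
  split_ifs <;> linarith

lemma braidPoint_y_lt [NeZero n] {i o r s : ℕ} (hi : i < k)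
    (ho : o ≤ 1 ∨ o = 2 * d i ∨ o = 2 * d i + 1) (hrs : r < s) (hs : s < p) :
    (braidPoint k d ι σ (i, o) r).2.1 < (braidPoint k d ι σ (i, o) s).2.1 := by
  have hι := h.ι_mono hrs.le
  rcases ho with ho | ho
  · rw [h.braidPoint_y_first hi ho (hrs.trans hs), h.braidPoint_y_first hi ho hs]
    exact add_lt_add_of_lt_of_le (Nat.cast_lt.2 (by lia)) le_rfl
  · rw [h.braidPoint_y_last hi ho (hrs.trans hs), h.braidPoint_y_last hi ho hs]
    exact add_lt_add_of_lt_of_le (Nat.cast_lt.2 (by lia)) le_rfl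

lemma braidPoint_y_pass_lt [NeZero n] {i o r s : ℕ} (hi : i < k) (ho : o ≤ 2 * d i + 1)
    (hrs : r < s) (hs : s < p) (hr' : r ≠ o / 2 - 1) (hs' : s ≠ o / 2 - 1) :
    (braidPoint k d ι σ (i, o) r).2.1 < (braidPoint k d ι σ (i, o) s).2.1 := by
  have hι := h.ι_mono hrs.le
  obtain ⟨z, -, -, e⟩ := h.braidPoint_pass hi ho (hrs.trans hs) hr'
  obtain ⟨z', -, -, e'⟩ := h.braidPoint_pass hi ho hs hs'
  rw [e, e']
  simp only [height]
  refine add_lt_add_of_lt_of_le (Nat.cast_lt.2 ?_) le_rfl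
  split_ifs <;> lia

/-- The string that moves along arc `i` is so far in front that it is separated from the others. -/
lemma braidPoint_sep [NeZero n] {i o r μ : ℕ} {s : ℝ} (hi : i < k) (h1 : 1 ≤ o) (h2 : o ≤ 2 * d i)
    (hr : r < p) (hμ : μ = o / 2 - 1) (hne : r ≠ μ) (hs : s = 1 ∨ s = -1) :
    0 < s / n * ((braidPoint k d ι σ (i, o) r).2.1 - (braidPoint k d ι σ (i, o) μ).2.1) +
      -1 * ((braidPoint k d ι σ (i, o) r).2.2 - (braidPoint k d ι σ (i, o) μ).2.2) := by
  have hspec := h.height_spec hi (by lia) hr (hμ ▸ hne)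
  obtain ⟨z, -, hz, e⟩ := h.braidPoint_pass hi (by lia) hr (hμ ▸ hne)
  rw [e, h.braidPoint_mid hi h1 h2 hμ]
  simp only
  have hn : (0 : ℝ) < n := by exact_mod_cast h.n_pos
  have hd := two_mul_sub_one_pos (h.d_pos i hi)
  have hcard := h.card
  have hup := h.σ_up ⟨i, by lia⟩ hi
  have hlt := (σ ⟨i, by lia⟩).2
  have hy1 : (height ι (i, o) r : ℝ) + 1 ≤ n := by exact_mod_cast hspec.1
  have hy2 : (i : ℝ) + 1 + d i ≤ n := by
    exact_mod_cast (by simp only at hup; lia : i + 1 + d i ≤ n)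
  have hy3 : (0 : ℝ) ≤ height ι (i, o) r := Nat.cast_nonneg _
  have ho1 : (1 : ℝ) ≤ o := by exact_mod_cast h1
  have ho2 : (o : ℝ) ≤ 2 * d i := by exact_mod_cast h2
  have ht0 : 0 ≤ ((o : ℝ) - 1) / (2 * d i - 1) := div_nonneg (by linarith) hd.le
  have ht1 : ((o : ℝ) - 1) / (2 * d i - 1) ≤ 1 := (div_le_one hd).2 (by linarith)
  generalize ((o : ℝ) - 1) / (2 * d i - 1) = t at ht0 ht1
  have hd0 : (0 : ℝ) ≤ d i := Nat.cast_nonneg _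
  have hi0 : (0 : ℝ) ≤ i := Nat.cast_nonneg _
  have htd : t * d i ≤ d i := mul_le_of_le_one_left hd0 ht1
  have htd0 : 0 ≤ t * d i := mul_nonneg ht0 hd0
  generalize hΔ : (height ι (i, o) r : ℝ) + 1 - ((i : ℝ) + 1 + t * d i) = Δ
  have hΔn : |Δ| < n := by
    rw [abs_lt]; constructor <;> linarith
  have hq : |s / n * Δ| < 1 := by
    rw [abs_mul, abs_div, abs_of_pos hn]
    have : |s| = 1 := by rcases hs with rfl | rfl <;> simp
    rw [this, one_div, inv_mul_lt_iff₀ hn]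
    linarith
  have := (abs_lt.1 hq).1
  linarith

/-- How the positions of the moving string `a` and of another string `b` change on the two steps
from a column on arc `i`. -/
lemma mover_cases {i o : ℕ} (hi : i < k) (h1 : 1 ≤ o) (h2 : o < 2 * d i) {a b : Fin p}
    (ha : (a : ℕ) = o / 2 - 1) (hb : (b : ℕ) ≠ o / 2 - 1) {a' b' a'' b'' : Fin p}
    (ha' : a' = blockPerm p k d (i, o) a) (hb' : b' = blockPerm p k d (i, o) b)
    (ha'' : a'' = blockPerm p k d (i, o + 1) a') (hb'' : b'' = blockPerm p k d (i, o + 1) b') :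
    (a' : ℕ) = (o + 1) / 2 - 1 ∧ (b' : ℕ) ≠ (o + 1) / 2 - 1 ∧
    ((o % 2 = 1 ∧ 3 ≤ o ∧ (a' : ℕ) = a + 1 ∧ (a'' : ℕ) = a + 1 ∧
        (((b : ℕ) = a + 1 ∧ (b' : ℕ) = a ∧ (b'' : ℕ) = a) ∨
          ((b : ℕ) ≠ a + 1 ∧ (b' : ℕ) = b ∧ (b'' : ℕ) = b))) ∨
      (o = 1 ∧ (a : ℕ) = 0 ∧ a' = a ∧ a'' = a ∧ b' = b ∧ b'' = b) ∨
      (o % 2 = 0 ∧ a' = a ∧ (a'' : ℕ) = a + 1 ∧ b' = b ∧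
        (((b : ℕ) = a + 1 ∧ (b'' : ℕ) = a) ∨ ((b : ℕ) ≠ a + 1 ∧ (b'' : ℕ) = b)))) := by
  have hv := fun o r => h.blockPerm_val (o := o) (i := i) hi r
  rcases Nat.mod_two_eq_zero_or_one o with ho | ho
  · rw [blockPerm_eq_one (by lia), Equiv.Perm.one_apply] at ha' hb'
    subst ha' hb'
    refine ⟨by lia, by lia, Or.inr (Or.inr ⟨ho, rfl, ?_, rfl, ?_⟩)⟩
    · rw [ha'', hv, if_pos (by lia)]
    · rw [hb'', hv, if_neg (by lia)]
      by_cases hba : (b' : ℕ) = a' + 1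
      · rw [if_pos (by lia)]; lia
      · rw [if_neg (by lia)]; exact Or.inr ⟨hba, rfl⟩
  · rw [blockPerm_eq_one (i := i) (o := o + 1) (by lia), Equiv.Perm.one_apply] at ha'' hb''
    subst ha'' hb''
    rcases (show o = 1 ∨ 3 ≤ o by lia) with rfl | ho3
    · rw [blockPerm_eq_one (by lia), Equiv.Perm.one_apply] at ha' hb'
      subst ha' hb'
      exact ⟨ha, hb, Or.inr (Or.inl ⟨rfl, ha, rfl, rfl, rfl, rfl⟩)⟩
    · have e1 : (a'' : ℕ) = a + 1 := by rw [ha', hv, if_pos (by lia)]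
      have e2 : ((b : ℕ) = a + 1 ∧ (b'' : ℕ) = a) ∨ ((b : ℕ) ≠ a + 1 ∧ (b'' : ℕ) = b) := by
        rw [hb', hv, if_neg (by lia)]
        by_cases hba : (b : ℕ) = a + 1
        · rw [if_pos (by lia)]; lia
        · rw [if_neg (by lia)]; exact Or.inr ⟨hba, rfl⟩
      refine ⟨by lia, by lia, Or.inl ⟨ho, ho3, e1, e1, ?_⟩⟩
      rcases e2 with ⟨h3, h4⟩ | ⟨h3, h4⟩
      · exact Or.inl ⟨h3, h4, h4⟩
      · exact Or.inr ⟨h3, h4, h4⟩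

/-- While a string moves along arc `i`, it is separated from the others: by its being in front of
them in the closed form, and in the closed braid of the word by that or by the order of the heights.
A string with which the moving one changes places counts as lying below it. -/
lemma exists_sepAt_mover [NeZero n] {m c i o : ℕ} (hm : m = 2 * (paddedWord k d).length)
    (hi : i < k) (h1 : 1 ≤ o) (h2 : o < 2 * d i) (e1 : cursor k d c = (i, o))
    (e2 : cursor k d (nextColumn m c) = (i, o + 1)) (hn : nextColumn m c = c + 1) (hc : c < m)
    {a b : Fin p} (ha : (a : ℕ) = o / 2 - 1) (hb : (b : ℕ) ≠ o / 2 - 1) :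
    ∃ α β, (ofWord p (paddedWord k d)).SepAt m (columnPerm p (paddedWord k d)) c a b α β ∧
      (braidPos p k d ι σ).SepAt m (columnPerm p (paddedWord k d)) c a b α β := by
  have hn0 : (0 : ℝ) < n := by exact_mod_cast h.n_pos
  obtain ⟨s, hs⟩ : ∃ s : ℝ, (s = -1 ∧ ((b : ℕ) < a ∨ (o % 2 = 1 ∧ 3 ≤ o ∧ (b : ℕ) = a + 1))) ∨
      (s = 1 ∧ ¬ ((b : ℕ) < a ∨ (o % 2 = 1 ∧ 3 ≤ o ∧ (b : ℕ) = a + 1))) := by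
    by_cases hcase : (b : ℕ) < a ∨ (o % 2 = 1 ∧ 3 ≤ o ∧ (b : ℕ) = a + 1)
    · exact ⟨-1, Or.inl ⟨rfl, hcase⟩⟩
    · exact ⟨1, Or.inr ⟨rfl, hcase⟩⟩
  have hs1 : s = 1 ∨ s = -1 := by
    rcases hs with ⟨rfl, -⟩ | ⟨rfl, -⟩ <;> simp
  have hcp := columnPerm_paddedWord (p := p) h.d_pos c
  have hcp' := columnPerm_paddedWord (p := p) h.d_pos (c + 1)
  rw [hn] at e2
  rw [e1] at hcp
  rw [e2] at hcp'
  obtain ⟨hga, hgb, hv⟩ := h.mover_cases hi h1 h2 ha hb rfl rfl rfl rfl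
  refine ⟨s / n, -1, ⟨?_, ?_⟩, ⟨?_, ?_⟩⟩
  · apply ofWord_sep hn0 (by lia) <;> rw [hcp]
    all_goals clear hcp hcp' e1 e2; try rw [Fin.lt_def]
    all_goals generalize blockPerm p k d (i, o + 1) (blockPerm p k d (i, o) a) = a'' at *
    all_goals generalize blockPerm p k d (i, o + 1) (blockPerm p k d (i, o) b) = b'' at *
    all_goals generalize blockPerm p k d (i, o) a = a' at *
    all_goals generalize blockPerm p k d (i, o) b = b' at *
    · lia
    · rcases hs with ⟨rfl, hs⟩ | ⟨rfl, hs⟩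
      · exact Or.inr ⟨rfl, by lia⟩
      · exact Or.inl ⟨rfl, by lia⟩
    · lia
  · rw [hn]
    apply ofWord_sep hn0 (by lia) <;> rw [hcp', hcp]
    all_goals clear hcp hcp' e1 e2; try rw [Fin.lt_def]
    all_goals generalize blockPerm p k d (i, o + 1) (blockPerm p k d (i, o) a) = a'' at *
    all_goals generalize blockPerm p k d (i, o + 1) (blockPerm p k d (i, o) b) = b'' at *
    all_goals generalize blockPerm p k d (i, o) a = a' at *
    all_goals generalize blockPerm p k d (i, o) b = b' at *
    · lia
    · rcases hs with ⟨rfl, hs⟩ | ⟨rfl, hs⟩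
      · exact Or.inr ⟨rfl, by lia⟩
      · exact Or.inl ⟨rfl, by lia⟩
    · lia
  · simp only [braidPos, e1]
    exact h.braidPoint_sep hi h1 h2.le b.2 ha (by lia) hs1
  · simp only [braidPos, hn, e2, hcp]
    exact h.braidPoint_sep hi (by lia) h2 (Fin.is_lt _) hga (by lia) hs1

/-- The standard closed braid and the closed form, cut at its columns, are isotopic. A string
that moves along an arc above the diagonal is separated from the others by a linear form in which
its depth matters; any two other strings are separated by their heights. -/
theorem isotopic_ofWord_braidPos [NeZero n] {m : ℕ} (hm : m = 2 * (paddedWord k d).length) :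
    (columnCurve m (columnPerm p (paddedWord k d)) (ofWord p (paddedWord k d))).Isotopic
      (columnCurve m (columnPerm p (paddedWord k d)) (braidPos p k d ι σ)) := by
  refine isotopic_of_sepAt (hm ▸ framed_ofWord _) (h.framed_braidPos hm) fun c hc a b hab => ?_
  have hcp := columnPerm_paddedWord (p := p) h.d_pos c
  -- where no strings change places, the order of the heights is the same
  have key : ∀ q q' : ℕ × ℕ, cursor k d c = q → cursor k d (nextColumn m c) = q' →
      blockPerm p k d q = 1 → blockPerm p k d q' = 1 →
      (∀ r s, r < s → s < p →
        (braidPoint k d ι σ q r).2.1 < (braidPoint k d ι σ q s).2.1) →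
      (∀ r s, r < s → s < p →
        (braidPoint k d ι σ q' r).2.1 < (braidPoint k d ι σ q' s).2.1) →
      ∃ α β, (ofWord p (paddedWord k d)).SepAt m (columnPerm p (paddedWord k d)) c a b α β ∧
        (braidPos p k d ι σ).SepAt m (columnPerm p (paddedWord k d)) c a b α β := by
    intro q q' e1 e2 h1 h2 h3 h4
    rw [e1, h1] at hcp
    refine ⟨1, 0, sepAt_of_y_lt ?_ ?_, sepAt_of_y_lt ?_ ?_⟩
    · exact ofWord_y_lt_of_trivial h.d_pos (by rw [e1, h1]) hab
    · rw [hcp]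
      exact ofWord_y_lt_of_trivial h.d_pos (by rw [e2, h2]) hab
    · simp only [braidPos, e1]
      exact h3 _ _ hab b.2
    · rw [hcp]
      simp only [braidPos, e2]
      exact h4 _ _ hab b.2
  rcases column_cases (c := c) h.d_pos hm hc with ⟨i, o, hi, ho, e1, e2, hn, hcm⟩ |
    ⟨i, hi, e1, e2, -⟩ | ⟨o, ho, e1, e2, -⟩ | ⟨-, e1, e2⟩
  · by_cases hmid : 1 ≤ o ∧ o < 2 * d i
    · by_cases ha : (a : ℕ) = o / 2 - 1
      · exact h.exists_sepAt_mover hm hi hmid.1 hmid.2 e1 e2 hn hcm ha (by lia)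
      by_cases hb : (b : ℕ) = o / 2 - 1
      · obtain ⟨α, β, s1, s2⟩ :=
          h.exists_sepAt_mover hm hi hmid.1 hmid.2 e1 e2 hn hcm hb ha
        exact ⟨-α, -β, s1.symm, s2.symm⟩
      rw [hn] at e2
      have hcp' := columnPerm_paddedWord (p := p) h.d_pos (c + 1)
      rw [e1] at hcp
      rw [e2] at hcp'
      -- the two strings keep their order, since neither is the moving one
      have hμ : o / 2 - 1 < p := by have := h.d_le i hi; lia
      obtain ⟨-, hga, hva⟩ := h.mover_cases (a := ⟨_, hμ⟩) hi hmid.1 hmid.2 rfl ha rfl rfl rfl rfl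
      obtain ⟨-, hgb, hvb⟩ := h.mover_cases (a := ⟨_, hμ⟩) hi hmid.1 hmid.2 rfl hb rfl rfl rfl rfl
      have hgab : (blockPerm p k d (i, o) a : ℕ) < blockPerm p k d (i, o) b := by
        clear key hcp hcp' e1 e2
        generalize blockPerm p k d (i, o) a = a' at *
        generalize blockPerm p k d (i, o) b = b' at *
        lia
      have hgab' : (blockPerm p k d (i, o + 1) (blockPerm p k d (i, o) a) : ℕ) <
          blockPerm p k d (i, o + 1) (blockPerm p k d (i, o) b) := by
        clear key hcp hcp' e1 e2
        generalize blockPerm p k d (i, o + 1) (blockPerm p k d (i, o) a) = a'' at *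
        generalize blockPerm p k d (i, o + 1) (blockPerm p k d (i, o) b) = b'' at *
        generalize blockPerm p k d (i, o) a = a' at *
        generalize blockPerm p k d (i, o) b = b' at *
        lia
      refine ⟨1, 0, sepAt_of_y_lt ?_ ?_, sepAt_of_y_lt ?_ ?_⟩
      · apply ofWord_y_lt
        rw [hcp]; lia
      · rw [hn]
        apply ofWord_y_lt
        rw [hcp', hcp]; lia
      · simp only [braidPos, e1]
        exact h.braidPoint_y_pass_lt hi (by lia) hab b.2 ha hb
      · simp only [braidPos, hn, e2, hcp]
        exact h.braidPoint_y_pass_lt hi (by lia) hgab (Fin.is_lt _) hga hgb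
    · refine key _ _ e1 e2 (blockPerm_eq_one (by lia)) (blockPerm_eq_one (by lia))
        (fun r s => h.braidPoint_y_lt hi (by lia)) fun r s => h.braidPoint_y_lt hi (by lia)
  · refine key _ _ e1 e2 (blockPerm_eq_one (by lia)) (blockPerm_eq_one (by lia))
      (fun r s => h.braidPoint_y_lt hi (by lia)) fun r s hrs hs => ?_
    rcases (show i + 1 ≤ k from hi).lt_or_eq with hi' | hi'
    · exact h.braidPoint_y_lt hi' (by lia) hrs hs
    · rw [hi']; exact h.braidPoint_y_back hrs hs
  · exact key _ _ e1 e2 (blockPerm_eq_one (by lia)) (blockPerm_eq_one (by lia))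
      (fun r s => h.braidPoint_y_back) fun r s => h.braidPoint_y_back
  · exact key _ _ e1 e2 (blockPerm_eq_one (by lia)) (blockPerm_eq_one (by lia))
      (fun r s => h.braidPoint_y_back) fun r s => h.braidPoint_y_lt h.k_pos (by lia)

/-- The diagonal link of a shuffle is the closure of the braid with one factor `σ₁ ⋯ σ_{d - 1}` for
each entry `d` of the Lorenz vector. -/
theorem isotopic_diagLink_closedBraid (hup : ∀ i : Fin n, (i : ℕ) < k → i < σ i)
    (hdown : ∀ i : Fin n, ¬ (i : ℕ) < k → σ i < i)
    (hmono : ∀ i j : Fin n, ¬ (i : ℕ) < k → i < j → σ i < σ j) :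
    (diagLink σ).Isotopic
      (closedBraid p ((List.range k).flatMap fun i => List.range' 1 (d i - 1))) := by
  have : NeZero n := ⟨h.n_pos.ne'⟩
  have h1 := isotopic_diagLink_closed hup hdown hmono
  have h2 := h.isotopic_ofWord_braidPos rfl
  have h3 := (h.subdivides_braidPos rfl).isotopic h2.2.1 h1.2.1
  have h4 := isotopic_filter_zero (p := p) (paddedWord k d)
  rw [filter_paddedWord, closedBraid_eq (paddedWord k d)] at h4
  exact h1.trans ((h4.trans (h2.trans h3)).symm)

end LorenzData

/-! ### Shuffles and their Lorenz vectors -/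

/-- The conjugate of the vector `⟨d 0, …, d (k - 1)⟩`: the number of entries that are at most
`r`. -/
def conjVector (k : ℕ) (d : ℕ → ℕ) (r : ℕ) : ℕ := ((Finset.range k).filter fun i => d i ≤ r).card

lemma conjVector_le_iff {k : ℕ} {d : ℕ → ℕ} (hmono : ∀ i j, i ≤ j → j < k → d i ≤ d j) {i : ℕ}
    (hi : i < k) (r : ℕ) : conjVector k d r ≤ i ↔ r < d i := by
  constructor
  · intro hle
    by_contra hge
    have hsub : Finset.range (i + 1) ⊆ (Finset.range k).filter fun i => d i ≤ r := by
      intro j hj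
      rw [Finset.mem_range] at hj
      have := hmono j i (by lia) hi
      rw [Finset.mem_filter, Finset.mem_range]
      lia
    have := Finset.card_le_card hsub
    rw [Finset.card_range] at this
    unfold conjVector at hle
    lia
  · intro hlt
    have hsub : ((Finset.range k).filter fun i => d i ≤ r) ⊆ Finset.range i := by
      intro j hj
      rw [Finset.mem_filter, Finset.mem_range] at hj
      rw [Finset.mem_range]
      by_contra hij
      have := hmono i j (by lia) hj.1
      lia
    exact (Finset.card_le_card hsub).trans (Finset.card_range i).le

lemma conjVector_mono (k : ℕ) (d : ℕ → ℕ) : Monotone (conjVector k d) := by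
  intro r s hrs
  refine Finset.card_le_card fun i hi => ?_
  rw [Finset.mem_filter] at hi ⊢
  exact ⟨hi.1, hi.2.trans hrs⟩

/-- Every vector of positive numbers in nondecreasing order comes from a shuffle without fixed
points. -/
lemma exists_lorenzData {k p : ℕ} {d : ℕ → ℕ} (hk : 0 < k) (hpos : ∀ i < k, 0 < d i)
    (hmono : ∀ i j, i ≤ j → j < k → d i ≤ d j) (hlast : d (k - 1) = p) :
    ∃ τ : Equiv.Perm (Fin (k + p)), LorenzData (k + p) k p d (conjVector k d) τ := by
  have hle : ∀ i < k, d i ≤ p := fun i hi => hlast ▸ hmono i (k - 1) (by lia) (by lia)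
  have hconj := fun i hi => conjVector_le_iff hmono (i := i) hi
  have hlt : ∀ r < p, conjVector k d r < k := fun r hr => by
    have := (hconj (k - 1) (by lia) r).2 (by lia)
    lia
  let f : Fin (k + p) → Fin (k + p) := fun i =>
    if h : (i : ℕ) < k then ⟨i + d i, by have := hle i h; lia⟩
    else ⟨(i - k) + conjVector k d (i - k), by have := hlt (i - k) (by lia); lia⟩
  have f_up : ∀ i : Fin (k + p), (i : ℕ) < k → (f i : ℕ) = i + d i := fun i hi => by
    simp only [f, dif_pos hi]
  have f_down : ∀ i : Fin (k + p), k ≤ (i : ℕ) →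
      (f i : ℕ) = (i - k) + conjVector k d (i - k) := fun i hi => by
    simp only [f, dif_neg (not_lt.2 hi)]
  have hne : ∀ i j : Fin (k + p), i < j → f i ≠ f j := by
    intro i j hij e
    have e := congrArg Fin.val e
    have hij : (i : ℕ) < j := hij
    rcases Nat.lt_or_ge j k with hj | hj
    · rw [f_up i (by lia), f_up j hj] at e
      have := hmono i j hij.le hj
      lia
    rw [f_down j hj] at e
    rcases Nat.lt_or_ge i k with hi | hi
    · rw [f_up i hi] at e
      have := hconj i hi (j - k)
      lia
    · rw [f_down i hi] at e
      have := conjVector_mono k d (show (i : ℕ) - k ≤ j - k by lia)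
      lia
  have hinj : Function.Injective f := fun i j e => by
    by_contra hij
    rcases lt_or_gt_of_ne hij with h | h
    · exact hne i j h e
    · exact hne j i h e.symm
  exact ⟨Equiv.ofBijective f (Finite.injective_iff_bijective.1 hinj),
    { card := rfl
      k_pos := hk
      d_pos := hpos
      d_le := hle
      ι_le_iff := hconj
      ι_lt := hlt
      ι_mono := conjVector_mono k d
      σ_up := f_up
      σ_down := f_down }⟩

namespace LorenzData

variable {n k p : ℕ} {d ι : ℕ → ℕ} {σ : Equiv.Perm (Fin n)}

lemma lt_apply (h : LorenzData n k p d ι σ) (i : Fin n) (hi : (i : ℕ) < k) : i < σ i := by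
  have h1 := h.σ_up i hi
  have h2 := h.d_pos i hi
  rw [Fin.lt_def]; lia

lemma apply_lt (h : LorenzData n k p d ι σ) (i : Fin n) (hi : ¬ (i : ℕ) < k) : σ i < i := by
  have h1 := h.σ_down i (not_lt.1 hi)
  have h2 := h.ι_lt (i - k) (by have := h.card; lia)
  rw [Fin.lt_def]; lia

lemma apply_lt_apply (h : LorenzData n k p d ι σ) (i j : Fin n) (hi : ¬ (i : ℕ) < k)
    (hij : i < j) : σ i < σ j := by
  have hij : (i : ℕ) < j := hij
  have h1 := h.σ_down i (not_lt.1 hi)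
  have h2 := h.σ_down j (by lia)
  have h3 := h.ι_mono (show (i : ℕ) - k ≤ j - k by lia)
  rw [Fin.lt_def]; lia

lemma isShuffle (h : LorenzData n k p d ι σ) : IsShuffle σ k := by
  refine ⟨by have := h.card; lia, fun i hi j hj hij => ?_, fun i hi j _ hij =>
    h.apply_lt_apply i j (not_lt.2 hi) hij⟩
  simp only [Set.mem_ofPred_eq] at hi hj
  have hij : (i : ℕ) < j := hij
  have h1 := h.σ_up i hi
  have h2 := h.σ_up j hj
  have h3 := h.d_mono hij.le hj
  rw [Fin.lt_def]; lia

lemma d_last (h : LorenzData n k p d ι σ) : d (k - 1) = p := by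
  have h1 := h.d_le (k - 1) (by have := h.k_pos; lia)
  have h2 := h.d_pos 0 h.k_pos
  have h3 := h.d_le 0 h.k_pos
  have h4 := h.ι_lt (p - 1) (by lia)
  have h5 := (h.ι_le_iff (k - 1) (by lia) (p - 1)).1 (by lia)
  lia

lemma apply_ne (h : LorenzData n k p d ι σ) (i : Fin n) : σ i ≠ i := by
  by_cases hi : (i : ℕ) < k
  · exact (h.lt_apply i hi).ne'
  · exact (h.apply_lt i hi).ne

end LorenzData

/-- A shuffle is determined by its values at `1, …, k`. -/
lemma IsShuffle.eq_of_forall_lt {n k : ℕ} {σ τ : Equiv.Perm (Fin n)} (hσ : IsShuffle σ k)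
    (hτ : IsShuffle τ k) (heq : ∀ i : Fin n, (i : ℕ) < k → σ i = τ i) : σ = τ := by
  -- a value of one shuffle that is skipped by the other one is never taken up
  have key : ∀ {σ τ : Equiv.Perm (Fin n)}, IsShuffle τ k → ∀ i : Fin n, k ≤ (i : ℕ) →
      (∀ j < i, σ j = τ j) → ¬ σ i < τ i := by
    intro σ τ hτ i hi ih hlt
    obtain ⟨x, hx⟩ := τ.surjective (σ i)
    rcases lt_trichotomy x i with h | rfl | h
    · rw [← ih x h] at hx
      exact h.ne (σ.injective hx)
    · exact hlt.ne hx.symm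
    · have := hτ.2.2 hi (show k ≤ (x : ℕ) from hi.trans (show (i : ℕ) < x from h).le) h
      rw [hx] at this
      exact lt_asymm this hlt
  ext1 i
  induction i using WellFoundedLT.induction with
  | ind i ih =>
    by_cases hi : (i : ℕ) < k
    · exact heq i hi
    · have h1 := key hτ i (not_lt.1 hi) ih
      have h2 := key hσ i (not_lt.1 hi) fun j hj => (ih j hj).symm
      exact le_antisymm (not_lt.1 h2) (not_lt.1 h1)

lemma lorenzVector_length {n k : ℕ} (σ : Equiv.Perm (Fin n)) (hk : k ≤ n) :
    (lorenzVector σ k).length = k := by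
  simp [lorenzVector, hk]

lemma lorenzVector_getD {n k : ℕ} (σ : Equiv.Perm (Fin n)) (i : Fin n) (hi : (i : ℕ) < k) :
    (lorenzVector σ k).getD i 0 = (σ i : ℕ) - i := by
  have hlt : (i : ℕ) < (lorenzVector σ k).length := by
    simp only [lorenzVector, List.length_map, List.length_take, List.length_finRange]
    lia
  rw [List.getD_eq_getElem _ _ hlt]
  simp [lorenzVector]

/-- The data of a shuffle without fixed points are given by its Lorenz vector. -/
lemma IsShuffle.exists_lorenzData {n k : ℕ} {σ : Equiv.Perm (Fin n)} (hs : IsShuffle σ k)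
    (hf : ∀ i, σ i ≠ i) (hn : 0 < n) :
    ∃ p ι, LorenzData n k p (fun i => (lorenzVector σ k).getD i 0) ι σ := by
  obtain ⟨p, rfl⟩ := Nat.exists_eq_add_of_le hs.1
  obtain ⟨hkn, hs1, hs2⟩ := id hs
  have hup : ∀ (m : ℕ) (i : Fin (k + p)), (i : ℕ) = m → (i : ℕ) < k → (i : ℕ) ≤ σ i := by
    intro m
    induction m with
    | zero => intro i hi _; lia
    | succ m ih =>
      intro i hi hik
      have h1 := ih ⟨m, by lia⟩ rfl (by simp only; lia)
      have h2 : σ ⟨m, by lia⟩ < σ i := hs1 (show m < k by lia) hik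
        (by rw [Fin.lt_def]; simp only; lia)
      rw [Fin.lt_def] at h2
      simp only at h1; lia
  have hup' : ∀ i : Fin (k + p), (i : ℕ) < k → (i : ℕ) < σ i := fun i hi =>
    (hup i i rfl hi).lt_of_ne fun e => hf i (Fin.ext e.symm)
  have hdown : ∀ (m : ℕ) (i : Fin (k + p)), (i : ℕ) + 1 + m = k + p → k ≤ (i : ℕ) →
      (σ i : ℕ) ≤ i := by
    intro m
    induction m with
    | zero => intro i hi _; have := (σ i).2; lia
    | succ m ih =>
      intro i hi hik
      have h1 := ih ⟨i + 1, by lia⟩ (by simp only; lia) (by simp only; lia)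
      have h2 : σ i < σ ⟨i + 1, by lia⟩ := hs2 hik (show k ≤ (i : ℕ) + 1 by lia)
        (by rw [Fin.lt_def]; simp only; lia)
      rw [Fin.lt_def] at h2
      simp only at h1; lia
  have hdown' : ∀ i : Fin (k + p), k ≤ (i : ℕ) → (σ i : ℕ) < i := fun i hi =>
    (hdown (k + p - 1 - i) i (by lia) hi).lt_of_ne fun e => hf i (Fin.ext e)
  have hk : 0 < k := by
    by_contra h0
    have := hdown' ⟨0, hn⟩ (by simp only; lia)
    simp only at this; lia
  obtain ⟨d, hd⟩ : ∃ d, d = fun i => (lorenzVector σ k).getD i 0 := ⟨_, rfl⟩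
  have hdσ : ∀ i : Fin (k + p), (i : ℕ) < k → (σ i : ℕ) = i + d i := fun i hi => by
    have := hup' i hi
    rw [hd]; simp only
    rw [lorenzVector_getD σ i hi]; lia
  have hpos : ∀ i < k, 0 < d i := fun i hi => by
    have h1 := hup' ⟨i, by lia⟩ hi
    have h2 := hdσ ⟨i, by lia⟩ hi
    simp only at h1 h2; lia
  have hmono : ∀ i j, i ≤ j → j < k → d i ≤ d j := by
    intro i j hij
    induction j, hij using Nat.le_induction with
    | base => intro; rfl
    | succ j hij ih =>
      intro hj
      refine (ih (by lia)).trans ?_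
      have h1 := hdσ ⟨j, by lia⟩ (by simp only; lia)
      have h2 := hdσ ⟨j + 1, by lia⟩ hj
      have h3 : σ ⟨j, by lia⟩ < σ ⟨j + 1, by lia⟩ := hs1 (show j < k by lia) hj
        (by rw [Fin.lt_def]; simp only; lia)
      rw [Fin.lt_def] at h3
      simp only at h1 h2; lia
  -- the largest value is taken at `k`
  have hlast : d (k - 1) = p := by
    obtain ⟨x, hx⟩ := σ.surjective ⟨k + p - 1, by lia⟩
    have hx' := congrArg Fin.val hx
    simp only at hx'
    have hxk : (x : ℕ) < k := by
      by_contra hge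
      have := hdown' x (not_lt.1 hge)
      lia
    have h1 := hdσ ⟨k - 1, by lia⟩ (by simp only; lia)
    have h2 := hdσ x hxk
    have h3 := hmono x (k - 1) (by lia) (by lia)
    have h4 := (σ ⟨k - 1, by lia⟩).2
    simp only at h1; lia
  obtain ⟨τ, hτ⟩ := _root_.exists_lorenzData hk hpos hmono hlast
  have hστ : σ = τ := hs.eq_of_forall_lt hτ.isShuffle fun i hi =>
    Fin.ext ((hdσ i hi).trans (hτ.σ_up i hi).symm)
  rw [← hστ] at hτ
  exact ⟨p, conjVector k d, hd ▸ hτ⟩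

/-! ### Vectors and twist data -/

lemma expandVector_ne_nil {L : List (ℕ × ℕ)} (hL : IsTwistData L) : expandVector L ≠ [] := by
  obtain ⟨h1, -, h3⟩ := hL
  obtain ⟨a, L, rfl⟩ := List.exists_cons_of_ne_nil h1
  have := (h3 a (by simp)).2
  simp [expandVector]
  lia

lemma mem_expandVector_pos {L : List (ℕ × ℕ)} (hL : IsTwistData L) {x : ℕ}
    (hx : x ∈ expandVector L) : 0 < x := by
  rw [expandVector, List.mem_flatMap] at hx
  obtain ⟨a, ha, hx⟩ := hx
  rw [List.eq_of_mem_replicate hx]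
  exact (hL.2.2 a ha).1

lemma pairwise_expandVector {L : List (ℕ × ℕ)} (hL : IsTwistData L) :
    (expandVector L).Pairwise (· ≤ ·) := by
  rw [expandVector, List.pairwise_flatMap]
  constructor
  · intro a _
    rw [List.pairwise_replicate]
    simp
  · have := hL.2.1
    rw [List.pairwise_map] at this
    refine this.imp fun {a b} hab x hx y hy => ?_
    rw [List.eq_of_mem_replicate hx, List.eq_of_mem_replicate hy]
    exact hab.le

lemma getLastD_expandVector {L : List (ℕ × ℕ)} (hL : IsTwistData L) :
    (expandVector L).getLastD 0 = (L.map Prod.fst).getLastD 0 := by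
  rcases List.eq_nil_or_concat L with rfl | ⟨L', a, rfl⟩
  · exact (hL.1 rfl).elim
  · obtain ⟨q, hq⟩ : ∃ q, a.2 = q + 1 := ⟨a.2 - 1, by have := (hL.2.2 a (by simp)).2; lia⟩
    simp [expandVector, hq, List.replicate_succ', ← List.append_assoc]

lemma twistWord_eq (L : List (ℕ × ℕ)) :
    twistWord L = (expandVector L).flatMap fun m => List.range' 1 (m - 1) := by
  rw [twistWord, expandVector, List.flatMap_assoc]
  congr 1
  funext a
  rw [List.flatMap_def, List.map_replicate]

/-- Every vector of positive numbers in nondecreasing order arises from twist data. -/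
lemma exists_expandVector_eq (v : List ℕ) (hv : v ≠ []) (hpos : ∀ x ∈ v, 0 < x)
    (hmono : v.Pairwise (· ≤ ·)) : ∃ L, IsTwistData L ∧ expandVector L = v := by
  induction v with
  | nil => exact (hv rfl).elim
  | cons a v ih =>
    have ha := hpos a (by simp)
    rcases eq_or_ne v [] with rfl | hv'
    · exact ⟨[(a, 1)], ⟨by simp, by simp, by simp; lia⟩, by simp [expandVector]⟩
    rw [List.pairwise_cons] at hmono
    obtain ⟨L, hL, rfl⟩ := ih hv' (fun x hx => hpos x (by simp [hx])) hmono.2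
    obtain ⟨⟨b, q⟩, L, rfl⟩ := List.exists_cons_of_ne_nil hL.1
    obtain ⟨-, h2, h3⟩ := hL
    have hq : 1 ≤ q := (h3 (b, q) (by simp)).2
    have hab : a ≤ b := hmono.1 b (by simp [expandVector]; lia)
    rw [List.map_cons, List.pairwise_cons] at h2
    rcases hab.eq_or_lt with rfl | hab
    · refine ⟨(a, q + 1) :: L, ⟨by simp, ?_, ?_⟩, ?_⟩
      · rw [List.map_cons, List.pairwise_cons]; exact h2
      · intro c hc
        rcases List.mem_cons.1 hc with rfl | hc
        · exact ⟨ha, by simp⟩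
        · exact h3 c (by simp [hc])
      · simp [expandVector, List.replicate_succ]
    · refine ⟨(a, 1) :: (b, q) :: L, ⟨by simp, ?_, ?_⟩, ?_⟩
      · rw [List.map_cons, List.map_cons, List.pairwise_cons, List.pairwise_cons]
        refine ⟨fun x hx => ?_, h2⟩
        rcases List.mem_cons.1 hx with rfl | hx
        · exact hab
        · exact hab.trans (h2.1 x hx)
      · intro c hc
        rcases List.mem_cons.1 hc with rfl | hc
        · exact ⟨ha, by simp⟩
        · exact h3 c hc
      · simp [expandVector]

/-! ### Diagonal links and T-links -/

lemma range_map_getD (v : List ℕ) : (List.range v.length).map (fun i => v.getD i 0) = v := by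
  apply List.ext_getElem
  · simp
  · intro i h1 h2
    simp [h2]

/-- The diagonal link of a shuffle with the vector `⟨p₁^{q₁}, …, p_s^{q_s}⟩` is the T-link. -/
theorem isotopic_diagLink_tLink {n k : ℕ} {σ : Equiv.Perm (Fin n)} (hs : IsShuffle σ k)
    (hf : ∀ i, σ i ≠ i) {L : List (ℕ × ℕ)} (hL : IsTwistData L)
    (hv : lorenzVector σ k = expandVector L) : (diagLink σ).Isotopic (tLink L) := by
  have hne := expandVector_ne_nil hL
  have hn : 0 < n := by
    rcases Nat.eq_zero_or_pos n with rfl | hn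
    · simp [← hv, lorenzVector] at hne
    · exact hn
  obtain ⟨p, ι, h⟩ := hs.exists_lorenzData hf hn
  have hlen := lorenzVector_length σ hs.1
  have hiso := h.isotopic_diagLink_closedBraid h.lt_apply h.apply_lt h.apply_lt_apply
  have hword : ((List.range k).flatMap fun i =>
      List.range' 1 ((lorenzVector σ k).getD i 0 - 1)) = twistWord L := by
    rw [twistWord_eq, ← hv]
    conv_rhs => rw [← range_map_getD (lorenzVector σ k)]
    rw [List.flatMap_map, hlen]
  have hp : p = (L.map Prod.fst).getLastD 0 := by
    rw [← getLastD_expandVector hL, ← hv, ← h.d_last, List.getLastD_eq_getLast?,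
      List.getLast?_eq_getElem?, hlen, List.getD_eq_getElem?_getD]
  rw [hword, hp] at hiso
  exact hiso

lemma exists_shuffle {L : List (ℕ × ℕ)} (hL : IsTwistData L) :
    ∃ (n : ℕ) (σ : Equiv.Perm (Fin n)) (k : ℕ), 0 < n ∧
      IsShuffle σ k ∧ (∀ i, σ i ≠ i) ∧ lorenzVector σ k = expandVector L := by
  obtain ⟨v, hv⟩ : ∃ v, v = expandVector L := ⟨_, rfl⟩
  have hk : 0 < v.length := List.length_pos_iff.2 (hv ▸ expandVector_ne_nil hL)
  have hmono := pairwise_expandVector hL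
  rw [← hv, List.pairwise_iff_getElem] at hmono
  have hget : ∀ i (hi : i < v.length), v.getD i 0 = v[i] := fun i hi =>
    List.getD_eq_getElem _ _ hi
  obtain ⟨τ, h⟩ := exists_lorenzData (d := fun i => v.getD i 0) hk
    (fun i hi => by
      simp only [hget i hi]
      exact mem_expandVector_pos hL (hv ▸ List.getElem_mem hi))
    (fun i j hij hj => by
      simp only [hget j hj, hget i (hij.trans_lt hj)]
      rcases hij.lt_or_eq with hlt | rfl
      · exact hmono i j (hij.trans_lt hj) hj hlt
      · rfl) rfl
  refine ⟨_, τ, v.length, h.n_pos, h.isShuffle, h.apply_ne, ?_⟩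
  have hlen := lorenzVector_length τ h.isShuffle.1
  rw [← hv]
  refine List.ext_getElem hlen fun i h1 h2 => ?_
  have h3 := lorenzVector_getD τ ⟨i, by have := h.card; lia⟩ h2
  have h4 := h.σ_up ⟨i, by have := h.card; lia⟩ h2
  simp only [hget i h2] at h4
  rw [List.getD_eq_getElem _ _ h1] at h3
  rw [h3, h4]
  simp

/-- The Lorenz vector of a shuffle without fixed points comes from twist data. -/
lemma exists_twistData {n k : ℕ} {σ : Equiv.Perm (Fin n)} (hn : 0 < n) (hs : IsShuffle σ k)
    (hf : ∀ i, σ i ≠ i) : ∃ L, IsTwistData L ∧ expandVector L = lorenzVector σ k := by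
  obtain ⟨p, ι, h⟩ := hs.exists_lorenzData hf hn
  have hlen := lorenzVector_length σ hs.1
  have hget : ∀ i (hi : i < (lorenzVector σ k).length),
      (lorenzVector σ k).getD i 0 = (lorenzVector σ k)[i] := fun i hi =>
    List.getD_eq_getElem _ _ hi
  apply exists_expandVector_eq
  · rw [← List.length_pos_iff, hlen]
    exact h.k_pos
  · intro x hx
    obtain ⟨i, hi, rfl⟩ := List.getElem_of_mem hx
    rw [← hget i hi]
    exact h.d_pos i (hlen ▸ hi)
  · rw [List.pairwise_iff_getElem]
    intro i j hi hj hij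
    rw [← hget i hi, ← hget j hj]
    exact h.d_mono hij.le (hlen ▸ hj)

theorem theorem2 :
    (∀ K : PolygonalCurve, IsDiagonalLink K ↔ IsTwistedLink K) ∧
    (∀ L : List (ℕ × ℕ), IsTwistData L →
      (∃ (n : ℕ) (σ : Equiv.Perm (Fin n)) (k : ℕ),
        IsShuffle σ k ∧ (∀ i, σ i ≠ i) ∧ lorenzVector σ k = expandVector L) ∧
      (∀ (n : ℕ) (σ : Equiv.Perm (Fin n)) (k : ℕ),
        IsShuffle σ k → (∀ i, σ i ≠ i) → lorenzVector σ k = expandVector L →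
          PolygonalCurve.Isotopic (diagLink σ) (tLink L))) := by
  refine ⟨fun K => ⟨?_, ?_⟩, fun L hL => ⟨?_, fun n σ k hs hf hv => ?_⟩⟩
  · rintro ⟨n, hn, σ, k, hs, hf, hK⟩
    obtain ⟨L, hL, hv⟩ := exists_twistData hn hs hf
    exact ⟨L, hL, hK.trans (isotopic_diagLink_tLink hs hf hL hv.symm)⟩
  · rintro ⟨L, hL, hK⟩
    obtain ⟨n, σ, k, hn, hs, hf, hv⟩ := exists_shuffle hL
    exact ⟨n, hn, σ, k, hs, hf, hK.trans (isotopic_diagLink_tLink hs hf hL hv).symm⟩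
  · obtain ⟨n, σ, k, -, hs, hf, hv⟩ := exists_shuffle hL
    exact ⟨n, σ, k, hs, hf, hv⟩
  · exact isotopic_diagLink_tLink hs hf hL hv
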